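/- Let $\mathbb T$ be the unit circle with normalized Haar measure $\mu$, let $r(z)=z^3$ and $m_0(z)=\frac{1}{\sqrt2}(1+z^2)$ for $z\in\mathbb T$. A \emph{wavelet representation} associated to $m_0$ is a quadruple $(\mathcal H,U,\pi,\varphi)$ consisting of a complex Hilbert space $\mathcal H$, a unitary operator $U$ on $\mathcal H$, a (unital) $*$-representation $\pi$ of $L^\infty(\mathbb T,\mu)$ on $\mathcal H$ and a vector $\varphi\in\mathcal H$ such that (1) $U\pi(f)U^{-1}=\pi(f\circ r)$ for all $f\in L^\infty(\mathbb T,\mu)$; (2) $U\varphi=\pi(m_0)\varphi$; (3) $\langle\pi(f)\varphi,\varphi\rangle=\int_{\mathbb T} f\,d\mu$ for all $f\in L^\infty(\mathbb T,\mu)$; (4) $\{U^{-n}\pi(f)\varphi : n\in\mathbb N,\ f\in L^\infty(\mathbb T,\mu)\}$ is dense in $\mathcal H$. It is \emph{irreducible} if the only bounded operators on $\mathcal H$ that commute with $U$ and with every $\pi(f)$, $f\in L^\infty(\mathbb T,\mu)$, are the scalar multiples of the identity. Let $\mathbf C\subset[0,1]$ be the middle third Cantor set, $\mathcal R:=\bigcup\{\mathbf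 C+\frac{k}{3^n} : k,n\in\mathbb Z\}$, and let $\mathfrak H^s$ be the Hausdorff measure of dimension $s=\log_3 2$, restricted to $\mathcal R$. \textbf{Theorem.} A wavelet representation associated to $m_0$ exists, and for every wavelet representation $(\mathcal H,U,\pi,\varphi)$ associated to $m_0$ the following assertions are equivalent: (i) The wavelet representation $(\mathcal H,U,\pi,\varphi)$ is irreducible. (ii) If a sequence $(a_k)_{k\in\mathbb Z}\in\ell^2(\mathbb Z)$ of complex numbers is such that $\sum_{k\in\mathbb Z}a_kz^k\in L^\infty(\mathbb T,\mu)$ and $$a_k=\tfrac12a_{3k-2}+a_{3k}+\tfrac12a_{3k+2}\qquad(k\in\mathbb Z),$$ then $a_k=0$ for all $k\neq0$. (iii) If a function $\xi\in L^2(\mathcal R,\mathfrak H^s)$ satisfies the refinement equation $$\xi(x)=\xi(3x)+\xi(3x-2)\qquad\text{for }\mathfrak H^s\text{-a.e. }x\in\mathcal R,$$ then $\xi$ is ($\mathfrak H^s$-a.e.) a constant multiple of the characteristic function of $\mathbf C$. -/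

import Mathlib

open MeasureTheory AddCircle
open scoped ENNReal

noncomputable section

namespace CantorWavelet

universe u v

/-! ### Wavelet representations -/

section General

variable {X : Type u} [MeasurableSpace X]

/-- A (unital) `*`-representation of the algebra `L^∞(X, μ)` by bounded operators on the Hilbert
space `H`.  Products and the unit of `L^∞` are expressed through almost everywhere equality. -/
structure LInftyRep (μ : Measure X) (H : Type v) [NormedAddCommGroup H] [InnerProductSpace ℂ H]
    [CompleteSpace H] extends Lp ℂ ∞ μ →ₗ[ℂ] (H →L[ℂ] H) where
  map_one : ∀ e : Lp ℂ ∞ μ, (∀ᵐ x ∂μ, e x = 1) → toFun e = 1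
  map_mul : ∀ f g h : Lp ℂ ∞ μ, (∀ᵐ x ∂μ, h x = f x * g x) → toFun h = toFun f * toFun g
  map_star : ∀ f : Lp ℂ ∞ μ, toFun (star f) = ContinuousLinearMap.adjoint (toFun f)

variable {μ : Measure X} {H : Type v} [NormedAddCommGroup H] [InnerProductSpace ℂ H]
  [CompleteSpace H]

instance : CoeFun (LInftyRep μ H) (fun _ => Lp ℂ ∞ μ → (H →L[ℂ] H)) where
  coe π := π.toFun

/-- `(H, U, π, φ)` is a wavelet representation associated to the filter `m₀ ∈ L^∞(X, μ)` and the
`μ`-preserving map `r : X → X`. -/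
structure IsWaveletRep (r : X → X) (hr : MeasurePreserving r μ μ) (m₀ : Lp ℂ ∞ μ)
    (U : H ≃ₗᵢ[ℂ] H) (π : LInftyRep μ H) (φ : H) : Prop where
  /-- `U π(f) U⁻¹ = π(f ∘ r)` -/
  covariance : ∀ (f : Lp ℂ ∞ μ) (v : H),
    U (π f (U.symm v)) = π (Lp.compMeasurePreserving r hr f) v
  /-- `U φ = π(m₀) φ` -/
  scaling : U φ = π m₀ φ
  /-- `⟨π(f) φ, φ⟩ = ∫ f dμ` (Mathlib's inner product is linear in the second variable) -/
  orthogonality : ∀ f : Lp ℂ ∞ μ, inner ℂ φ (π f φ) = ∫ x, f x ∂μ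
  /-- `{U⁻ⁿ π(f) φ : n ∈ ℕ, f ∈ L^∞}` is dense -/
  density : Dense {v : H | ∃ (n : ℕ) (f : Lp ℂ ∞ μ), v = (U.symm)^[n] (π f φ)}

/-- The commutant of `U` and of all `π(f)` in the bounded operators consists of the scalars. -/
def IsIrreducible (U : H ≃ₗᵢ[ℂ] H) (π : LInftyRep μ H) : Prop :=
  ∀ A : H →L[ℂ] H, (∀ v, A (U v) = U (A v)) → (∀ f v, A (π f v) = π f (A v)) →
    ∃ c : ℂ, A = c • (1 : H →L[ℂ] H)

end General

/-! ### The filter of the Cantor set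

The unit circle is modelled by `ℝ / ℤ`, with `z = exp (2 π i t)`; `fourier n` is `z ↦ z ^ n` and
`haarAddCircle` is the normalised Haar measure. -/

/-- The map `z ↦ z ^ 3` of the circle, written additively. -/
def cubeMap (t : AddCircle (1 : ℝ)) : AddCircle (1 : ℝ) := (3 : ℕ) • t

theorem measurePreserving_cubeMap :
    MeasurePreserving cubeMap (haarAddCircle (T := (1 : ℝ))) (haarAddCircle (T := (1 : ℝ))) := by
  have h := (AddCircle.ergodic_nsmul (T := (1 : ℝ)) (n := 3) (by norm_num)).toMeasurePreserving
  rw [volume_eq_smul_haarAddCircle] at h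
  simp only [ENNReal.ofReal_one, one_smul] at h
  exact h

/-- The filter `m₀(z) = (1 + z ^ 2) / √2` as an element of `L^∞` of the circle. -/
def cantorFilter : Lp ℂ ∞ (haarAddCircle (T := (1 : ℝ))) :=
  ContinuousMap.toLp ∞ (haarAddCircle (T := (1 : ℝ))) ℂ
    (((Real.sqrt 2 : ℝ) : ℂ)⁻¹ • (1 + fourier 2))

/-- `(H, U, π, φ)` is the wavelet representation associated to `r(z) = z ^ 3` and
`m₀(z) = (1 + z ^ 2) / √2`. -/
abbrev IsCantorWaveletRep {H : Type v} [NormedAddCommGroup H] [InnerProductSpace ℂ H]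
    [CompleteSpace H] (U : H ≃ₗᵢ[ℂ] H) (π : LInftyRep (haarAddCircle (T := (1 : ℝ))) H) (φ : H) : Prop :=
  IsWaveletRep cubeMap measurePreserving_cubeMap cantorFilter U π φ

/-- For `a ∈ ℓ²(ℤ)`, the function `∑ a_k z ^ k` in `L²` of the circle. -/
def fourierSeries (a : lp (fun _ : ℤ => ℂ) 2) : Lp ℂ 2 (haarAddCircle (T := (1 : ℝ))) :=
  fourierBasis.repr.symm a

/-! ### The Hausdorff measure on the enlarged Cantor set -/

/-- `𝓡 = ⋃ (C + k / 3 ^ n)` over `k, n ∈ ℤ`, with `C` the middle third Cantor set. -/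
def enlargedCantorSet : Set ℝ :=
  ⋃ (k : ℤ) (n : ℤ), (fun x : ℝ => x + (k : ℝ) / (3 : ℝ) ^ n) '' cantorSet

/-- The Hausdorff measure of dimension `log₃ 2`, restricted to `𝓡`. -/
def cantorHausdorff : Measure ℝ :=
  (Measure.hausdorffMeasure (Real.logb 3 2)).restrict enlargedCantorSet

end CantorWavelet

end

/-! All three assertions are equivalent to a fourth one, `BoundedHarmonicConst`. Call `h` harmonic
if `h(z³)` is the average of `h` over the three cube roots of `z³`, with weights `|m₀|² / 3`; these
weights add up to 1 on every fibre. The pivot says that bounded harmonic functions are constant.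

The sequence condition is the pivot read on Fourier coefficients: `h ∘ r` and the weighted fibre sum
have spectrum in `3ℤ`, and equality of their coefficients at `3k` is the recursion
(`isHarmonic_iff`, `boundedHarmonicConst_iff`).

For the refinement equation, the relevant structure of `L²(𝓡, 𝓗ˢ)` is abstracted as
`IsCantorSystem`: a dilation, integer translations and an orthonormal, generating scaling vector
`φ`. Every wavelet representation gives such a system too, with `π(z^k)` as translations. In any
system a solution `ξ` of the refinement equation yields the harmonic function with Fourier
coefficients `⟨τ_k φ, ξ⟩`, and `ξ` is determined by it. This function need not be bounded; only its
integrals against the products `∏ |m₀(z^{3^j})|²` are controlled, in square mean. The main analytic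
step (`BoundedHarmonicConst.transferSup_const`, `BoundedHarmonicConst.real`) upgrades the pivot to
such functions by truncating least harmonic majorants. Conversely a bounded harmonic `h` produces a
solution as a weak limit of the vectors `U⁻ⁿ` applied to the synthesis of `h · ∏_{j<n} m₀(z^{3^j})`.
This proves `IsCantorSystem.refinementUnique_iff`.

For irreducibility, an operator `A` in the commutant sends `φ` to a solution of the refinement
equation, so uniqueness and density make `A` scalar. Conversely a bounded harmonic `h` gives an
element of the commutant, a weak limit of `U⁻ⁿ π(h) Uⁿ`; if it is scalar, then `h` is constant.

Two constructions remain. Existence comes from completing `m₀` to a filter bank whose isometries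
satisfy the Cuntz relations, on a countable sum of copies of `L²`. That `L²(𝓡, 𝓗ˢ)` is a Cantor
system needs `0 < 𝓗ˢ(C) < ∞` and a totality argument with triadic copies of `C`. -/

noncomputable section

namespace CantorWavelet

local notation "𝕋" => AddCircle (1 : ℝ)
local notation "μT" => haarAddCircle (T := (1 : ℝ))

/-! ### Fibres of the cube map -/

/-- The point `1 / 3` of the circle. -/
def third : 𝕋 := ((1 / 3 : ℝ) : 𝕋)

theorem third_add_third_add_third : third + third + third = 0 := by
  have : third + third + third = ((1 / 3 + 1 / 3 + 1 / 3 : ℝ) : 𝕋) := by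
    simp [third]
  rw [this, AddCircle.coe_eq_zero_iff]
  exact ⟨1, by norm_num⟩

theorem cubeMap_add (s t : 𝕋) : cubeMap (s + t) = cubeMap s + cubeMap t := smul_add _ _ _

theorem cubeMap_third : cubeMap third = 0 := by
  rw [cubeMap, ← third_add_third_add_third]; abel

@[simp] theorem cubeMap_add_third (t : 𝕋) : cubeMap (t + third) = cubeMap t := by
  rw [cubeMap_add, cubeMap_third, add_zero]

theorem continuous_cubeMap : Continuous cubeMap := continuous_const_smul (3 : ℕ)

theorem measurable_cubeMap : Measurable cubeMap := continuous_cubeMap.measurable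

theorem fourier_cubeMap (n : ℤ) (t : 𝕋) :
    (fourier n (cubeMap t) : ℂ) = fourier (3 * n) t := by
  rw [fourier_apply, fourier_apply, cubeMap]
  congr 2
  rw [← natCast_zsmul, smul_smul]
  congr 1
  push_cast; ring

theorem fourier_add_arg (n : ℤ) (s t : 𝕋) :
    (fourier n (s + t) : ℂ) = fourier n s * fourier n t := by
  simp only [fourier_apply, smul_add, toCircle_add, Circle.coe_mul]

theorem fourier_third_pow_three (n : ℤ) : (fourier n third : ℂ) ^ 3 = 1 := by
  have h : (fourier n (third + third + third) : ℂ) = 1 := by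
    rw [third_add_third_add_third, fourier_eval_zero]
  rw [fourier_add_arg, fourier_add_arg] at h
  rw [← h]; ring

theorem fourier_third_eq_one_iff (n : ℤ) : (fourier n third : ℂ) = 1 ↔ (3 : ℤ) ∣ n := by
  rw [third, fourier_coe_apply, Complex.exp_eq_one_iff]
  have h2 : (2 * Real.pi * Complex.I : ℂ) ≠ 0 := Complex.two_pi_I_ne_zero
  constructor
  · rintro ⟨m, hm⟩
    refine ⟨m, ?_⟩
    have h3 : (2 * Real.pi * Complex.I : ℂ) * n = (2 * Real.pi * Complex.I : ℂ) * (3 * m : ℤ) := by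
      push_cast at hm ⊢
      linear_combination 3 * hm
    exact_mod_cast mul_left_cancel₀ h2 h3
  · rintro ⟨m, rfl⟩
    refine ⟨m, ?_⟩
    push_cast; ring

/-- The sum of `f` over the fibre of the cube map through `t`. -/
def fiberSum {M : Type*} [Add M] (f : 𝕋 → M) (t : 𝕋) : M :=
  f t + f (t + third) + f (t + third + third)

theorem fiberSum_add_third {M : Type*} [AddCommMonoid M] (f : 𝕋 → M) (t : 𝕋) :
    fiberSum f (t + third) = fiberSum f t := by
  have : t + third + third + third = t := by
    rw [add_assoc, add_assoc, ← add_assoc third, third_add_third_add_third, add_zero]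
  simp only [fiberSum, this]
  abel

theorem fiberSum_fourier (n : ℤ) (t : 𝕋) :
    fiberSum (fun x => (fourier n x : ℂ)) t = if (3 : ℤ) ∣ n then 3 * fourier n t else 0 := by
  have h3 := fourier_third_pow_three n
  simp only [fiberSum, fourier_add_arg]
  split_ifs with h
  · rw [(fourier_third_eq_one_iff n).2 h]; ring
  · have h1 : (fourier n third : ℂ) - 1 ≠ 0 :=
      sub_ne_zero.2 (mt (fourier_third_eq_one_iff n).1 h)
    have h2 : (1 : ℂ) + fourier n third + fourier n third ^ 2 = 0 := by
      apply mul_left_cancel₀ h1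
      linear_combination h3
    linear_combination (fourier n t : ℂ) * h2

/-- A measurable section of the cube map. -/
def cubeSection (t : 𝕋) : 𝕋 := (((AddCircle.measurableEquivIco 1 0 t : ℝ) / 3 : ℝ) : 𝕋)

theorem measurable_cubeSection : Measurable cubeSection := by
  unfold cubeSection
  exact AddCircle.measurable_mk'.comp
    ((measurable_subtype_coe.comp (AddCircle.measurableEquivIco 1 0).measurable).div_const 3)

theorem cubeMap_cubeSection (t : 𝕋) : cubeMap (cubeSection t) = t := by
  have h : (((AddCircle.measurableEquivIco 1 0 t : ℝ)) : 𝕋) = t :=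
    (AddCircle.equivIco 1 0).symm_apply_apply t
  conv_rhs => rw [← h]
  rw [cubeMap, cubeSection, ← AddCircle.coe_nsmul]
  congr 1
  simp only [nsmul_eq_mul]
  push_cast; ring

theorem cubeSection_cubeMap (t : 𝕋) : cubeSection (cubeMap t) = t ∨
    cubeSection (cubeMap t) = t + third ∨ cubeSection (cubeMap t) = t + third + third := by
  have h : (3 : ℕ) • (cubeSection (cubeMap t) - t) = 0 := by
    rw [smul_sub, sub_eq_zero]
    exact cubeMap_cubeSection (cubeMap t)
  rw [AddCircle.nsmul_eq_zero_iff (by norm_num)] at h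
  obtain ⟨m, hm, hm'⟩ := h
  have h2 : cubeSection (cubeMap t) = t + m • third := by
    rw [← sub_eq_iff_eq_add', ← hm', third, ← AddCircle.coe_nsmul]
    congr 1
    simp [nsmul_eq_mul, div_eq_mul_inv]
  interval_cases m
  · left; simpa using h2
  · right; left; simpa using h2
  · right; right; rw [h2, two_nsmul, add_assoc]

/-- The section returns some point of the same fibre, and a fibre sum does not depend on the base
point chosen. -/
theorem fiberSum_cubeSection_cubeMap {M : Type*} [AddCommMonoid M] (f : 𝕋 → M) (t : 𝕋) :
    fiberSum f (cubeSection (cubeMap t)) = fiberSum f t := by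
  rcases cubeSection_cubeMap t with h | h | h <;> simp [h, fiberSum_add_third]

theorem measurePreserving_add_third : MeasurePreserving (· + third) μT μT :=
  measurePreserving_add_right _ third

/-- As `G` is constant on fibres, each of the three terms is a translate of `f * G`, and Haar
measure is translation invariant. -/
theorem integral_fiberSum_mul (f G : 𝕋 → ℂ) (hf : Integrable (fun t => f t * G t) μT)
    (hG : ∀ t, G (t + third) = G t) :
    ∫ t, fiberSum f t * G t ∂μT = 3 * ∫ t, f t * G t ∂μT := by
  have e1 := measurePreserving_add_third.integrable_comp_of_integrable hf
  have e2 := measurePreserving_add_third.integrable_comp_of_integrable e1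
  have i1 : ∫ t, f (t + third) * G t ∂μT = ∫ t, f t * G t ∂μT := by
    rw [← integral_add_right_eq_self (fun t => f t * G t) third]
    simp [hG]
  have i2 : ∫ t, f (t + third + third) * G t ∂μT = ∫ t, f t * G t ∂μT := by
    rw [← i1, ← integral_add_right_eq_self (fun t => f (t + third) * G t) third]
    simp [hG]
  simp only [Function.comp_def, hG] at e1 e2
  simp only [fiberSum, add_mul]
  rw [integral_add (f := fun t => f t * G t + f (t + third) * G t) (hf.add e1) e2,
    integral_add hf e1, i1, i2]
  ring

theorem lintegral_fiberSum_mul (f G : 𝕋 → ℝ≥0∞) (hf : Measurable f) (hGm : Measurable G)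
    (hG : ∀ t, G (t + third) = G t) :
    ∫⁻ t, fiberSum f t * G t ∂μT = 3 * ∫⁻ t, f t * G t ∂μT := by
  have m1 : Measurable fun t : 𝕋 => t + third := measurable_add_const third
  have i1 : ∫⁻ t, f (t + third) * G t ∂μT = ∫⁻ t, f t * G t ∂μT := by
    rw [← lintegral_add_right_eq_self (fun t => f t * G t) third]
    simp [hG]
  have i2 : ∫⁻ t, f (t + third + third) * G t ∂μT = ∫⁻ t, f t * G t ∂μT := by
    rw [← i1, ← lintegral_add_right_eq_self (fun t => f (t + third) * G t) third]
    simp [hG]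
  simp only [fiberSum, add_mul]
  rw [lintegral_add_left (by fun_prop), lintegral_add_left (by fun_prop), i1, i2]
  ring

/-! ### The weight `|m₀|²` -/

/-- The weight `|m₀(z)|² / 3` of the transfer operator. -/
def weight (t : 𝕋) : ℝ := ‖(1 : ℂ) + fourier 2 t‖ ^ 2 / 6

theorem weight_nonneg (t : 𝕋) : 0 ≤ weight t := by unfold weight; positivity

theorem continuous_weight : Continuous weight := by unfold weight; fun_prop

theorem ofReal_weight (t : 𝕋) :
    (weight t : ℂ) = (2 + fourier 2 t + fourier (-2) t) / 6 := by
  have h : (fourier 2 t : ℂ) * fourier (-2) t = 1 := by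
    rw [← fourier_add]; simp
  have h1 : ((‖(1 : ℂ) + fourier 2 t‖ ^ 2 : ℝ) : ℂ)
      = (1 + fourier 2 t) * (1 + fourier (-2) t) := by
    rw [fourier_neg, Complex.ofReal_pow, ← Complex.mul_conj', map_add, map_one]
  rw [weight, Complex.ofReal_div, h1]
  push_cast
  linear_combination h / 6

theorem weight_le (t : 𝕋) : weight t ≤ 1 := by
  have h1 : ‖(1 : ℂ) + fourier 2 t‖ ≤ 2 := by
    refine (norm_add_le _ _).trans ?_
    rw [fourier_apply, Circle.norm_coe, norm_one]; norm_num
  unfold weight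
  nlinarith [norm_nonneg ((1 : ℂ) + fourier 2 t)]

/-- The modes `z^{±2}` of the weight cancel over a fibre because 3 does not divide 2; the constant
mode contributes `3 · 2/6`. -/
theorem fiberSum_weight (t : 𝕋) : fiberSum weight t = 1 := by
  have h2 := fiberSum_fourier 2 t
  have h3 := fiberSum_fourier (-2) t
  rw [if_neg (by decide)] at h2 h3
  have : ((fiberSum weight t : ℝ) : ℂ) = 1 := by
    simp only [fiberSum, Complex.ofReal_add, ofReal_weight] at h2 h3 ⊢
    linear_combination (h2 + h3) / 6
  exact_mod_cast this

/-! ### Fourier coefficients -/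

theorem fourierCoeff_eq_repr {f : 𝕋 → ℂ} (hf : MemLp f 2 μT) (n : ℤ) :
    fourierBasis.repr (hf.toLp f) n = fourierCoeff f n := by
  rw [fourierBasis_repr]
  exact congrFun (fourierCoeff_congr_ae hf.coeFn_toLp) n

theorem ae_eq_of_fourierCoeff_eq {f g : 𝕋 → ℂ} (hf : MemLp f 2 μT) (hg : MemLp g 2 μT)
    (h : ∀ n, fourierCoeff f n = fourierCoeff g n) : f =ᵐ[μT] g := by
  rw [← MemLp.toLp_eq_toLp_iff hf hg]
  apply fourierBasis.repr.injective
  ext n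
  rw [fourierCoeff_eq_repr, fourierCoeff_eq_repr, h]

theorem fourierCoeff_def (f : 𝕋 → ℂ) (n : ℤ) :
    fourierCoeff f n = ∫ t, fourier (-n) t * f t ∂μT := rfl

theorem fourierCoeff_fourier_mul (f : 𝕋 → ℂ) (k n : ℤ) :
    fourierCoeff (fun t => fourier k t * f t) n = fourierCoeff f (n - k) := by
  simp only [fourierCoeff_def, ← mul_assoc, ← fourier_add]
  congr! 4
  ring_nf

theorem fourierCoeff_eq_zero_of_invariant {f : 𝕋 → ℂ} (hf : ∀ t, f (t + third) = f t) {n : ℤ}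
    (hn : ¬ (3 : ℤ) ∣ n) : fourierCoeff f n = 0 := by
  have h1 : (fourier (-n) third : ℂ) ≠ 1 := by
    rw [Ne, fourier_third_eq_one_iff, dvd_neg]; exact hn
  have h2 : fourierCoeff f n = fourier (-n) third * fourierCoeff f n := by
    conv_lhs => rw [fourierCoeff_def, ← integral_add_right_eq_self _ third]
    rw [fourierCoeff_def, ← integral_const_mul]
    congr 1; ext t
    rw [hf, fourier_add_arg]; ring
  have h3 : (fourier (-n) third - 1 : ℂ) * fourierCoeff f n = 0 := by
    linear_combination -h2
  exact (mul_eq_zero.1 h3).resolve_left (sub_ne_zero.2 h1)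

theorem fourierCoeff_comp_cubeMap {f : 𝕋 → ℂ} (hf : AEStronglyMeasurable f μT) (k : ℤ) :
    fourierCoeff (f ∘ cubeMap) (3 * k) = fourierCoeff f k := by
  rw [fourierCoeff_def, fourierCoeff_def]
  have h := measurePreserving_cubeMap.map_eq
  conv_rhs => rw [← h]
  rw [integral_map measurable_cubeMap.aemeasurable]
  · simp only [Function.comp_apply, fourier_cubeMap, mul_neg]
  · rw [h]
    exact (fourier (-k)).continuous.aestronglyMeasurable.mul hf

theorem memLp_fiberSum {f : 𝕋 → ℂ} {p : ℝ≥0∞} (hf : MemLp f p μT) : MemLp (fiberSum f) p μT := by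
  have h1 := hf.comp_measurePreserving measurePreserving_add_third
  have h2 := h1.comp_measurePreserving measurePreserving_add_third
  exact (hf.add h1).add h2

theorem memLp_weight_mul {f : 𝕋 → ℂ} {p : ℝ≥0∞} (hf : MemLp f p μT) :
    MemLp (fun t => (weight t : ℂ) * f t) p μT := by
  refine hf.of_le ?_ (.of_forall fun t => ?_)
  · exact (Complex.continuous_ofReal.comp continuous_weight).aestronglyMeasurable.mul hf.1
  · rw [norm_mul, Complex.norm_real, Real.norm_of_nonneg (weight_nonneg t)]
    exact mul_le_of_le_one_left (norm_nonneg _) (weight_le t)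

/-- `h` is harmonic for the transfer operator: `h(z³) = ⅓ ∑_{w³ = z³} |m₀(w)|² h(w)`. -/
def IsHarmonic (h : 𝕋 → ℂ) : Prop :=
  h ∘ cubeMap =ᵐ[μT] fiberSum fun t => (weight t : ℂ) * h t

/-- The character `z^{-3k}` is constant on fibres, so the fibre sum unfolds to an integral against
`3 * weight = 1 + z²/2 + z⁻²/2`. -/
theorem fourierCoeff_fiberSum_weight_mul {h : 𝕋 → ℂ} (hh : MemLp h 2 μT) (k : ℤ) :
    fourierCoeff (fiberSum fun t => (weight t : ℂ) * h t) (3 * k) =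
      1 / 2 * fourierCoeff h (3 * k - 2) + fourierCoeff h (3 * k)
        + 1 / 2 * fourierCoeff h (3 * k + 2) := by
  have hfi : Integrable h μT := hh.integrable (by norm_num)
  have hw : Integrable (fun t => (weight t : ℂ) * h t) μT :=
    (memLp_weight_mul hh).integrable (by norm_num)
  have h0 : fourierCoeff (fiberSum fun t => (weight t : ℂ) * h t) (3 * k) =
      3 * ∫ t, (weight t : ℂ) * h t * fourier (-(3 * k)) t ∂μT := by
    rw [fourierCoeff_def, ← integral_fiberSum_mul]
    · simp only [mul_comm]
    · have := hw.fourier_smul (-(3 * k))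
      simpa only [smul_eq_mul, mul_comm] using this
    · intro t
      rw [fourier_add_arg, (fourier_third_eq_one_iff _).2, mul_one]
      rw [dvd_neg]; exact dvd_mul_right _ _
  rw [h0]
  have e1 := hfi.fourier_smul (-(3 * k))
  have e2 := hfi.fourier_smul (-(3 * k - 2))
  have e3 := hfi.fourier_smul (-(3 * k + 2))
  simp only [smul_eq_mul] at e1 e2 e3
  simp only [fourierCoeff_def]
  rw [← integral_const_mul, ← integral_const_mul, ← integral_const_mul, ← integral_add,
    ← integral_add]
  · congr 1; ext t
    rw [ofReal_weight, show -(3 * k - 2) = -(3 * k) + 2 by ring,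
      show -(3 * k + 2) = -(3 * k) + -2 by ring, fourier_add, fourier_add]
    ring
  · exact (e2.const_mul _).add e1
  · exact e3.const_mul _
  · exact e2.const_mul _
  · exact e1

/-- Both sides of the harmonic equation are invariant under `third`, so only coefficients at
multiples of 3 can differ. -/
theorem isHarmonic_iff {h : 𝕋 → ℂ} (hh : MemLp h 2 μT) :
    IsHarmonic h ↔ ∀ k : ℤ, fourierCoeff h k = 1 / 2 * fourierCoeff h (3 * k - 2)
      + fourierCoeff h (3 * k) + 1 / 2 * fourierCoeff h (3 * k + 2) := by
  have hc : MemLp (h ∘ cubeMap) 2 μT := hh.comp_measurePreserving measurePreserving_cubeMap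
  have hs := memLp_fiberSum (memLp_weight_mul hh)
  constructor
  · intro H k
    rw [← fourierCoeff_fiberSum_weight_mul hh, ← fourierCoeff_comp_cubeMap hh.1]
    exact congrFun (fourierCoeff_congr_ae H) _
  · intro H
    refine ae_eq_of_fourierCoeff_eq hc hs fun n => ?_
    by_cases hn : (3 : ℤ) ∣ n
    · obtain ⟨k, rfl⟩ := hn
      rw [fourierCoeff_comp_cubeMap hh.1, fourierCoeff_fiberSum_weight_mul hh, H]
    · rw [fourierCoeff_eq_zero_of_invariant (fun t => by simp) hn,
        fourierCoeff_eq_zero_of_invariant (fun t => fiberSum_add_third _ t) hn]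

/-- Pull `h * G` back along the measure-preserving cube map, replace `h ∘ cubeMap` by the fibre sum
and unfold. In this form harmonicity says that `π h` has the same matrix coefficients after
dilation. -/
theorem IsHarmonic.integral_mul {h G : 𝕋 → ℂ} (hh : IsHarmonic h) (hm : AEStronglyMeasurable h μT)
    (hG : AEStronglyMeasurable G μT) (hi : Integrable (fun t => h t * G (cubeMap t)) μT) :
    ∫ t, 3 * (weight t : ℂ) * h t * G (cubeMap t) ∂μT = ∫ t, h t * G t ∂μT := by
  have e := measurePreserving_cubeMap.map_eq
  conv_rhs => rw [← e]
  rw [integral_map measurable_cubeMap.aemeasurable (by rw [e]; exact hm.mul hG)]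
  have : ∫ t, h (cubeMap t) * G (cubeMap t) ∂μT
      = ∫ t, fiberSum (fun t => (weight t : ℂ) * h t) t * G (cubeMap t) ∂μT := by
    refine integral_congr_ae ?_
    filter_upwards [hh] with t ht
    rw [← ht, Function.comp_apply]
  rw [this, integral_fiberSum_mul, ← integral_const_mul]
  · simp only [mul_assoc]
  · have := memLp_weight_mul (memLp_one_iff_integrable.2 hi)
    simpa only [mul_assoc] using memLp_one_iff_integrable.1 this
  · simp

/-! ### The transfer operator on nonnegative functions -/

open Filter Topology

/-- The transfer operator `f ↦ ⅓ ∑_{w³ = z} |m₀(w)|² f(w)` on nonnegative functions. -/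
def transfer (f : 𝕋 → ℝ≥0∞) (t : 𝕋) : ℝ≥0∞ :=
  fiberSum (fun x => ENNReal.ofReal (weight x) * f x) (cubeSection t)

theorem transfer_cubeMap (f : 𝕋 → ℝ≥0∞) (t : 𝕋) :
    transfer f (cubeMap t) = fiberSum (fun x => ENNReal.ofReal (weight x) * f x) t :=
  fiberSum_cubeSection_cubeMap _ t

theorem measurable_transfer {f : 𝕋 → ℝ≥0∞} (hf : Measurable f) : Measurable (transfer f) := by
  have hw : Measurable fun x => ENNReal.ofReal (weight x) * f x :=
    continuous_weight.measurable.ennreal_ofReal.mul hf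
  have h1 : Measurable fun t : 𝕋 => t + third := measurable_add_const third
  have h2 : Measurable (fiberSum fun x => ENNReal.ofReal (weight x) * f x) :=
    (hw.add (hw.comp h1)).add (hw.comp (h1.comp h1))
  exact h2.comp measurable_cubeSection

theorem transfer_mono {f g : 𝕋 → ℝ≥0∞} (h : ∀ t, f t ≤ g t) (t : 𝕋) :
    transfer f t ≤ transfer g t := by
  simp only [transfer, fiberSum]
  gcongr <;> exact h _

theorem transfer_add (f g : 𝕋 → ℝ≥0∞) : transfer (f + g) = transfer f + transfer g := by
  ext t
  simp only [transfer, fiberSum, Pi.add_apply, mul_add]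
  ring

theorem ofReal_weight_add (t : 𝕋) : ENNReal.ofReal (weight t)
    + ENNReal.ofReal (weight (t + third)) + ENNReal.ofReal (weight (t + third + third)) = 1 := by
  rw [← ENNReal.ofReal_add (weight_nonneg _) (weight_nonneg _),
    ← ENNReal.ofReal_add (add_nonneg (weight_nonneg _) (weight_nonneg _)) (weight_nonneg _)]
  exact (congrArg ENNReal.ofReal (fiberSum_weight t)).trans ENNReal.ofReal_one

theorem transfer_const (c : ℝ≥0∞) : transfer (fun _ => c) = fun _ => c := by
  ext t
  simp only [transfer, fiberSum, ← add_mul, ofReal_weight_add, one_mul]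

/-- Jensen's inequality: the weights on a fibre form a probability vector. -/
theorem sq_transfer_le (f : 𝕋 → ℝ≥0∞) (t : 𝕋) :
    transfer f t ^ 2 ≤ transfer (fun x => f x ^ 2) t := by
  have h := ENNReal.rpow_arith_mean_le_arith_mean_rpow (Finset.univ : Finset (Fin 3))
    ![ENNReal.ofReal (weight (cubeSection t)), ENNReal.ofReal (weight (cubeSection t + third)),
      ENNReal.ofReal (weight (cubeSection t + third + third))]
    ![f (cubeSection t), f (cubeSection t + third), f (cubeSection t + third + third)]
    (by simpa [Fin.sum_univ_three] using ofReal_weight_add (cubeSection t)) (p := 2) (by norm_num)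
  simpa [Fin.sum_univ_three, transfer, fiberSum] using h

/-- `transfer f` has an explicit form only at points `cubeMap t`; this reduces almost everywhere
statements to such points. -/
theorem ae_of_ae_cubeMap {P : 𝕋 → Prop} (hP : MeasurableSet {t | P t})
    (h : ∀ᵐ t ∂μT, P (cubeMap t)) : ∀ᵐ t ∂μT, P t := by
  rw [← measurePreserving_cubeMap.map_eq]
  exact (ae_map_iff measurable_cubeMap.aemeasurable hP).2 h

theorem ae_cubeMap {P : 𝕋 → Prop} (h : ∀ᵐ t ∂μT, P t) : ∀ᵐ t ∂μT, P (cubeMap t) :=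
  measurePreserving_cubeMap.quasiMeasurePreserving.ae h

theorem ae_fiber {P : 𝕋 → Prop} (h : ∀ᵐ t ∂μT, P t) :
    ∀ᵐ t ∂μT, P t ∧ P (t + third) ∧ P (t + third + third) := by
  have h1 := measurePreserving_add_third.quasiMeasurePreserving.ae h
  have h2 := measurePreserving_add_third.quasiMeasurePreserving.ae h1
  filter_upwards [h, h1, h2] with t a b c using ⟨a, b, c⟩

theorem transfer_mono_ae {f g : 𝕋 → ℝ≥0∞} (hf : Measurable f) (hg : Measurable g)
    (h : f ≤ᵐ[μT] g) : transfer f ≤ᵐ[μT] transfer g := by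
  refine ae_of_ae_cubeMap (measurableSet_le (measurable_transfer hf) (measurable_transfer hg)) ?_
  filter_upwards [ae_fiber h] with t ht
  rw [transfer_cubeMap, transfer_cubeMap]
  simp only [fiberSum]
  gcongr
  exacts [ht.1, ht.2.1, ht.2.2]

theorem transfer_congr_ae {f g : 𝕋 → ℝ≥0∞} (hf : Measurable f) (hg : Measurable g)
    (h : f =ᵐ[μT] g) : transfer f =ᵐ[μT] transfer g :=
  (transfer_mono_ae hf hg h.le).antisymm (transfer_mono_ae hg hf h.symm.le)

theorem measurable_iterate_transfer {f : 𝕋 → ℝ≥0∞} (hf : Measurable f) (n : ℕ) :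
    Measurable (transfer^[n] f) := by
  induction n with
  | zero => exact hf
  | succ n ih => rw [Function.iterate_succ_apply']; exact measurable_transfer ih

theorem iterate_transfer_add (f g : 𝕋 → ℝ≥0∞) (n : ℕ) :
    transfer^[n] (f + g) = transfer^[n] f + transfer^[n] g := by
  induction n with
  | zero => rfl
  | succ n ih => simp only [Function.iterate_succ_apply', ih, transfer_add]

theorem iterate_transfer_mono_ae {f g : 𝕋 → ℝ≥0∞} (hf : Measurable f) (hg : Measurable g)
    (h : f ≤ᵐ[μT] g) (n : ℕ) : transfer^[n] f ≤ᵐ[μT] transfer^[n] g := by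
  induction n with
  | zero => exact h
  | succ n ih =>
    simp only [Function.iterate_succ_apply']
    exact transfer_mono_ae (measurable_iterate_transfer hf n) (measurable_iterate_transfer hg n) ih

theorem iterate_transfer_le {f : 𝕋 → ℝ≥0∞} {c : ℝ≥0∞} (h : ∀ t, f t ≤ c) (n : ℕ) (t : 𝕋) :
    transfer^[n] f t ≤ c := by
  induction n generalizing t with
  | zero => exact h t
  | succ n ih =>
    rw [Function.iterate_succ_apply']
    exact (transfer_mono ih t).trans_eq (congrFun (transfer_const c) t)

theorem iterate_transfer_eq_ae {f : 𝕋 → ℝ≥0∞} (hf : Measurable f) (h : transfer f =ᵐ[μT] f)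
    (n : ℕ) : transfer^[n] f =ᵐ[μT] f := by
  induction n with
  | zero => exact .rfl
  | succ n ih =>
    rw [Function.iterate_succ_apply']
    exact (transfer_congr_ae (measurable_iterate_transfer hf n) hf ih).trans h

theorem sq_iterate_transfer_le (f : 𝕋 → ℝ≥0∞) (n : ℕ) (t : 𝕋) :
    (transfer^[n] f t) ^ 2 ≤ transfer^[n] (fun x => f x ^ 2) t := by
  induction n generalizing t with
  | zero => exact le_rfl
  | succ n ih =>
    simp only [Function.iterate_succ_apply']
    exact (sq_transfer_le _ t).trans (transfer_mono ih t)

theorem ae_monotone_iterate_transfer {f : 𝕋 → ℝ≥0∞} (hf : Measurable f)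
    (h : f ≤ᵐ[μT] transfer f) : ∀ᵐ t ∂μT, Monotone fun n => transfer^[n] f t := by
  have : ∀ n, ∀ᵐ t ∂μT, transfer^[n] f t ≤ transfer^[n + 1] f t := fun n => by
    rw [Function.iterate_succ_apply]
    exact iterate_transfer_mono_ae hf (measurable_transfer hf) h n
  filter_upwards [ae_all_iff.2 this] with t ht using monotone_nat_of_le_succ ht

/-- The limit of the iterates of the transfer operator on a subharmonic function. -/
def transferSup (f : 𝕋 → ℝ≥0∞) (t : 𝕋) : ℝ≥0∞ := ⨆ n, transfer^[n] f t

theorem measurable_transferSup {f : 𝕋 → ℝ≥0∞} (hf : Measurable f) : Measurable (transferSup f) :=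
  Measurable.iSup fun n => measurable_iterate_transfer hf n

theorem le_transferSup (f : 𝕋 → ℝ≥0∞) (t : 𝕋) : f t ≤ transferSup f t :=
  le_iSup (fun n => transfer^[n] f t) 0

theorem ae_tendsto_iterate_transfer {f : 𝕋 → ℝ≥0∞} (hf : Measurable f)
    (h : f ≤ᵐ[μT] transfer f) :
    ∀ᵐ t ∂μT, Tendsto (fun n => transfer^[n] f t) atTop (𝓝 (transferSup f t)) := by
  filter_upwards [ae_monotone_iterate_transfer hf h] with t ht using tendsto_atTop_iSup ht

/-- The operator is a finite sum with finite weights, so it commutes with the almost everywhere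
increasing limit of the iterates; the shifted sequence has the same limit. -/
theorem transfer_transferSup {f : 𝕋 → ℝ≥0∞} (hf : Measurable f)
    (h : f ≤ᵐ[μT] transfer f) : transfer (transferSup f) =ᵐ[μT] transferSup f := by
  have hm := measurable_transferSup hf
  have ht := ae_tendsto_iterate_transfer hf h
  refine ae_of_ae_cubeMap (measurableSet_eq_fun (measurable_transfer hm) hm) ?_
  filter_upwards [ae_cubeMap ht, ae_fiber ht] with t h1 h2
  refine tendsto_nhds_unique ?_ ((tendsto_add_atTop_iff_nat 1).2 h1)
  simp only [Function.iterate_succ_apply', transfer_cubeMap]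
  have hc : ∀ {x : ℕ → ℝ≥0∞} {a : ℝ≥0∞} (y : 𝕋), Tendsto x atTop (𝓝 a) →
      Tendsto (fun n => ENNReal.ofReal (weight y) * x n) atTop
        (𝓝 (ENNReal.ofReal (weight y) * a)) := fun y hx =>
    ENNReal.Tendsto.const_mul hx (Or.inr ENNReal.ofReal_ne_top)
  exact ((hc _ h2.1).add (hc _ h2.2.1)).add (hc _ h2.2.2)

/-- The product `∏_{j < n} |m₀(z^{3^j})|²`. -/
def weightProd (n : ℕ) (t : 𝕋) : ℝ≥0∞ :=
  ∏ j ∈ Finset.range n, ENNReal.ofReal (3 * weight (cubeMap^[j] t))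

theorem measurable_weightProd (n : ℕ) : Measurable (weightProd n) := by
  unfold weightProd
  refine Finset.measurable_fun_prod _ fun j _ => ?_
  have := continuous_weight.measurable.comp (measurable_cubeMap.iterate j)
  exact (this.const_mul 3).ennreal_ofReal

theorem lintegral_transfer_mul {f G : 𝕋 → ℝ≥0∞} (hf : Measurable f) (hG : Measurable G) :
    ∫⁻ t, transfer f t * G t ∂μT
      = ∫⁻ t, f t * (ENNReal.ofReal (3 * weight t) * G (cubeMap t)) ∂μT := by
  have hw : Measurable fun x => ENNReal.ofReal (weight x) * f x :=
    continuous_weight.measurable.ennreal_ofReal.mul hf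
  conv_lhs => rw [← measurePreserving_cubeMap.map_eq]
  rw [lintegral_map (f := fun t => transfer f t * G t) ((measurable_transfer hf).mul hG)
    measurable_cubeMap]
  simp only [transfer_cubeMap]
  rw [lintegral_fiberSum_mul (G := fun t => G (cubeMap t)) _ hw (hG.comp measurable_cubeMap)
    (by simp),
    ← lintegral_const_mul (f := fun t => ENNReal.ofReal (weight t) * f t * G (cubeMap t)) _
      (hw.mul (hG.comp measurable_cubeMap))]
  congr 1; ext t
  rw [ENNReal.ofReal_mul (by norm_num)]
  norm_num
  ring

/-- The adjoint of `transfer` is `G ↦ 3 * weight * (G ∘ cubeMap)`; its `n`-th power applied to 1 is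
`weightProd n`. -/
theorem lintegral_iterate_transfer {f : 𝕋 → ℝ≥0∞} (hf : Measurable f) (n : ℕ) :
    ∫⁻ t, transfer^[n] f t ∂μT = ∫⁻ t, f t * weightProd n t ∂μT := by
  induction n generalizing f with
  | zero => simp [weightProd]
  | succ n ih =>
    rw [Function.iterate_succ_apply, ih (measurable_transfer hf),
      lintegral_transfer_mul hf (measurable_weightProd n)]
    simp only [weightProd, Finset.prod_range_succ', Function.iterate_succ_apply,
      Function.iterate_zero, id]
    congr 1; ext t; ring

/-! ### From bounded to square integrable harmonic functions -/

theorem IsHarmonic.congr {h k : 𝕋 → ℂ} (hh : IsHarmonic h) (e : h =ᵐ[μT] k) : IsHarmonic k := by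
  unfold IsHarmonic at *
  filter_upwards [hh, ae_cubeMap e, ae_fiber e] with t h1 h2 h3
  simp only [Function.comp_apply, fiberSum, h2, h3] at *
  exact h1

theorem isHarmonic_toReal {p : 𝕋 → ℝ≥0∞} (hp : ∀ t, p t ≠ ∞) (h : transfer p =ᵐ[μT] p) :
    IsHarmonic fun t => ((p t).toReal : ℂ) := by
  unfold IsHarmonic
  filter_upwards [ae_cubeMap h] with t ht
  have hf : ∀ x, ENNReal.ofReal (weight x) * p x ≠ ∞ := fun x =>
    ENNReal.mul_ne_top ENNReal.ofReal_ne_top (hp x)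
  rw [transfer_cubeMap] at ht
  simp only [Function.comp_apply, ← ht, fiberSum]
  rw [ENNReal.toReal_add (ENNReal.add_ne_top.2 ⟨hf _, hf _⟩) (hf _),
    ENNReal.toReal_add (hf _) (hf _)]
  simp only [ENNReal.toReal_mul, ENNReal.toReal_ofReal (weight_nonneg _)]
  push_cast; rfl

/-- Bounded harmonic functions are constant. -/
def BoundedHarmonicConst : Prop :=
  ∀ h : 𝕋 → ℂ, MemLp h ∞ μT → IsHarmonic h → ∃ c : ℂ, h =ᵐ[μT] fun _ => c

theorem BoundedHarmonicConst.ennreal (H : BoundedHarmonicConst) {p : 𝕋 → ℝ≥0∞}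
    (hm : Measurable p) {N : ℕ} (hN : ∀ t, p t ≤ N) (h : transfer p =ᵐ[μT] p) :
    ∃ c : ℝ≥0∞, c ≤ N ∧ p =ᵐ[μT] fun _ => c := by
  have hp : ∀ t, p t ≠ ∞ := fun t => ne_top_of_le_ne_top (by simp) (hN t)
  have hb : MemLp (fun t => ((p t).toReal : ℂ)) ∞ μT := by
    refine memLp_top_of_bound
      (Complex.measurable_ofReal.comp hm.ennreal_toReal).aestronglyMeasurable
      N (.of_forall fun t => ?_)
    rw [Complex.norm_real, Real.norm_of_nonneg ENNReal.toReal_nonneg]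
    exact ENNReal.toReal_le_of_le_ofReal (by simp) (by simpa using hN t)
  obtain ⟨c, hc⟩ := H _ hb (isHarmonic_toReal hp h)
  obtain ⟨t₀, ht₀⟩ := hc.exists
  refine ⟨p t₀, hN t₀, ?_⟩
  filter_upwards [hc] with t ht
  replace ht := ht.trans ht₀.symm
  exact (ENNReal.toReal_eq_toReal_iff' (hp _) (hp _)).1 (Complex.ofReal_injective ht)

/-- A Chebyshev-type bound: the excess of `q` over the level `N` is controlled by the second moment
and becomes negligible as `N` grows. -/
theorem ENNReal.tsub_le_sq_div (q : ℝ≥0∞) {N : ℝ≥0∞} (h0 : N ≠ 0) (h1 : N ≠ ∞) :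
    q - N ≤ q ^ 2 / N := by
  rcases le_total q N with h | h
  · rw [tsub_eq_zero_of_le h]; exact zero_le
  · calc q - N ≤ q := tsub_le_self
      _ = q * N / N := (ENNReal.mul_div_cancel_right h0 h1).symm
      _ ≤ q ^ 2 / N := by rw [sq]; gcongr

/-- If bounded harmonic functions are constant, then so is the least harmonic majorant of a
subharmonic function dominated by an integrable one. -/
theorem BoundedHarmonicConst.transferSup_const (H : BoundedHarmonicConst) {f F : 𝕋 → ℝ≥0∞}
    (hf : Measurable f) (hF : Measurable F) (hle : ∀ t, f t ^ 2 ≤ F t) (h1 : f ≤ᵐ[μT] transfer f)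
    (h2 : F ≤ᵐ[μT] transfer F) {M : ℝ≥0∞} (hM : M ≠ ∞)
    (hb : ∀ n, ∫⁻ t, transfer^[n] F t ∂μT ≤ M) :
    ∃ c : ℝ≥0∞, c ≠ ∞ ∧ transferSup f =ᵐ[μT] fun _ => c := by
  set q := transferSup f with hq
  set g := transferSup F with hg
  have mq : Measurable q := measurable_transferSup hf
  have mg : Measurable g := measurable_transferSup hF
  have Rq : transfer q =ᵐ[μT] q := transfer_transferSup hf h1
  have Rg : transfer g =ᵐ[μT] g := transfer_transferSup hF h2
  -- By monotone convergence the integral of `g` is at most `M`.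
  have hg_fin : ∀ᵐ t ∂μT, g t < ∞ := by
    refine ae_lt_top mg (ne_top_of_le_ne_top hM ?_)
    simp only [hg, transferSup]
    rw [lintegral_iSup' (fun n => (measurable_iterate_transfer hF n).aemeasurable)
      (ae_monotone_iterate_transfer hF h2)]
    exact iSup_le hb
  have hqg : ∀ᵐ t ∂μT, q t ^ 2 ≤ g t := by
    filter_upwards [ae_tendsto_iterate_transfer hf h1] with t ht
    refine le_of_tendsto (((ENNReal.continuous_pow 2).tendsto _).comp ht) (.of_forall fun n => ?_)
    refine (sq_iterate_transfer_le f n t).trans (le_trans ?_ (le_iSup _ n))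
    clear ht
    induction n generalizing t with
    | zero => exact hle t
    | succ n ih => 
      simp only [Function.iterate_succ_apply']
      exact transfer_mono ih t
  -- The truncation `k = (N - q)⁺` is subharmonic and bounded by `N`, so its least harmonic majorant
  -- is a constant `c`. Then `k ≤ c` gives the lower bound, while `k + q = N + (q - N)⁺ ≤ N + g /
  -- N`, whose right side is harmonic, gives the upper bound after iteration.
  have key : ∀ N : ℕ, N ≠ 0 → ∃ c : ℝ≥0∞, c ≤ N ∧
      ∀ᵐ t ∂μT, (N : ℝ≥0∞) ≤ c + q t ∧ c + q t ≤ N + g t / N := by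
    intro N hN
    set k : 𝕋 → ℝ≥0∞ := fun t => N - q t with hk
    have mk : Measurable k := measurable_const.sub mq
    have k1 : k ≤ᵐ[μT] transfer k := by
      filter_upwards [Rq] with t ht
      rw [hk, tsub_le_iff_right, ← ht, ← hk]
      have : transfer (fun _ => (N : ℝ≥0∞)) t ≤ transfer (k + q) t :=
        transfer_mono (fun x => le_tsub_add) t
      rwa [transfer_const, transfer_add] at this
    obtain ⟨c, hcN, hc⟩ := H.ennreal (measurable_transferSup mk) (N := N)
      (fun t => iSup_le fun n => iterate_transfer_le (fun x => tsub_le_self) n t)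
      (transfer_transferSup mk k1)
    refine ⟨c, hcN, ?_⟩
    have up : ∀ n, ∀ᵐ t ∂μT, transfer^[n] k t + q t ≤ N + g t / N := by
      intro n
      have e0 : (k + q) ≤ᵐ[μT] fun t => N + g t / N := by
        filter_upwards [hqg] with t ht
        have e1 : k t + q t = N + (q t - N) := by
          simp only [hk]
          rcases le_total (q t) N with h | h
          · rw [tsub_add_cancel_of_le h, tsub_eq_zero_of_le h, add_zero]
          · rw [add_tsub_cancel_of_le h, tsub_eq_zero_of_le h, zero_add]
        rw [Pi.add_apply, e1]
        gcongr
        exact (ENNReal.tsub_le_sq_div _ (by exact_mod_cast hN) (by simp)).trans (by gcongr)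
      have mr : Measurable fun t => N + g t / N := measurable_const.add (mg.div_const _)
      have e2 : transfer (fun t => N + g t / N) =ᵐ[μT] fun t => N + g t / N := by
        filter_upwards [Rg] with t ht
        have := congrFun (transfer_add (fun _ => (N : ℝ≥0∞)) (fun t => g t / N)) t
        rw [transfer_const] at this
        refine this.trans ?_
        simp only [Pi.add_apply]
        congr 1
        rw [← ht]
        simp only [transfer, fiberSum, div_eq_mul_inv, ← mul_assoc, ← add_mul]
      have e3 := iterate_transfer_mono_ae (mk.add mq) mr e0 n
      filter_upwards [e3, iterate_transfer_eq_ae mr e2 n, iterate_transfer_eq_ae mq Rq n]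
        with t a1 a2 a3
      rwa [iterate_transfer_add, Pi.add_apply, a2, a3] at a1
    filter_upwards [hc, ae_all_iff.2 up] with t ht hu
    constructor
    · rw [← ht]
      exact (le_tsub_add (a := q t)).trans (by gcongr; exact le_transferSup k t)
    · rw [← ht, transferSup, ENNReal.iSup_add]
      exact iSup_le hu
  choose! c hcN hc using key
  have hall : ∀ᵐ t ∂μT, ∀ N : ℕ, N ≠ 0 → (N : ℝ≥0∞) ≤ c N + q t ∧ c N + q t ≤ N + g t / N := by
    rw [ae_all_iff]; intro N
    by_cases h : N = 0
    · simp [h]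
    · filter_upwards [hc N h] with t ht _ using ht
  -- The two bounds at `s` and `t` share the same finite `c N`; cancelling it leaves `q s ≤ q t + g
  -- s / N`, and `N → ∞` removes the error.
  have hcomp : ∀ s t, g s < ∞ →
      (∀ N : ℕ, N ≠ 0 → (N : ℝ≥0∞) ≤ c N + q s ∧ c N + q s ≤ N + g s / N) →
      (∀ N : ℕ, N ≠ 0 → (N : ℝ≥0∞) ≤ c N + q t ∧ c N + q t ≤ N + g t / N) → q s ≤ q t := by
    intro s t hs h1 h2
    have h3 : ∀ N : ℕ, N ≠ 0 → q s ≤ q t + g s / N := by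
      intro N hN
      have h4 : c N + q s ≤ c N + (q t + g s / N) := by
        rw [← add_assoc]
        exact (h1 N hN).2.trans (by gcongr; exact (h2 N hN).1)
      exact (ENNReal.add_le_add_iff_left (ne_top_of_le_ne_top (by simp) (hcN N hN))).1 h4
    have h5 : Tendsto (fun N : ℕ => q t + g s / N) atTop (𝓝 (q t + 0)) := by
      refine tendsto_const_nhds.add ?_
      have := ENNReal.Tendsto.const_mul ENNReal.tendsto_inv_nat_nhds_zero (Or.inr hs.ne)
      simpa [div_eq_mul_inv] using this
    rw [add_zero] at h5
    refine ge_of_tendsto h5 ?_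
    filter_upwards [eventually_ne_atTop 0] with N hN using h3 N hN
  obtain ⟨t₀, h₀, h₀'⟩ := (hg_fin.and hall).exists
  refine ⟨q t₀, ?_, ?_⟩
  · have := (h₀' 1 one_ne_zero).2
    intro htop
    rw [htop] at this
    simp at this
    exact h₀.ne this
  · filter_upwards [hg_fin, hall] with t h h'
    exact le_antisymm (hcomp _ _ h h' h₀') (hcomp _ _ h₀ h₀' h')

theorem transfer_ofReal_cubeMap {u : 𝕋 → ℝ} (hu : ∀ t, 0 ≤ u t) (t : 𝕋) :
    transfer (fun x => ENNReal.ofReal (u x)) (cubeMap t)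
      = ENNReal.ofReal (fiberSum (fun x => weight x * u x) t) := by
  have h : ∀ x, 0 ≤ weight x * u x := fun x => mul_nonneg (weight_nonneg x) (hu x)
  rw [transfer_cubeMap]
  simp only [fiberSum]
  rw [ENNReal.ofReal_add (add_nonneg (h _) (h _)) (h _), ENNReal.ofReal_add (h _) (h _)]
  simp only [ENNReal.ofReal_mul (weight_nonneg _)]

/-- A real harmonic function with bounded second moments is constant, if bounded harmonic
functions are. -/
theorem BoundedHarmonicConst.real (H : BoundedHarmonicConst) {u : 𝕋 → ℝ} (hu : Measurable u)
    (hh : u ∘ cubeMap =ᵐ[μT] fiberSum fun t => weight t * u t) {M : ℝ≥0∞} (hM : M ≠ ∞)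
    (hb : ∀ n, ∫⁻ t, ‖u t‖ₑ ^ 2 * weightProd n t ∂μT ≤ M) :
    ∃ c : ℝ, u =ᵐ[μT] fun _ => c := by
  have mF : Measurable fun t => ‖u t‖ₑ ^ 2 := hu.enorm.pow_const 2
  -- `|u|²` is subharmonic by the triangle inequality on the fibre followed by Jensen.
  have hF : (fun t => ‖u t‖ₑ ^ 2) ≤ᵐ[μT] transfer fun t => ‖u t‖ₑ ^ 2 := by
    refine ae_of_ae_cubeMap (measurableSet_le mF (measurable_transfer mF)) ?_
    filter_upwards [hh] with t ht
    refine le_trans ?_ (sq_transfer_le (fun x => ‖u x‖ₑ) _)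
    gcongr
    rw [transfer_cubeMap]
    rw [Function.comp_apply] at ht
    rw [ht]
    refine (enorm_add_le _ _).trans ?_
    refine (add_le_add_left (enorm_add_le _ _) _).trans_eq ?_
    simp only [enorm_mul, Real.enorm_of_nonneg (weight_nonneg _), fiberSum]
  have sub : ∀ v : 𝕋 → ℝ, Measurable v → (v ∘ cubeMap =ᵐ[μT] fiberSum fun t => weight t * v t) →
      (fun t => ENNReal.ofReal (v t)) ≤ᵐ[μT] transfer fun t => ENNReal.ofReal (v t) := by
    intro v mv hv
    refine ae_of_ae_cubeMap (measurableSet_le mv.ennreal_ofReal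
      (measurable_transfer mv.ennreal_ofReal)) ?_
    filter_upwards [hv] with t ht
    rw [transfer_cubeMap]
    rw [Function.comp_apply] at ht
    rw [ht]
    refine ENNReal.ofReal_add_le.trans ?_
    refine (add_le_add_left ENNReal.ofReal_add_le _).trans_eq ?_
    simp only [ENNReal.ofReal_mul (weight_nonneg _), fiberSum]
  have hneg : (-u) ∘ cubeMap =ᵐ[μT] fiberSum fun t => weight t * (-u) t := by
    filter_upwards [hh] with t ht
    simp only [Function.comp_apply, Pi.neg_apply, fiberSum] at ht ⊢
    rw [ht]; ring
  have s1 := sub u hu hh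
  have s2 := sub (-u) hu.neg hneg
  have mp : Measurable fun t => ENNReal.ofReal (u t) := hu.ennreal_ofReal
  have mn : Measurable fun t => ENNReal.ofReal ((-u) t) := hu.neg.ennreal_ofReal
  have hle : ∀ (x : ℝ), ENNReal.ofReal x ≤ ‖x‖ₑ := fun x => by
    rw [← ofReal_norm]; exact ENNReal.ofReal_le_ofReal (le_abs_self x)
  have hb' : ∀ n, ∫⁻ t, transfer^[n] (fun t => ‖u t‖ₑ ^ 2) t ∂μT ≤ M := fun n => by
    rw [lintegral_iterate_transfer mF]; exact hb n
  obtain ⟨c, hc, hc'⟩ := H.transferSup_const mp mF (fun t => by gcongr; exact hle _) s1 hF hM hb'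
  obtain ⟨d, hd, hd'⟩ := H.transferSup_const mn mF
    (fun t => by gcongr; exact (hle _).trans_eq (by simp)) s2 hF hM hb'
  set f : 𝕋 → ℝ≥0∞ := fun t => ENNReal.ofReal (u t) with hf
  set f' : 𝕋 → ℝ≥0∞ := fun t => ENNReal.ofReal ((-u) t) with hf'
  -- This is `R u = u` for the transfer operator `R`, with `u = u⁺ - u⁻` and the negative terms
  -- moved across so that everything stays in `ℝ≥0∞`.
  have step : f + transfer f' =ᵐ[μT] f' + transfer f := by
    refine ae_of_ae_cubeMap (measurableSet_eq_fun (mp.add (measurable_transfer mn))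
      (mn.add (measurable_transfer mp))) ?_
    filter_upwards [hh] with t ht
    have e1 : f = fun t => ENNReal.ofReal (max (u t) 0) := by
      ext x; rw [hf, ENNReal.ofReal_max]; simp
    have e2 : f' = fun t => ENNReal.ofReal (max ((-u) t) 0) := by
      ext x; rw [hf', ENNReal.ofReal_max]; simp
    have p1 : 0 ≤ fiberSum (fun x => weight x * max (u x) 0) t := by
      have : ∀ x, 0 ≤ weight x * max (u x) 0 := fun x => mul_nonneg (weight_nonneg x) (by simp)
      exact add_nonneg (add_nonneg (this _) (this _)) (this _)
    have p2 : 0 ≤ fiberSum (fun x => weight x * max ((-u) x) 0) t := by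
      have : ∀ x, 0 ≤ weight x * max ((-u) x) 0 := fun x => mul_nonneg (weight_nonneg x) (by simp)
      exact add_nonneg (add_nonneg (this _) (this _)) (this _)
    have e3 : u (cubeMap t) = fiberSum (fun x => weight x * max (u x) 0) t
        - fiberSum (fun x => weight x * max ((-u) x) 0) t := by
      rw [Function.comp_apply] at ht
      have : ∀ x, u x = max (u x) 0 - max ((-u) x) 0 := fun x => by
        rw [Pi.neg_apply, max_comm, max_comm (-u x)]
        exact (max_zero_sub_max_neg_zero_eq_self (u x)).symm.trans (by simp [max_comm])
      rw [ht]
      simp only [fiberSum]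
      conv_lhs => rw [this t, this (t + third), this (t + third + third)]
      ring
    have e4 : transfer f (cubeMap t) = _ :=
      (congrArg (fun F => transfer F (cubeMap t)) e1).trans
        (transfer_ofReal_cubeMap (fun x => le_max_right (u x) 0) t)
    have e5 : transfer f' (cubeMap t) = _ :=
      (congrArg (fun F => transfer F (cubeMap t)) e2).trans
        (transfer_ofReal_cubeMap (fun x => le_max_right ((-u) x) 0) t)
    simp only [Pi.add_apply, e4, e5]
    generalize fiberSum (fun x => weight x * max (u x) 0) t = A at *
    generalize fiberSum (fun x => weight x * max ((-u) x) 0) t = B at *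
    simp only [hf, hf', Pi.neg_apply, e3]
    rcases le_total A B with h | h
    · rw [ENNReal.ofReal_of_nonpos (by linarith), zero_add,
        ← ENNReal.ofReal_add (by linarith) (by linarith)]
      congr 1; ring
    · rw [ENNReal.ofReal_of_nonpos (p := -(A - B)) (by linarith), zero_add,
        ← ENNReal.ofReal_add (by linarith) (by linarith)]
      congr 1; ring
  have tfin : ∀ (v : 𝕋 → ℝ) t, transfer (fun x => ENNReal.ofReal (v x)) t ≠ ∞ := fun v t => by
    simp [transfer, fiberSum, ENNReal.mul_eq_top]
  have steps : ∀ n, f + transfer^[n] f' =ᵐ[μT] f' + transfer^[n] f := by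
    intro n
    induction n with
    | zero => exact .of_forall fun t => add_comm (f t) (f' t)
    | succ n ih =>
      have ih' := transfer_congr_ae (mp.add (measurable_iterate_transfer mn n))
        (mn.add (measurable_iterate_transfer mp n)) ih
      rw [transfer_add, transfer_add] at ih'
      filter_upwards [ih', step] with t h1 h2
      simp only [Pi.add_apply, ← Function.iterate_succ_apply' transfer] at h1 h2 ⊢
      have h3 : transfer f t + transfer f' t ≠ ∞ := ENNReal.add_ne_top.2 ⟨tfin _ t, tfin _ t⟩
      -- Adding `R u⁺ + R u⁻`, which is finite, lets the induction hypothesis and the case of one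
      -- iterate be added; it is then cancelled.
      refine (ENNReal.add_right_inj h3).1 ?_
      calc transfer f t + transfer f' t + (f t + transfer^[n + 1] f' t)
          = (f t + transfer f' t) + (transfer f t + transfer^[n + 1] f' t) := by ring
        _ = (f' t + transfer f t) + (transfer f' t + transfer^[n + 1] f t) := by rw [h1, h2]
        _ = _ := by ring
  refine ⟨c.toReal - d.toReal, ?_⟩
  filter_upwards [ae_all_iff.2 steps, ae_tendsto_iterate_transfer mp s1,
    ae_tendsto_iterate_transfer mn s2, hc', hd'] with t h1 h2 h3 h4 h5
  -- In the limit `u⁺ + d = u⁻ + c`, whence `u = c - d`.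
  have h6 : f t + transferSup f' t = f' t + transferSup f t := by
    refine tendsto_nhds_unique (tendsto_const_nhds.add h3) ?_
    refine (tendsto_const_nhds.add h2).congr fun n => (h1 n).symm
  rw [h4, h5] at h6
  have h7 := congrArg ENNReal.toReal h6
  rw [ENNReal.toReal_add ENNReal.ofReal_ne_top hd, ENNReal.toReal_add
    ENNReal.ofReal_ne_top hc] at h7
  simp only [ENNReal.toReal_ofReal', Pi.neg_apply] at h7
  rcases le_total (u t) 0 with h | h
  · rw [max_eq_right h, max_eq_left (by linarith)] at h7; linarith
  · rw [max_eq_left h, max_eq_right (by linarith)] at h7; linarith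

/-- The weight is real, so real and imaginary parts are harmonic separately, and each is dominated
by the modulus. -/
theorem BoundedHarmonicConst.of_memLp_two (H : BoundedHarmonicConst) {h : 𝕋 → ℂ}
    (hm : AEStronglyMeasurable h μT) (hh : IsHarmonic h) {M : ℝ≥0∞} (hM : M ≠ ∞)
    (hb : ∀ n, ∫⁻ t, ‖h t‖ₑ ^ 2 * weightProd n t ∂μT ≤ M) :
    ∃ c : ℂ, h =ᵐ[μT] fun _ => c := by
  set k := hm.mk h
  have mk : Measurable k := hm.stronglyMeasurable_mk.measurable
  have hk : IsHarmonic k := hh.congr hm.ae_eq_mk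
  have hb' : ∀ n, ∫⁻ t, ‖k t‖ₑ ^ 2 * weightProd n t ∂μT ≤ M := fun n => by
    refine le_trans (le_of_eq (lintegral_congr_ae ?_)) (hb n)
    filter_upwards [hm.ae_eq_mk] with t ht
    rw [ht]
  have hre : (fun t => (k t).re) ∘ cubeMap =ᵐ[μT] fiberSum fun t => weight t * (k t).re := by
    filter_upwards [hk] with t ht
    simpa [fiberSum] using congrArg Complex.re ht
  have him : (fun t => (k t).im) ∘ cubeMap =ᵐ[μT] fiberSum fun t => weight t * (k t).im := by
    filter_upwards [hk] with t ht
    simpa [fiberSum] using congrArg Complex.im ht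
  obtain ⟨a, ha⟩ := H.real (Complex.measurable_re.comp mk) hre hM fun n =>
    (lintegral_mono fun t => by
      gcongr
      rw [← ofReal_norm, ← ofReal_norm]
      exact ENNReal.ofReal_le_ofReal (Complex.abs_re_le_norm (k t))).trans (hb' n)
  obtain ⟨b, hb⟩ := H.real (Complex.measurable_im.comp mk) him hM fun n =>
    (lintegral_mono fun t => by
      gcongr
      rw [← ofReal_norm, ← ofReal_norm]
      exact ENNReal.ofReal_le_ofReal (Complex.abs_im_le_norm (k t))).trans (hb' n)
  refine ⟨⟨a, b⟩, ?_⟩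
  filter_upwards [hm.ae_eq_mk, ha, hb] with t h1 h2 h3
  rw [h1]
  exact Complex.ext h2 h3

/-! ### Bounded harmonic functions and sequences -/

theorem fourierCoeff_const (c : ℂ) {k : ℤ} (hk : k ≠ 0) :
    fourierCoeff (fun _ : 𝕋 => c) k = 0 := by
  have h := fourierCoeff.const_mul (T := 1) (fun t : 𝕋 => (fourier 0 t : ℂ)) c k
  simp only [fourier_zero, mul_one] at h
  rw [h]
  have h2 := congrFun (fourierCoeff_fourier (T := 1) 0) k
  rw [Pi.single_eq_of_ne hk] at h2
  have h3 : (fun _ : 𝕋 => (1 : ℂ)) = fourier 0 := by ext; simp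
  rw [h3, h2, mul_zero]

theorem ae_const_iff {h : 𝕋 → ℂ} (hh : MemLp h 2 μT) :
    (∃ c : ℂ, h =ᵐ[μT] fun _ => c) ↔ ∀ k : ℤ, k ≠ 0 → fourierCoeff h k = 0 := by
  constructor
  · rintro ⟨c, hc⟩ k hk
    rw [fourierCoeff_congr_ae hc, fourierCoeff_const c hk]
  · intro H
    refine ⟨fourierCoeff h 0, ae_eq_of_fourierCoeff_eq hh (memLp_const _) fun n => ?_⟩
    by_cases hn : n = 0
    · subst hn
      simp [fourierCoeff_def _ 0]
    · rw [H n hn, fourierCoeff_const _ hn]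

theorem boundedHarmonicConst_iff : BoundedHarmonicConst ↔
    ∀ a : lp (fun _ : ℤ => ℂ) 2, MemLp (fourierSeries a) ⊤ μT →
      (∀ k : ℤ, a k = 1 / 2 * a (3 * k - 2) + a (3 * k) + 1 / 2 * a (3 * k + 2)) →
      ∀ k : ℤ, k ≠ 0 → a k = 0 := by
  have hc : ∀ (a : lp (fun _ : ℤ => ℂ) 2) k, fourierCoeff (fourierSeries a) k = a k := by
    intro a k
    rw [← fourierBasis_repr, fourierSeries, LinearIsometryEquiv.apply_symm_apply]
  constructor
  · intro H a ha hrec k hk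
    rw [← hc]
    refine (ae_const_iff (Lp.memLp _)).1 (H _ ha ?_) k hk
    rw [isHarmonic_iff (Lp.memLp _)]
    simpa only [hc] using hrec
  · intro H h hb hh
    have h2 : MemLp h 2 μT := hb.mono_exponent le_top
    set a : lp (fun _ : ℤ => ℂ) 2 := fourierBasis.repr (h2.toLp h) with ha
    have hs : fourierSeries a = h2.toLp h := LinearIsometryEquiv.symm_apply_apply _ _
    have hak : ∀ k, fourierCoeff h k = a k := fun k => (fourierCoeff_eq_repr h2 k).symm
    rw [ae_const_iff h2]
    simp only [hak]
    refine H a ?_ ?_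
    · rw [hs]
      exact hb.ae_eq h2.coeFn_toLp.symm
    · simpa only [hak] using (isHarmonic_iff h2).1 hh

/-! ### Weak limits -/

section WeakLimits

variable {H : Type*} [NormedAddCommGroup H] [InnerProductSpace ℂ H] [CompleteSpace H]

/-- Inner products stay in a compact disc and converge along an ultrafilter. The limits depend
linearly and boundedly on the test vector, so Riesz representation gives `η`. The ultrafilter avoids
subsequences and separability. -/
theorem exists_weak_limit (ξ : ℕ → H) {C : ℝ} (hC : ∀ n, ‖ξ n‖ ≤ C) :
    ∃ η : H, ‖η‖ ≤ C ∧ ∀ u : H,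
      Tendsto (fun n => inner ℂ u (ξ n)) (hyperfilter ℕ) (𝓝 (inner ℂ u η)) := by
  have hC0 : 0 ≤ C := (norm_nonneg _).trans (hC 0)
  have hlim : ∀ u : H, ∃ l : ℂ, ‖l‖ ≤ C * ‖u‖ ∧
      Tendsto (fun n => inner ℂ (ξ n) u) (hyperfilter ℕ) (𝓝 l) := by
    intro u
    obtain ⟨l, hl, hl'⟩ := (isCompact_closedBall (0 : ℂ) (C * ‖u‖)).ultrafilter_le_nhds
      ((hyperfilter ℕ).map fun n => inner ℂ (ξ n) u) (by
        rw [le_principal_iff]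
        refine Filter.mem_map.2 (Filter.univ_mem' fun n => ?_)
        simp only [Set.mem_preimage, mem_closedBall_zero_iff]
        exact (norm_inner_le_norm _ _).trans (by gcongr; exact hC n))
    exact ⟨l, by simpa using hl, hl'⟩
  choose l hl hl' using hlim
  let L : H →ₗ[ℂ] ℂ :=
    { toFun := l
      map_add' := fun u v => by
        refine tendsto_nhds_unique (hl' (u + v)) ?_
        simpa only [inner_add_right] using (hl' u).add (hl' v)
      map_smul' := fun c u => by
        refine tendsto_nhds_unique (hl' (c • u)) ?_
        simpa only [inner_smul_right, RingHom.id_apply, smul_eq_mul] using (hl' u).const_mul c }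
  let F : StrongDual ℂ H := L.mkContinuous C hl
  refine ⟨(InnerProductSpace.toDual ℂ H).symm F, ?_, fun u => ?_⟩
  · rw [LinearIsometryEquiv.norm_map]
    exact L.mkContinuous_norm_le hC0 hl
  · have h1 : inner ℂ ((InnerProductSpace.toDual ℂ H).symm F) u = l u :=
      InnerProductSpace.toDual_symm_apply
    have h2 := (Complex.continuous_conj.tendsto _).comp (hl' u)
    rw [← h1] at h2
    simpa only [Function.comp_def, inner_conj_symm] using h2

theorem exists_weak_operator_limit (A : ℕ → H →L[ℂ] H) {C : ℝ} (hC : ∀ n, ‖A n‖ ≤ C) :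
    ∃ B : H →L[ℂ] H, ∀ u v : H,
      Tendsto (fun n => inner ℂ u (A n v)) (hyperfilter ℕ) (𝓝 (inner ℂ u (B v))) := by
  have hb : ∀ v n, ‖A n v‖ ≤ C * ‖v‖ := fun v n => (A n).le_of_opNorm_le (hC n) v
  choose b hb hb' using fun v => exists_weak_limit (fun n => A n v) (hb v)
  let B : H →ₗ[ℂ] H :=
    { toFun := b
      map_add' := fun v w => by
        refine ext_inner_left ℂ fun u => tendsto_nhds_unique (hb' (v + w) u) ?_
        simpa only [map_add, inner_add_right] using (hb' v u).add (hb' w u)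
      map_smul' := fun c v => by
        refine ext_inner_left ℂ fun u => tendsto_nhds_unique (hb' (c • v) u) ?_
        simpa only [map_smul, inner_smul_right, RingHom.id_apply] using (hb' v u).const_mul c }
  exact ⟨B.mkContinuous C hb, fun u v => hb' v u⟩

end WeakLimits

/-! ### Dilation-translation systems -/

section System

universe v

variable {H : Type v} [NormedAddCommGroup H] [InnerProductSpace ℂ H]

/-- A unitary dilation `U` by `3`, integer translations `τ`, and an orthogonal scaling vector `φ`
with `√2 U φ = φ + τ₂ φ` which generates the whole space. -/
structure IsCantorSystem (U : H ≃ₗᵢ[ℂ] H) (τ : ℤ → H →L[ℂ] H) (φ : H) : Prop where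
  add : ∀ j k v, τ (j + k) v = τ j (τ k v)
  inner_left : ∀ k u v, inner ℂ (τ k u) v = inner ℂ u (τ (-k) v)
  dilate : ∀ k v, U (τ k v) = τ (3 * k) (U v)
  scaling : U φ = (Real.sqrt 2 : ℂ)⁻¹ • (φ + τ 2 φ)
  orth : ∀ k, inner ℂ φ (τ k φ) = if k = 0 then 1 else 0
  zero : ∀ v, τ 0 v = v
  total : ∀ η, (∀ n k, inner ℂ (U.symm^[n] (τ k φ)) η = 0) → η = 0

/-- Solutions of the refinement equation `√2 U ξ = ξ + τ₂ ξ` are multiples of `φ`. -/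
def RefinementUnique (U : H ≃ₗᵢ[ℂ] H) (τ : ℤ → H →L[ℂ] H) (φ : H) : Prop :=
  ∀ ξ : H, U ξ = (Real.sqrt 2 : ℂ)⁻¹ • (ξ + τ 2 ξ) → ∃ c : ℂ, ξ = c • φ

theorem ofReal_sqrt_two_inv_mul_self : ((Real.sqrt 2 : ℂ)⁻¹) * (Real.sqrt 2 : ℂ)⁻¹ = 1 / 2 := by
  rw [← mul_inv, ← Complex.ofReal_mul, Real.mul_self_sqrt (by norm_num)]
  norm_num

theorem conj_sqrt_two_inv : (starRingEnd ℂ) ((Real.sqrt 2 : ℂ)⁻¹) = (Real.sqrt 2 : ℂ)⁻¹ := by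
  rw [map_inv₀, Complex.conj_ofReal]

theorem inner_iterate_symm (U : H ≃ₗᵢ[ℂ] H) (n : ℕ) (u v : H) :
    inner ℂ (U.symm^[n] u) v = inner ℂ u (U^[n] v) := by
  induction n generalizing u v with
  | zero => rfl
  | succ n ih =>
    rw [Function.iterate_succ_apply, ih, Function.iterate_succ_apply',
      ← LinearIsometryEquiv.inner_map_map U, LinearIsometryEquiv.apply_symm_apply]

theorem iterate_map_smul (U : H ≃ₗᵢ[ℂ] H) (n : ℕ) (c : ℂ) (v : H) :
    U^[n] (c • v) = c • U^[n] v := by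
  induction n generalizing v with
  | zero => rfl
  | succ n ih => simp only [Function.iterate_succ_apply, map_smul, ih]

theorem iterate_map_add (U : H ≃ₗᵢ[ℂ] H) (n : ℕ) (v w : H) : U^[n] (v + w) = U^[n] v + U^[n] w := by
  induction n generalizing v w with
  | zero => rfl
  | succ n ih => simp only [Function.iterate_succ_apply, map_add, ih]

theorem fourier_iterate_cubeMap (k : ℤ) (n : ℕ) (t : 𝕋) :
    (fourier k (cubeMap^[n] t) : ℂ) = fourier (3 ^ n * k) t := by
  induction n generalizing t with
  | zero => simp only [Function.iterate_zero, id, pow_zero, one_mul]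
  | succ n ih =>
    rw [Function.iterate_succ_apply, ih, fourier_cubeMap]
    congr 2; ring

theorem enorm_filter_sq (t : 𝕋) :
    ‖(Real.sqrt 2 : ℂ)⁻¹ * (1 + fourier 2 t)‖ₑ ^ 2 = ENNReal.ofReal (3 * weight t) := by
  rw [← ofReal_norm, ← ENNReal.ofReal_pow (norm_nonneg _), norm_mul, mul_pow, norm_inv,
    Complex.norm_real, Real.norm_of_nonneg (Real.sqrt_nonneg _), inv_pow,
      Real.sq_sqrt (by norm_num),
    weight]
  congr 1; ring

theorem norm_iterate (U : H ≃ₗᵢ[ℂ] H) (n : ℕ) (v : H) : ‖U^[n] v‖ = ‖v‖ := by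
  induction n generalizing v with
  | zero => rfl
  | succ n ih => rw [Function.iterate_succ_apply, ih, LinearIsometryEquiv.norm_map]

theorem lintegral_enorm_sq_eq (f : Lp ℂ 2 μT) : ∫⁻ t, ‖f t‖ₑ ^ 2 ∂μT = ‖f‖ₑ ^ 2 := by
  rw [Lp.enorm_def, eLpNorm_eq_lintegral_rpow_enorm_toReal (by norm_num) (by norm_num)]
  rw [← ENNReal.rpow_natCast, ← ENNReal.rpow_mul]
  norm_num

/-! ### From bounded harmonic functions to uniqueness in the refinement equation -/

namespace IsCantorSystem

variable {U : H ≃ₗᵢ[ℂ] H} {τ : ℤ → H →L[ℂ] H} {φ : H}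

theorem inner_translate (S : IsCantorSystem U τ φ) (j k : ℤ) (u v : H) :
    inner ℂ (τ j u) (τ k v) = inner ℂ (τ (j - k) u) v := by
  rw [S.inner_left, S.inner_left, ← S.add]
  congr 3; ring

theorem orthonormal (S : IsCantorSystem U τ φ) : Orthonormal ℂ fun k => τ k φ := by
  classical
  rw [orthonormal_iff_ite]
  intro j k
  rw [S.inner_left, ← S.add, S.orth]
  congr 1
  rw [eq_iff_iff]
  constructor <;> intro h <;> omega

/-- The isometry of `L²` of the circle onto the closed span of the translates of `φ`. -/
def synthesis (S : IsCantorSystem U τ φ) [CompleteSpace H] : Lp ℂ 2 μT →ₗᵢ[ℂ] H :=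
  (S.orthonormal.orthogonalFamily.linearIsometry).comp
    fourierBasis.repr.toLinearIsometry

theorem synthesis_fourier (S : IsCantorSystem U τ φ) [CompleteSpace H] (k : ℤ) :
    S.synthesis (fourierLp 2 k) = τ k φ := by
  classical
  change S.orthonormal.orthogonalFamily.linearIsometry (fourierBasis.repr (fourierLp 2 k)) = _
  rw [← coe_fourierBasis, HilbertBasis.repr_self, OrthogonalFamily.linearIsometry_apply_single]
  simp

/-- The function with Fourier coefficients `⟨τ_k φ, η⟩`. -/
def coeffFun (S : IsCantorSystem U τ φ) [CompleteSpace H] (η : H) : Lp ℂ 2 μT :=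
  ContinuousLinearMap.adjoint S.synthesis.toContinuousLinearMap η

theorem fourierCoeff_coeffFun (S : IsCantorSystem U τ φ) [CompleteSpace H] (η : H) (k : ℤ) :
    fourierCoeff (S.coeffFun η) k = inner ℂ (τ k φ) η := by
  rw [← fourierBasis_repr, HilbertBasis.repr_apply_apply, coe_fourierBasis, coeffFun,
    ContinuousLinearMap.adjoint_inner_right]
  congr 1
  exact S.synthesis_fourier k

theorem norm_coeffFun_le (S : IsCantorSystem U τ φ) [CompleteSpace H] (η : H) :
    ‖S.coeffFun η‖ ≤ ‖η‖ := by
  refine (ContinuousLinearMap.le_opNorm _ _).trans ?_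
  refine mul_le_of_le_one_left (norm_nonneg _) ?_
  rw [LinearIsometryEquiv.norm_map]
  exact S.synthesis.norm_toContinuousLinearMap_le

theorem iterate_dilate (S : IsCantorSystem U τ φ) (n : ℕ) (k : ℤ) (v : H) :
    U^[n] (τ k v) = τ (3 ^ n * k) (U^[n] v) := by
  induction n generalizing k v with
  | zero => simp
  | succ n ih =>
    rw [Function.iterate_succ_apply, Function.iterate_succ_apply, S.dilate, ih]
    congr 2; ring

theorem iterate_symm_dilate (S : IsCantorSystem U τ φ) (n : ℕ) (k : ℤ) (v : H) :
    τ k (U.symm^[n] v) = U.symm^[n] (τ (3 ^ n * k) v) := by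
  have hl : Function.LeftInverse U.symm^[n] U^[n] :=
    Function.LeftInverse.iterate U.symm_apply_apply n
  have hr : Function.RightInverse U.symm^[n] U^[n] :=
    Function.RightInverse.iterate U.apply_symm_apply n
  rw [← hl (τ k _), S.iterate_dilate, hr]

theorem iterate_succ_of_refinement (S : IsCantorSystem U τ φ)
    {ξ : H} (hξ : U ξ = (Real.sqrt 2 : ℂ)⁻¹ • (ξ + τ 2 ξ)) (n : ℕ) :
    U^[n + 1] ξ = (Real.sqrt 2 : ℂ)⁻¹ • (U^[n] ξ + τ (3 ^ n * 2) (U^[n] ξ)) := by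
  rw [Function.iterate_succ_apply, hξ, iterate_map_smul, iterate_map_add, S.iterate_dilate]

theorem dilate_translate_scaling (S : IsCantorSystem U τ φ) (k : ℤ) :
    U (τ k φ) = (Real.sqrt 2 : ℂ)⁻¹ • (τ (3 * k) φ + τ (3 * k + 2) φ) := by
  rw [S.dilate, S.scaling, map_smul, map_add, ← S.add]

/-- Each `Uⁿ ξ` is a combination of translates of `ξ`, so orthogonality to the `τ k φ` propagates to
all `U⁻ⁿ τ k φ`, which are total. -/
theorem eq_zero_of_refinement (S : IsCantorSystem U τ φ)
    {ξ : H} (hξ : U ξ = (Real.sqrt 2 : ℂ)⁻¹ • (ξ + τ 2 ξ))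
    (h0 : ∀ k, inner ℂ (τ k φ) ξ = 0) : ξ = 0 := by
  refine S.total ξ fun n k => ?_
  rw [inner_iterate_symm]
  induction n generalizing k with
  | zero => exact h0 k
  | succ n ih =>
    rw [S.iterate_succ_of_refinement hξ, inner_smul_right, inner_add_right, ih, S.inner_translate,
      ih]
    simp

variable [CompleteSpace H]

/-- Applying `U` to both entries of `⟨τ k φ, ξ⟩` and refining both gives four terms with factor
`1/2`, two of which coincide: the recursion on coefficients. -/
theorem isHarmonic_coeffFun (S : IsCantorSystem U τ φ)
    {ξ : H} (hξ : U ξ = (Real.sqrt 2 : ℂ)⁻¹ • (ξ + τ 2 ξ)) :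
    IsHarmonic (S.coeffFun ξ) := by
  rw [isHarmonic_iff (Lp.memLp _)]
  intro k
  simp only [S.fourierCoeff_coeffFun]
  rw [← LinearIsometryEquiv.inner_map_map U, hξ, S.dilate_translate_scaling]
  simp only [inner_smul_left, inner_smul_right, inner_add_left, inner_add_right, conj_sqrt_two_inv,
    S.inner_translate]
  rw [show 3 * k + 2 - 2 = 3 * k by ring]
  linear_combination (inner ℂ (τ (3 * k) φ) ξ + inner ℂ (τ (3 * k + 2) φ) ξ +
    (inner ℂ (τ (3 * k - 2) φ) ξ + inner ℂ (τ (3 * k) φ) ξ)) * ofReal_sqrt_two_inv_mul_self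

/-- The refinement equation dilated `n` times involves the translation by `2 · 3ⁿ`, which acts on
coefficient functions as multiplication by `z^{2·3ⁿ}`. -/
theorem coeffFun_iterate_succ (S : IsCantorSystem U τ φ)
    {ξ : H} (hξ : U ξ = (Real.sqrt 2 : ℂ)⁻¹ • (ξ + τ 2 ξ)) (n : ℕ) :
    S.coeffFun (U^[n + 1] ξ) =ᵐ[μT] fun t =>
      (Real.sqrt 2 : ℂ)⁻¹ * (1 + fourier 2 (cubeMap^[n] t)) * S.coeffFun (U^[n] ξ) t := by
  have h2 : MemLp (S.coeffFun (U^[n] ξ)) 2 μT := Lp.memLp _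
  have h3 : MemLp (fun t => (fourier (3 ^ n * 2) t : ℂ) * S.coeffFun (U^[n] ξ) t) 2 μT := by
    refine h2.of_le ((fourier _).continuous.aestronglyMeasurable.mul h2.1) (.of_forall fun t => ?_)
    rw [norm_mul, fourier_apply, Circle.norm_coe, one_mul]
  have e : (fun t => (Real.sqrt 2 : ℂ)⁻¹ * (1 + fourier 2 (cubeMap^[n] t))
      * S.coeffFun (U^[n] ξ) t) = fun t => (Real.sqrt 2 : ℂ)⁻¹ * ((S.coeffFun (U^[n] ξ) t) +
        fourier (3 ^ n * 2) t * S.coeffFun (U^[n] ξ) t) := by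
    ext t; rw [fourier_iterate_cubeMap]; ring
  rw [e]
  refine ae_eq_of_fourierCoeff_eq (Lp.memLp _) ((h2.add h3).const_mul _) fun k => ?_
  rw [fourierCoeff.const_mul, S.fourierCoeff_coeffFun, S.iterate_succ_of_refinement hξ]
  have := fourierCoeff.add (h2.integrable (by norm_num)) (h3.integrable (by norm_num))
  have h4 := congrFun this k
  simp only [Pi.add_apply] at h4
  erw [h4]
  rw [fourierCoeff_fourier_mul, S.fourierCoeff_coeffFun, S.fourierCoeff_coeffFun,
    inner_smul_right, inner_add_right, S.inner_translate]

/-- The integral is the squared norm of the coefficient function of `Uⁿ ξ`, so Bessel's inequality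
and unitarity of `U` bound it uniformly in `n`. -/
theorem lintegral_coeffFun_le (S : IsCantorSystem U τ φ)
    {ξ : H} (hξ : U ξ = (Real.sqrt 2 : ℂ)⁻¹ • (ξ + τ 2 ξ)) (n : ℕ) :
    ∫⁻ t, ‖S.coeffFun ξ t‖ₑ ^ 2 * weightProd n t ∂μT ≤ ENNReal.ofReal ‖ξ‖ ^ 2 := by
  have h1 : ∀ᵐ t ∂μT, ‖S.coeffFun ξ t‖ₑ ^ 2 * weightProd n t = ‖S.coeffFun (U^[n] ξ) t‖ₑ ^ 2 := by
    induction n with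
    | zero => simp [weightProd]
    | succ n ih =>
      filter_upwards [ih, S.coeffFun_iterate_succ hξ n] with t h1 h2
      rw [h2, enorm_mul, mul_pow, enorm_filter_sq, ← h1]
      simp only [weightProd, Finset.prod_range_succ]
      ring
  rw [lintegral_congr_ae h1]
  have h3 := S.norm_coeffFun_le (U^[n] ξ)
  rw [norm_iterate] at h3
  rw [lintegral_enorm_sq_eq, ← ofReal_norm]
  gcongr

/-- If bounded harmonic functions are constant, then the refinement equation has no solutions
besides the multiples of `φ`. -/
theorem refinementUnique (S : IsCantorSystem U τ φ) (HC : BoundedHarmonicConst) :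
    RefinementUnique U τ φ := by
  intro ξ hξ
  have hc := HC.of_memLp_two (Lp.memLp (S.coeffFun ξ)).1 (S.isHarmonic_coeffFun hξ)
    (M := ENNReal.ofReal ‖ξ‖ ^ 2) (by simp) (S.lintegral_coeffFun_le hξ)
  rw [ae_const_iff (Lp.memLp _)] at hc
  simp only [S.fourierCoeff_coeffFun] at hc
  -- Constancy kills the coefficients with `k ≠ 0`; subtracting the projection onto `φ` kills the
  -- one at `k = 0`.
  refine ⟨inner ℂ φ ξ, sub_eq_zero.1 (S.eq_zero_of_refinement ?_ fun k => ?_)⟩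
  · simp only [map_sub, map_smul, hξ, S.scaling]
    module
  · rw [inner_sub_right, inner_smul_right]
    by_cases hk : k = 0
    · subst hk
      rw [S.zero]
      have := S.orth 0
      rw [if_pos rfl, S.zero] at this
      rw [this]; ring
    · rw [hc k hk, S.inner_left, S.orth, if_neg (by omega)]; ring

end IsCantorSystem

end System

/-- The product `∏_{j < n} m₀(z^{3^j})`. -/
def filterProd (n : ℕ) (t : 𝕋) : ℂ :=
  ∏ j ∈ Finset.range n, (Real.sqrt 2 : ℂ)⁻¹ * (1 + fourier 2 (cubeMap^[j] t))

theorem continuous_filterProd (n : ℕ) : Continuous (filterProd n) := by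
  unfold filterProd
  refine continuous_finsetProd _ fun j _ => ?_
  have := (fourier (T := 1) 2).continuous.comp (continuous_cubeMap.iterate j)
  exact continuous_const.mul (continuous_const.add this)

theorem filterProd_zero (t : 𝕋) : filterProd 0 t = 1 := by simp [filterProd]

theorem filterProd_succ (n : ℕ) (t : 𝕋) : filterProd (n + 1) t =
    filterProd n t * ((Real.sqrt 2 : ℂ)⁻¹ * (1 + fourier (3 ^ n * 2) t)) := by
  rw [filterProd, Finset.prod_range_succ, fourier_iterate_cubeMap]
  rfl

theorem filterProd_succ' (n : ℕ) (t : 𝕋) : filterProd (n + 1) t =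
    (Real.sqrt 2 : ℂ)⁻¹ * (1 + fourier 2 t) * filterProd n (cubeMap t) := by
  rw [filterProd, Finset.prod_range_succ', mul_comm]
  rfl

theorem enorm_filterProd_sq (n : ℕ) (t : 𝕋) : ‖filterProd n t‖ₑ ^ 2 = weightProd n t := by
  induction n with
  | zero => simp [filterProd, weightProd]
  | succ n ih =>
    rw [filterProd, Finset.prod_range_succ, enorm_mul, mul_pow, enorm_filter_sq, weightProd,
      Finset.prod_range_succ, ← filterProd, ih, weightProd]

/-- The constant 1 is fixed by the transfer operator. Hence every `filterProd n` has norm 1 in `L²`.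
-/
theorem lintegral_weightProd (n : ℕ) : ∫⁻ t, weightProd n t ∂μT = 1 := by
  have h := lintegral_iterate_transfer (f := fun _ => 1) measurable_const n
  rw [Function.iterate_fixed (transfer_const 1)] at h
  simpa using h.symm

theorem MemLp.mul_filterProd {h : 𝕋 → ℂ} {p : ℝ≥0∞} (hh : MemLp h p μT) (n : ℕ) :
    MemLp (fun t => h t * filterProd n t) p μT := by
  obtain ⟨C, hC⟩ := isCompact_univ.exists_bound_of_continuousOn
    (continuous_filterProd n).continuousOn
  refine hh.of_le_mul (c := C) (hh.1.mul (continuous_filterProd n).aestronglyMeasurable)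
    (.of_forall fun t => ?_)
  rw [norm_mul, mul_comm]
  gcongr
  exact hC t trivial

theorem sqrt_two_mul_filter (t : 𝕋) : (Real.sqrt 2 : ℂ)⁻¹ * (1 + fourier (-2) t) *
    ((Real.sqrt 2 : ℂ)⁻¹ * (1 + fourier 2 t)) = 3 * weight t := by
  have h : (fourier 2 t : ℂ) * fourier (-2) t = 1 := by
    rw [← fourier_add]; simp
  rw [ofReal_weight]
  linear_combination (1 + fourier 2 t : ℂ) * (1 + fourier (-2) t) * ofReal_sqrt_two_inv_mul_self
    + h / 2

/-- Duality `IsHarmonic.integral_mul` with `G = z^{-k} * filterProd n`: the outermost filter times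
the conjugate filter is `3 * weight`. It is the consistency condition between consecutive levels of
the approximation. -/
theorem fourierCoeff_mul_filterProd {h : 𝕋 → ℂ} (hb : MemLp h ∞ μT) (hh : IsHarmonic h) (n : ℕ)
    (k : ℤ) : (Real.sqrt 2 : ℂ)⁻¹ * (fourierCoeff (fun t => h t * filterProd (n + 1) t) (3 * k)
      + fourierCoeff (fun t => h t * filterProd (n + 1) t) (3 * k + 2))
      = fourierCoeff (fun t => h t * filterProd n t) k := by
  have hi : ∀ n, Integrable (fun t => h t * filterProd n t) μT := fun n =>
    (MemLp.mul_filterProd hb n).integrable le_top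
  have e1 := (hi (n + 1)).fourier_smul (-(3 * k))
  have e2 := (hi (n + 1)).fourier_smul (-(3 * k + 2))
  simp only [smul_eq_mul] at e1 e2
  have key := hh.integral_mul (G := fun t => fourier (-k) t * filterProd n t) hb.1
    ((fourier (-k)).continuous.mul (continuous_filterProd n)).aestronglyMeasurable (by
      have hc : Continuous fun t => (fourier (-k) (cubeMap t) : ℂ) * filterProd n (cubeMap t) :=
        ((fourier (-k)).continuous.mul (continuous_filterProd n)).comp continuous_cubeMap
      obtain ⟨C, hC⟩ := isCompact_univ.exists_bound_of_continuousOn hc.continuousOn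
      exact (hb.integrable le_top).mul_bdd hc.aestronglyMeasurable
        (.of_forall fun t => hC t trivial))
  simp only [fourierCoeff_def]
  rw [← integral_add e1 e2, ← integral_const_mul]
  trans ∫ t, h t * (fourier (-k) t * filterProd n t) ∂μT
  · rw [← key]
    congr 1; ext t
    rw [filterProd_succ', fourier_cubeMap, ← sqrt_two_mul_filter,
      show -(3 * k + 2) = -(3 * k) + -2 by ring, fourier_add, show 3 * -k = -(3 * k) by ring]
    ring
  · congr 1; ext t; ring

/-! ### From uniqueness in the refinement equation to bounded harmonic functions -/

namespace IsCantorSystem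

universe v

variable {H : Type v} [NormedAddCommGroup H] [InnerProductSpace ℂ H] [CompleteSpace H]
  {U : H ≃ₗᵢ[ℂ] H} {τ : ℤ → H →L[ℂ] H} {φ : H}

theorem inner_synthesis (S : IsCantorSystem U τ φ) (f : Lp ℂ 2 μT) (k : ℤ) :
    inner ℂ (τ k φ) (S.synthesis f) = fourierCoeff f k := by
  rw [← S.synthesis_fourier, LinearIsometry.inner_map_map, ← fourierBasis_repr,
    HilbertBasis.repr_apply_apply, coe_fourierBasis]

theorem inner_iterate_synthesis (S : IsCantorSystem U τ φ) {h : 𝕋 → ℂ} (hb : MemLp h ∞ μT)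
    (h2 : ∀ n, MemLp (fun t => h t * filterProd n t) 2 μT) (hh : IsHarmonic h) (p n : ℕ) (k : ℤ) :
    inner ℂ (U^[p] (τ k φ)) (S.synthesis ((h2 (n + p)).toLp _))
      = fourierCoeff (fun t => h t * filterProd n t) k := by
  induction p generalizing n k with
  | zero =>
    rw [Function.iterate_zero, id, S.inner_synthesis]
    exact congrFun (fourierCoeff_congr_ae (h2 n).coeFn_toLp) k
  | succ p ih =>
    have e : n + (p + 1) = n + 1 + p := by ring
    simp only [e]
    rw [Function.iterate_succ_apply, S.dilate_translate_scaling, iterate_map_smul, iterate_map_add,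
      inner_smul_left, inner_add_left, ih, ih, conj_sqrt_two_inv,
      fourierCoeff_mul_filterProd hb hh]

/-- If the refinement equation has no solutions besides the multiples of `φ`, then bounded
harmonic functions are constant. -/
theorem boundedHarmonicConst (S : IsCantorSystem U τ φ) (HR : RefinementUnique U τ φ) :
    BoundedHarmonicConst := by
  intro h hb hh
  have h2' : MemLp h 2 μT := hb.mono_exponent le_top
  have h2 : ∀ n, MemLp (fun t => h t * filterProd n t) 2 μT := MemLp.mul_filterProd h2'
  obtain ⟨C, hC⟩ : ∃ C : ℝ, ∀ n, ‖S.synthesis ((h2 n).toLp _)‖ ≤ C := by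
    refine ⟨(eLpNorm h ∞ μT).toReal, fun n => ?_⟩
    rw [LinearIsometry.norm_map, Lp.norm_toLp]
    refine ENNReal.toReal_mono hb.2.ne ?_
    have h3 : eLpNorm (filterProd n) 2 μT = 1 := by
      rw [eLpNorm_eq_lintegral_rpow_enorm_toReal (by norm_num) (by norm_num)]
      have := lintegral_weightProd n
      simp only [← enorm_filterProd_sq] at this
      simp [this]
    refine (eLpNorm_smul_le_mul_eLpNorm (p := ∞) (q := 2) (r := 2)
      (continuous_filterProd n).aestronglyMeasurable hb.1).trans ?_
    rw [h3, mul_one]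
  -- These vectors have norm at most `‖h‖_∞`. Their inner products with `U⁻ᵐ τ k φ` no longer change
  -- once `n ≥ m`, which evaluates the weak limit.
  obtain ⟨ξ, -, hξ⟩ := exists_weak_limit
    (fun n => U.symm^[n] (S.synthesis ((h2 n).toLp _))) (C := C) (fun n => by
      rw [norm_iterate]; exact hC n)
  have hval : ∀ m k, inner ℂ (U.symm^[m] (τ k φ)) ξ
      = fourierCoeff (fun t => h t * filterProd m t) k := by
    intro m k
    refine tendsto_nhds_unique (hξ _) (tendsto_const_nhds.congr' ?_)
    refine Nat.hyperfilter_le_atTop ?_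
    filter_upwards [eventually_ge_atTop m] with n hn
    obtain ⟨p, rfl⟩ := Nat.exists_eq_add_of_le hn
    have hr' : Function.RightInverse U.symm^[m] U^[m] :=
      Function.RightInverse.iterate U.apply_symm_apply _
    rw [← S.inner_iterate_synthesis hb h2 hh p m k]
    rw [← inner_conj_symm (U.symm^[m] (τ k φ)), inner_iterate_symm, inner_conj_symm, add_comm m p,
      Function.iterate_add_apply, hr']
  -- Tested against `U⁻ᵐ τ k φ`, the equation is the recursion `filterProd_succ`: `U` raises the
  -- level to `m + 1`, and `τ 2` becomes multiplication by `z^{2·3ᵐ}`.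
  have href : U ξ = (Real.sqrt 2 : ℂ)⁻¹ • (ξ + τ 2 ξ) := by
    rw [← sub_eq_zero]
    refine S.total _ fun m k => ?_
    have e1 : inner ℂ (U.symm^[m] (τ k φ)) (U ξ)
        = fourierCoeff (fun t => h t * filterProd (m + 1) t) k := by
      rw [← hval, Function.iterate_succ_apply', ← LinearIsometryEquiv.inner_map_map U (U.symm _),
        LinearIsometryEquiv.apply_symm_apply]
    have e2 : inner ℂ (U.symm^[m] (τ k φ)) (τ 2 ξ)
        = fourierCoeff (fun t => h t * filterProd m t) (k - 3 ^ m * 2) := by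
      rw [← hval, ← neg_neg (2 : ℤ), ← S.inner_left, S.iterate_symm_dilate, ← S.add]
      congr 4; ring
    rw [inner_sub_right, inner_smul_right, inner_add_right, e1, e2, hval, sub_eq_zero]
    have i1 := (h2 m).integrable (by norm_num)
    rw [← fourierCoeff_fourier_mul]
    have := congrFun (fourierCoeff.add i1 (i1.fourier_smul (3 ^ m * 2))) k
    simp only [Pi.add_apply, smul_eq_mul] at this
    rw [← this, ← fourierCoeff.const_mul]
    congr 1; ext t
    rw [filterProd_succ]
    simp only [Pi.add_apply]
    ring
  obtain ⟨c, rfl⟩ := HR ξ href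
  rw [ae_const_iff h2']
  intro k hk
  have := hval 0 k
  simp only [filterProd_zero, mul_one, Function.iterate_zero, id] at this
  rw [← this, inner_smul_right, S.inner_left, S.orth, if_neg (by omega), mul_zero]

theorem refinementUnique_iff (S : IsCantorSystem U τ φ) :
    RefinementUnique U τ φ ↔ BoundedHarmonicConst :=
  ⟨S.boundedHarmonicConst, S.refinementUnique⟩

end IsCantorSystem

/-! ### Multiplication by bounded functions -/

/-- The product in `L^∞`. -/
def linftyMul (f g : Lp ℂ ∞ μT) : Lp ℂ ∞ μT := (ContinuousLinearMap.mul ℂ ℂ).holder ∞ f g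

theorem coeFn_linftyMul (f g : Lp ℂ ∞ μT) : linftyMul f g =ᵐ[μT] fun t => f t * g t :=
  ContinuousLinearMap.coeFn_holder (ContinuousLinearMap.mul ℂ ℂ) f g

/-- Multiplication of `L²` functions by bounded functions. -/
def mulLTwo : Lp ℂ ∞ μT →L[ℂ] Lp ℂ 2 μT →L[ℂ] Lp ℂ 2 μT :=
  (ContinuousLinearMap.mul ℂ ℂ).holderL μT ∞ 2 2

theorem coeFn_mulLTwo (f : Lp ℂ ∞ μT) (g : Lp ℂ 2 μT) :
    mulLTwo f g =ᵐ[μT] fun t => f t * g t :=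
  ContinuousLinearMap.coeFn_holder (ContinuousLinearMap.mul ℂ ℂ) f g

/-- The inclusion of `L^∞` into `L²`. -/
def toLTwo : Lp ℂ ∞ μT →L[ℂ] Lp ℂ 2 μT := mulLTwo.flip (fourierLp 2 0)

theorem coeFn_toLTwo (f : Lp ℂ ∞ μT) : toLTwo f =ᵐ[μT] f := by
  filter_upwards [coeFn_mulLTwo f (fourierLp 2 0), coeFn_fourierLp (T := 1) 2 0] with t h1 h2
  change (mulLTwo f (fourierLp 2 0)) t = _
  rw [h1, h2, fourier_zero, mul_one]

theorem toLTwo_fourierLp (k : ℤ) : toLTwo (fourierLp ∞ k) = fourierLp 2 k := by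
  refine Lp.ext ?_
  filter_upwards [coeFn_toLTwo (fourierLp ∞ k), coeFn_fourierLp (T := 1) 2 k,
    coeFn_fourierLp (T := 1) ∞ k] with t h1 h2 h3
  rw [h1, h2, h3]

/-- Composition of a bounded function with the cube map. -/
def compCube (f : Lp ℂ ∞ μT) : Lp ℂ ∞ μT :=
  Lp.compMeasurePreserving cubeMap measurePreserving_cubeMap f

theorem coeFn_compCube (f : Lp ℂ ∞ μT) : compCube f =ᵐ[μT] fun t => f (cubeMap t) :=
  Lp.coeFn_compMeasurePreserving f measurePreserving_cubeMap

theorem coeFn_cantorFilter : cantorFilter =ᵐ[μT] fun t =>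
    (Real.sqrt 2 : ℂ)⁻¹ * (1 + fourier 2 t) := by
  refine (ContinuousMap.coeFn_toLp (p := ∞) (𝕜 := ℂ) μT _).trans (.of_forall fun t => ?_)
  simp

theorem star_fourierLp (k : ℤ) : star (fourierLp ∞ k : Lp ℂ ∞ μT) = fourierLp ∞ (-k) := by
  refine Lp.ext ?_
  filter_upwards [Lp.coeFn_star (fourierLp ∞ k : Lp ℂ ∞ μT), coeFn_fourierLp (T := 1) ∞ k,
    coeFn_fourierLp (T := 1) ∞ (-k)] with t h1 h2 h3
  rw [h1, Pi.star_apply, h2, h3, fourier_neg]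
  rfl

theorem compCube_fourierLp (k : ℤ) : compCube (fourierLp ∞ k) = fourierLp ∞ (3 * k) := by
  refine Lp.ext ?_
  filter_upwards [coeFn_compCube (fourierLp ∞ k), ae_cubeMap (coeFn_fourierLp (T := 1) ∞ k),
    coeFn_fourierLp (T := 1) ∞ (3 * k)] with t h1 h2 h3
  rw [h1, h2, h3, fourier_cubeMap]

theorem linftyMul_fourierLp (j k : ℤ) :
    linftyMul (fourierLp ∞ j) (fourierLp ∞ k) = fourierLp ∞ (j + k) := by
  refine Lp.ext ?_
  filter_upwards [coeFn_linftyMul (fourierLp ∞ j) (fourierLp ∞ k), coeFn_fourierLp (T := 1) ∞ j,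
    coeFn_fourierLp (T := 1) ∞ k, coeFn_fourierLp (T := 1) ∞ (j + k)] with t h1 h2 h3 h4
  rw [h1, h2, h3, h4, fourier_add]

theorem linftyMul_comm (f g : Lp ℂ ∞ μT) : linftyMul f g = linftyMul g f := by
  refine Lp.ext ?_
  filter_upwards [coeFn_linftyMul f g, coeFn_linftyMul g f] with t h1 h2
  rw [h1, h2, mul_comm]

theorem cantorFilter_eq :
    cantorFilter = (Real.sqrt 2 : ℂ)⁻¹ • (fourierLp ∞ 0 + fourierLp ∞ 2 : Lp ℂ ∞ μT) := by
  refine Lp.ext ?_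
  filter_upwards [coeFn_cantorFilter, Lp.coeFn_smul (Real.sqrt 2 : ℂ)⁻¹
    (fourierLp ∞ 0 + fourierLp ∞ 2 : Lp ℂ ∞ μT), Lp.coeFn_add (fourierLp ∞ 0 : Lp ℂ ∞ μT)
    (fourierLp ∞ 2), coeFn_fourierLp (T := 1) ∞ 0, coeFn_fourierLp (T := 1) ∞ 2]
    with t h1 h2 h3 h4 h5
  rw [h1, h2, Pi.smul_apply, h3, Pi.add_apply, h4, h5, fourier_zero, smul_eq_mul]

section Conjugate

variable {H : Type*} [NormedAddCommGroup H] [InnerProductSpace ℂ H]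

/-- The operators `U⁻ⁿ A Uⁿ`. -/
def conjugate (U : H ≃ₗᵢ[ℂ] H) (A : H →L[ℂ] H) : ℕ → H →L[ℂ] H
  | 0 => A
  | n + 1 => (U.symm : H →L[ℂ] H) ∘L conjugate U A n ∘L (U : H →L[ℂ] H)

theorem conjugate_succ_apply (U : H ≃ₗᵢ[ℂ] H) (A : H →L[ℂ] H) (n : ℕ) (v : H) :
    conjugate U A (n + 1) v = U.symm (conjugate U A n (U v)) := rfl

theorem norm_conjugate_le (U : H ≃ₗᵢ[ℂ] H) (A : H →L[ℂ] H) (n : ℕ) : ‖conjugate U A n‖ ≤ ‖A‖ := by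
  refine ContinuousLinearMap.opNorm_le_bound _ (norm_nonneg _) fun v => ?_
  induction n generalizing v with
  | zero => exact A.le_opNorm v
  | succ n ih =>
    rw [conjugate_succ_apply, LinearIsometryEquiv.norm_map]
    simpa using ih (U v)

end Conjugate

/-! ### Wavelet representations as dilation-translation systems -/

section Rep

universe v

variable {H : Type v} [NormedAddCommGroup H] [InnerProductSpace ℂ H] [CompleteSpace H]

namespace LInftyRep

theorem apply_add (π : LInftyRep μT H) (f g : Lp ℂ ∞ μT) : π (f + g) = π f + π g :=
  π.toLinearMap.map_add f g

theorem apply_smul (π : LInftyRep μT H) (c : ℂ) (f : Lp ℂ ∞ μT) : π (c • f) = c • π f :=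
  π.toLinearMap.map_smul c f

theorem apply_sub (π : LInftyRep μT H) (f g : Lp ℂ ∞ μT) : π (f - g) = π f - π g :=
  π.toLinearMap.map_sub f g

theorem apply_sum (π : LInftyRep μT H) {ι : Type*} (s : Finset ι) (f : ι → Lp ℂ ∞ μT) :
    π (∑ i ∈ s, f i) = ∑ i ∈ s, π (f i) :=
  map_sum π.toLinearMap f s

theorem apply_mul (π : LInftyRep μT H) (f g : Lp ℂ ∞ μT) (v : H) :
    π (linftyMul f g) v = π f (π g v) := by
  rw [π.map_mul f g _ (coeFn_linftyMul f g)]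
  rfl

theorem apply_comm (π : LInftyRep μT H) (f g : Lp ℂ ∞ μT) (v : H) :
    π f (π g v) = π g (π f v) := by
  rw [← apply_mul, linftyMul_comm, apply_mul]

theorem apply_fourier_zero (π : LInftyRep μT H) (v : H) : π (fourierLp ∞ 0) v = v := by
  rw [π.map_one (fourierLp ∞ 0)]
  · rfl
  · filter_upwards [coeFn_fourierLp (T := 1) ∞ 0] with t ht
    rw [ht, fourier_zero]

theorem inner_apply_left (π : LInftyRep μT H) (f : Lp ℂ ∞ μT) (u v : H) :
    inner ℂ (π f u) v = inner ℂ u (π (star f) v) := by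
  rw [π.map_star, ContinuousLinearMap.adjoint_inner_right]

end LInftyRep

/-- The subspaces `U⁻ᵐ π(L^∞) φ` increase with `m`, so finitely many vectors can be moved to a
common level. -/
theorem exists_iterate_symm_eq {U : H ≃ₗᵢ[ℂ] H} {π : LInftyRep μT H} {φ : H}
    (hstep : ∀ f, ∃ g, U (π f φ) = π g φ) (m p : ℕ) (f : Lp ℂ ∞ μT) :
    ∃ g : Lp ℂ ∞ μT, U.symm^[m] (π f φ) = U.symm^[m + p] (π g φ) := by
  induction p generalizing f with
  | zero => exact ⟨f, rfl⟩
  | succ p ih =>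
    obtain ⟨g, hg⟩ := ih f
    obtain ⟨g', hg'⟩ := hstep g
    refine ⟨g', ?_⟩
    rw [hg, ← hg', ← add_assoc, Function.iterate_succ_apply, LinearIsometryEquiv.symm_apply_apply]

/-- Totality implies density of the set of the vectors `U⁻ⁿ π(f) φ`, as it is a subspace. -/
theorem dense_iterate_symm {U : H ≃ₗᵢ[ℂ] H} {π : LInftyRep μT H} {φ : H}
    (hstep : ∀ f, ∃ g, U (π f φ) = π g φ)
    (htot : ∀ η, (∀ n f, inner ℂ (U.symm^[n] (π f φ)) η = 0) → η = 0) :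
    Dense {v : H | ∃ (n : ℕ) (f : Lp ℂ ∞ μT), v = U.symm^[n] (π f φ)} := by
  let K : Submodule ℂ H :=
    { carrier := {v : H | ∃ (n : ℕ) (f : Lp ℂ ∞ μT), v = U.symm^[n] (π f φ)}
      add_mem' := by
        rintro _ _ ⟨m, f, rfl⟩ ⟨n, g, rfl⟩
        obtain ⟨f', hf'⟩ := exists_iterate_symm_eq hstep m n f
        obtain ⟨g', hg'⟩ := exists_iterate_symm_eq hstep n m g
        refine ⟨m + n, f' + g', ?_⟩
        rw [hf', hg', add_comm n m, ← iterate_map_add, LInftyRep.apply_add, add_apply]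
      zero_mem' := ⟨0, 0, by
        have := LInftyRep.apply_smul π 0 0
        rw [zero_smul, zero_smul] at this
        simp [this]⟩
      smul_mem' := by
        rintro c _ ⟨m, f, rfl⟩
        exact ⟨m, c • f, by rw [LInftyRep.apply_smul, smul_apply, iterate_map_smul]⟩ }
  change Dense (K : Set H)
  rw [Submodule.dense_iff_topologicalClosure_eq_top, Submodule.topologicalClosure_eq_top_iff,
    Submodule.eq_bot_iff]
  intro η hη
  exact htot η fun n f => hη _ ⟨n, f, rfl⟩

/-! ### Irreducibility and bounded harmonic functions -/

namespace IsCantorWaveletRep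

variable {U : H ≃ₗᵢ[ℂ] H} {π : LInftyRep μT H} {φ : H}

theorem dilate (W : IsCantorWaveletRep U π φ) (f : Lp ℂ ∞ μT) (v : H) :
    U (π f v) = π (compCube f) (U v) := by
  have := W.covariance f (U v)
  rwa [LinearIsometryEquiv.symm_apply_apply] at this

theorem symm_dilate (W : IsCantorWaveletRep U π φ) (f : Lp ℂ ∞ μT) (v : H) :
    U.symm (π (compCube f) v) = π f (U.symm v) := by
  rw [LinearIsometryEquiv.symm_apply_eq]
  exact (W.covariance f v).symm

theorem inner_apply (W : IsCantorWaveletRep U π φ) (f g : Lp ℂ ∞ μT) :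
    inner ℂ (π f φ) (π g φ) = ∫ t, (starRingEnd ℂ) (f t) * g t ∂μT := by
  rw [LInftyRep.inner_apply_left, ← LInftyRep.apply_mul, W.orthogonality]
  refine integral_congr_ae ?_
  filter_upwards [coeFn_linftyMul (star f) g, Lp.coeFn_star f] with t h1 h2
  rw [h1, h2]; rfl

theorem norm_apply (W : IsCantorWaveletRep U π φ) (f : Lp ℂ ∞ μT) : ‖π f φ‖ = ‖toLTwo f‖ := by
  have h : inner ℂ (π f φ) (π f φ) = inner ℂ (toLTwo f) (toLTwo f) := by
    rw [W.inner_apply, L2.inner_def]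
    refine integral_congr_ae ?_
    filter_upwards [coeFn_toLTwo f] with t ht
    rw [ht, RCLike.inner_apply, mul_comm]
  rw [inner_self_eq_norm_sq_to_K, inner_self_eq_norm_sq_to_K] at h
  have h' : ‖π f φ‖ ^ 2 = ‖toLTwo f‖ ^ 2 := by exact_mod_cast h
  exact (pow_left_inj₀ (norm_nonneg _) (norm_nonneg _) two_ne_zero).1 h'

/-- `f ↦ π f φ` is isometric for the `L²` norm, so the partial Fourier sums of `f` converge after
application to `φ`, although they need not converge in `L^∞`. -/
theorem inner_eq_zero (W : IsCantorWaveletRep U π φ) {ζ : H}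
    (hζ : ∀ k : ℤ, inner ℂ (π (fourierLp ∞ k) φ) ζ = 0) (f : Lp ℂ ∞ μT) :
    inner ℂ (π f φ) ζ = 0 := by
  have hs := hasSum_fourier_series_L2 (toLTwo f)
  set a := fourierCoeff (toLTwo f)
  have hlim : Tendsto (fun s : Finset ℤ => π (∑ k ∈ s, a k • fourierLp ∞ k) φ) atTop
      (𝓝 (π f φ)) := by
    rw [tendsto_iff_norm_sub_tendsto_zero]
    have h1 := tendsto_iff_norm_sub_tendsto_zero.1 hs
    refine h1.congr fun s => ?_
    rw [← sub_apply, ← LInftyRep.apply_sub, W.norm_apply, map_sub, map_sum]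
    simp only [map_smul, toLTwo_fourierLp]
  have h2 := hlim.inner (𝕜 := ℂ) (tendsto_const_nhds (x := ζ))
  refine tendsto_nhds_unique h2 (tendsto_const_nhds.congr fun s => ?_)
  rw [LInftyRep.apply_sum]
  simp only [LInftyRep.apply_smul, sum_apply, smul_apply, sum_inner, inner_smul_left, hζ, mul_zero,
    Finset.sum_const_zero]

theorem scaling' (W : IsCantorWaveletRep U π φ) :
    U φ = (Real.sqrt 2 : ℂ)⁻¹ • (φ + π (fourierLp ∞ 2) φ) := by
  rw [W.scaling, cantorFilter_eq, LInftyRep.apply_smul, LInftyRep.apply_add,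
    smul_apply, add_apply, LInftyRep.apply_fourier_zero]

theorem isCantorSystem (W : IsCantorWaveletRep U π φ) :
    IsCantorSystem U (fun k => π (fourierLp ∞ k)) φ where
  add j k v := by rw [← linftyMul_fourierLp, LInftyRep.apply_mul]
  inner_left k u v := by rw [LInftyRep.inner_apply_left, star_fourierLp]
  dilate k v := by rw [W.dilate, compCube_fourierLp]
  scaling := W.scaling'
  orth k := by
    rw [W.orthogonality]
    have h := congrFun (fourierCoeff_fourier (T := 1) k) 0
    rw [fourierCoeff_def] at h
    simp only [neg_zero, fourier_zero, one_mul] at h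
    rw [integral_congr_ae (coeFn_fourierLp (T := 1) ∞ k), h, Pi.single_apply]
    simp only [eq_comm]
  zero v := LInftyRep.apply_fourier_zero π v
  total η hη := by
    have h : ∀ v : H, inner ℂ v η = 0 := by
      intro v
      refine W.density.induction ?_ (isClosed_eq (by fun_prop) continuous_const) v
      rintro _ ⟨n, f, rfl⟩
      rw [inner_iterate_symm]
      refine W.inner_eq_zero (fun k => ?_) f
      rw [← inner_iterate_symm]
      exact hη n k
    exact inner_self_eq_zero.1 (h η)

/-- An operator of the commutant maps `φ` to a solution of the refinement equation, hence to `c •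
φ`, and then agrees with `c` on the dense set of the `U⁻ⁿ π(f) φ`. -/
theorem isIrreducible (W : IsCantorWaveletRep U π φ)
    (HR : RefinementUnique U (fun k => π (fourierLp ∞ k)) φ) : IsIrreducible U π := by
  intro A hU hπ
  obtain ⟨c, hc⟩ := HR (A φ) (by
    rw [← hU, W.scaling', map_smul, map_add, hπ])
  have hs : ∀ v, A (U.symm v) = U.symm (A v) := fun v => by
    rw [← LinearIsometryEquiv.symm_apply_apply U (A (U.symm v)), ← hU,
      LinearIsometryEquiv.apply_symm_apply]
  have hn : ∀ n v, A (U.symm^[n] v) = U.symm^[n] (A v) := fun n => by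
    induction n with
    | zero => exact fun v => rfl
    | succ n ih => intro v; rw [Function.iterate_succ_apply, ih, hs, Function.iterate_succ_apply]
  refine ⟨c, ?_⟩
  ext v
  refine W.density.induction ?_ (isClosed_eq (by fun_prop) (by fun_prop)) v
  rintro _ ⟨n, f, rfl⟩
  rw [hn, hπ, hc, map_smul, iterate_map_smul]
  rfl

theorem dilate_apply (W : IsCantorWaveletRep U π φ) (f : Lp ℂ ∞ μT) :
    U (π f φ) = π (linftyMul (compCube f) cantorFilter) φ := by
  rw [W.dilate, W.scaling, LInftyRep.apply_mul]

theorem iterate_symm_eq (W : IsCantorWaveletRep U π φ) (m p : ℕ) (f : Lp ℂ ∞ μT) :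
    ∃ g : Lp ℂ ∞ μT, U.symm^[m] (π f φ) = U.symm^[m + p] (π g φ) :=
  exists_iterate_symm_eq (fun f => ⟨_, W.dilate_apply f⟩) m p f

/-- Moving `π f` across `U` replaces `f` by `f ∘ r`, `L^∞` is commutative, and `U⁻¹` undoes the
replacement. -/
theorem conjugate_commute (W : IsCantorWaveletRep U π φ) (h f : Lp ℂ ∞ μT) (n : ℕ) (v : H) :
    conjugate U (π h) n (π f v) = π f (conjugate U (π h) n v) := by
  induction n generalizing f v with
  | zero => exact LInftyRep.apply_comm π h f v
  | succ n ih => rw [conjugate_succ_apply, W.dilate, ih, W.symm_dilate, conjugate_succ_apply]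

theorem inner_apply_apply (W : IsCantorWaveletRep U π φ) (h f g : Lp ℂ ∞ μT) :
    inner ℂ (π f φ) (π h (π g φ)) = ∫ t, h t * ((starRingEnd ℂ) (f t) * g t) ∂μT := by
  rw [← LInftyRep.apply_mul, W.inner_apply]
  refine integral_congr_ae ?_
  filter_upwards [coeFn_linftyMul h g] with t h1
  rw [h1]; ring

theorem inner_dilate_apply (W : IsCantorWaveletRep U π φ) {h : Lp ℂ ∞ μT} (hh : IsHarmonic h)
    (f g : Lp ℂ ∞ μT) :
    inner ℂ (U (π f φ)) (π h (U (π g φ))) = inner ℂ (π f φ) (π h (π g φ)) := by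
  rw [W.dilate_apply, W.dilate_apply, W.inner_apply_apply, W.inner_apply_apply]
  have hi : MemLp (fun t => (starRingEnd ℂ) (f t) * g t) ∞ μT := by
    refine (Lp.memLp (linftyMul (star f) g)).ae_eq ?_
    filter_upwards [coeFn_linftyMul (star f) g, Lp.coeFn_star f] with t h1 h2
    rw [h1, h2]; rfl
  have key := hh.integral_mul (Lp.aestronglyMeasurable h) hi.1 (by
    have hc := hi.comp_measurePreserving measurePreserving_cubeMap
    exact (hc.mul (Lp.memLp h) (r := ∞)).integrable le_top)
  rw [← key]
  refine integral_congr_ae ?_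
  filter_upwards [coeFn_linftyMul (compCube f) cantorFilter,
    coeFn_linftyMul (compCube g) cantorFilter, coeFn_compCube f, coeFn_compCube g,
    coeFn_cantorFilter] with t h1 h2 h3 h4 h5
  rw [h1, h2, h3, h4, h5, ← sqrt_two_mul_filter, fourier_neg, map_mul, map_mul, map_add, map_one,
    conj_sqrt_two_inv]
  ring

/-- Outer dilations cancel down to level 0; there each further conjugation leaves the matrix
coefficient unchanged by harmonicity. Thus the operators `U⁻ⁿ π(h) Uⁿ` stabilise weakly on every
level. -/
theorem inner_conjugate (W : IsCantorWaveletRep U π φ) {h : Lp ℂ ∞ μT} (hh : IsHarmonic h)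
    (m n : ℕ) (f g : Lp ℂ ∞ μT) :
    inner ℂ (U.symm^[m] (π f φ)) (conjugate U (π h) (m + n) (U.symm^[m] (π g φ)))
      = inner ℂ (π f φ) (π h (π g φ)) := by
  induction m with
  | zero =>
    simp only [Function.iterate_zero, id, zero_add]
    induction n generalizing f g with
    | zero => rfl
    | succ n ih =>
      rw [conjugate_succ_apply, ← LinearIsometryEquiv.inner_map_map U,
        LinearIsometryEquiv.apply_symm_apply, W.dilate_apply, W.dilate_apply, ih, ← W.dilate_apply,
        ← W.dilate_apply, W.inner_dilate_apply hh]
  | succ m ih =>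
    rw [show m + 1 + n = m + n + 1 by ring, Function.iterate_succ_apply',
      Function.iterate_succ_apply', conjugate_succ_apply, LinearIsometryEquiv.inner_map_map,
      LinearIsometryEquiv.apply_symm_apply, ih]

/-- Bounded harmonic functions are constant if the representation is irreducible. -/
theorem boundedHarmonicConst (W : IsCantorWaveletRep U π φ) (hI : IsIrreducible U π) :
    BoundedHarmonicConst := by
  intro k hb hk
  set h : Lp ℂ ∞ μT := hb.toLp k with hdef
  have hkh : k =ᵐ[μT] h := hb.coeFn_toLp.symm
  have hh : IsHarmonic h := hk.congr hkh
  obtain ⟨A, hA⟩ := exists_weak_operator_limit (conjugate U (π h)) (norm_conjugate_le U (π h))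
  have hval : ∀ m f g, inner ℂ (U.symm^[m] (π f φ)) (A (U.symm^[m] (π g φ)))
      = inner ℂ (π f φ) (π h (π g φ)) := by
    intro m f g
    refine tendsto_nhds_unique (hA _ _) (tendsto_const_nhds.congr' ?_)
    refine Nat.hyperfilter_le_atTop ?_
    filter_upwards [eventually_ge_atTop m] with n hn
    obtain ⟨p, rfl⟩ := Nat.exists_eq_add_of_le hn
    exact (W.inner_conjugate hh m p f g).symm
  have hAπ : ∀ f v, A (π f v) = π f (A v) := by
    intro f v
    refine ext_inner_left ℂ fun u => tendsto_nhds_unique (hA u (π f v)) ?_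
    have h1 := hA (π (star f) u) v
    simp only [LInftyRep.inner_apply_left, star_star] at h1
    exact h1.congr fun n => by rw [W.conjugate_commute]
  have hAU' : ∀ u v, inner ℂ (U u) (A (U v)) = inner ℂ u (A v) := by
    intro u v
    refine W.density.induction (P := fun u => inner ℂ (U u) (A (U v)) = inner ℂ u (A v)) ?_
      (isClosed_eq (by fun_prop) (by fun_prop)) u
    rintro _ ⟨m, f, rfl⟩
    refine W.density.induction (P := fun v => inner ℂ (U _) (A (U v)) = inner ℂ _ (A v)) ?_
      (isClosed_eq (by fun_prop) (by fun_prop)) v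
    rintro _ ⟨n, g, rfl⟩
    -- Both vectors are moved to level `m + n + 1`; the extra 1 lets `U` bring them to level `m +
    -- n`, and the matrix coefficients of `A` do not depend on the level.
    obtain ⟨f', hf'⟩ := W.iterate_symm_eq m (n + 1) f
    obtain ⟨g', hg'⟩ := W.iterate_symm_eq n (m + 1) g
    rw [show n + (m + 1) = m + n + 1 by ring] at hg'
    rw [← add_assoc] at hf'
    rw [hf', hg', hval, Function.iterate_succ_apply', Function.iterate_succ_apply',
      LinearIsometryEquiv.apply_symm_apply, LinearIsometryEquiv.apply_symm_apply, hval]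
  have hAU : ∀ v, A (U v) = U (A v) := by
    intro v
    refine ext_inner_left ℂ fun u => ?_
    have := hAU' (U.symm u) v
    rw [LinearIsometryEquiv.apply_symm_apply] at this
    rw [this, ← LinearIsometryEquiv.inner_map_map U, LinearIsometryEquiv.apply_symm_apply]
  obtain ⟨c, hc⟩ := hI A hAU hAπ
  rw [ae_const_iff (hb.mono_exponent le_top)]
  intro j hj
  -- With `A = c`, this coefficient is `c ⟨τ_j φ, φ⟩ = 0`, while it also equals the `j`-th Fourier
  -- coefficient of `h`.
  have h1 := hval 0 (fourierLp ∞ j) (fourierLp ∞ 0)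
  rw [W.inner_apply_apply] at h1
  simp only [Function.iterate_zero, id, hc, LInftyRep.apply_fourier_zero,
    smul_apply, one_apply_eq_self] at h1
  have S := W.isCantorSystem
  rw [inner_smul_right, S.inner_left j φ φ, S.orth, if_neg (by omega), mul_zero] at h1
  rw [fourierCoeff_def, h1]
  refine integral_congr_ae ?_
  filter_upwards [hkh, coeFn_fourierLp (T := 1) ∞ j, coeFn_fourierLp (T := 1) ∞ 0] with t e1 e2 e3
  rw [e1, e2, e3, fourier_neg, fourier_zero]
  ring

theorem isIrreducible_iff (W : IsCantorWaveletRep U π φ) :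
    IsIrreducible U π ↔ BoundedHarmonicConst :=
  ⟨W.boundedHarmonicConst, fun h => W.isIrreducible (W.isCantorSystem.refinementUnique h)⟩

end IsCantorWaveletRep

end Rep

/-! ### Existence of the wavelet representation

The filters `m₀ = (1 + z²) / √2`, `m₁ = z`, `m₂ = (1 - z²) / √2` give isometries
`S_i g = m_i (g ∘ r)` of `L²` of the circle which satisfy the Cuntz relations, and the wavelet
representation is realized on the sum of countably many copies of `L²`. -/

theorem lTwo_ext {f g : Lp ℂ 2 μT} (h : ∀ k : ℤ, inner ℂ (fourierLp 2 k) f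
    = (inner ℂ (fourierLp 2 k) g : ℂ)) : f = g := by
  apply fourierBasis.repr.injective
  ext k
  rw [HilbertBasis.repr_apply_apply, HilbertBasis.repr_apply_apply, coe_fourierBasis, h]

theorem clm_ext_fourierLp {F G : Lp ℂ 2 μT →L[ℂ] Lp ℂ 2 μT}
    (h : ∀ k : ℤ, F (fourierLp 2 k) = G (fourierLp 2 k)) : F = G := by
  refine ContinuousLinearMap.ext_on (s := Set.range (fourierLp (T := 1) 2)) ?_ ?_
  · rw [Submodule.dense_iff_topologicalClosure_eq_top]
    exact span_fourierLp_closure_eq_top (by norm_num)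
  · rintro _ ⟨k, rfl⟩
    exact h k

theorem inner_fourierLp (j k : ℤ) :
    (inner ℂ (fourierLp (T := 1) 2 j) (fourierLp 2 k) : ℂ) = if j = k then 1 else 0 :=
  orthonormal_iff_ite.1 orthonormal_fourier j k

/-- The three filters. -/
def filterBank : Fin 3 → Lp ℂ ∞ μT :=
  ![cantorFilter, fourierLp ∞ 1, (Real.sqrt 2 : ℂ)⁻¹ • (fourierLp ∞ 0 - fourierLp ∞ 2)]

/-- The isometry `g ↦ m_i (g ∘ r)`. -/
def cuntz (i : Fin 3) : Lp ℂ 2 μT →L[ℂ] Lp ℂ 2 μT :=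
  mulLTwo (filterBank i) ∘L
    (Lp.compMeasurePreservingₗᵢ ℂ cubeMap measurePreserving_cubeMap).toContinuousLinearMap

theorem coeFn_cuntz (i : Fin 3) (g : Lp ℂ 2 μT) :
    cuntz i g =ᵐ[μT] fun t => filterBank i t * g (cubeMap t) := by
  filter_upwards [coeFn_mulLTwo (filterBank i)
    (Lp.compMeasurePreserving cubeMap measurePreserving_cubeMap g),
    Lp.coeFn_compMeasurePreserving g measurePreserving_cubeMap] with t h1 h2
  change (mulLTwo (filterBank i) (Lp.compMeasurePreserving cubeMap measurePreserving_cubeMap g)) t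
    = _
  rw [h1, h2]; rfl

theorem comp_fourierLp (k : ℤ) : (Lp.compMeasurePreserving cubeMap measurePreserving_cubeMap)
    (fourierLp 2 k : Lp ℂ 2 μT) = fourierLp 2 (3 * k) := by
  refine Lp.ext ?_
  filter_upwards [Lp.coeFn_compMeasurePreserving (fourierLp 2 k : Lp ℂ 2 μT)
    measurePreserving_cubeMap, ae_cubeMap (coeFn_fourierLp (T := 1) 2 k),
    coeFn_fourierLp (T := 1) 2 (3 * k)] with t h1 h2 h3
  rw [h1, Function.comp_apply, h2, h3, fourier_cubeMap]

theorem mulLTwo_fourierLp (j k : ℤ) :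
    mulLTwo (fourierLp ∞ j) (fourierLp 2 k) = fourierLp 2 (k + j) := by
  refine Lp.ext ?_
  filter_upwards [coeFn_mulLTwo (fourierLp ∞ j) (fourierLp 2 k), coeFn_fourierLp (T := 1) ∞ j,
    coeFn_fourierLp (T := 1) 2 k, coeFn_fourierLp (T := 1) 2 (k + j)] with t h1 h2 h3 h4
  rw [h1, h2, h3, h4, fourier_add, mul_comm]

theorem cuntz_fourierLp (i : Fin 3) (k : ℤ) :
    cuntz i (fourierLp 2 k) = mulLTwo (filterBank i) (fourierLp 2 (3 * k)) :=
  congrArg (mulLTwo (filterBank i)) (comp_fourierLp k)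

theorem cuntz_zero_fourierLp (k : ℤ) : cuntz 0 (fourierLp 2 k)
    = (Real.sqrt 2 : ℂ)⁻¹ • (fourierLp 2 (3 * k) + fourierLp 2 (3 * k + 2)) := by
  rw [cuntz_fourierLp, show filterBank 0 = cantorFilter from rfl, cantorFilter_eq]
  simp only [map_smul, map_add, smul_apply, add_apply, mulLTwo_fourierLp, add_zero]

theorem cuntz_one_fourierLp (k : ℤ) : cuntz 1 (fourierLp 2 k) = fourierLp 2 (3 * k + 1) := by
  rw [cuntz_fourierLp]
  exact mulLTwo_fourierLp 1 (3 * k)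

theorem cuntz_two_fourierLp (k : ℤ) : cuntz 2 (fourierLp 2 k)
    = (Real.sqrt 2 : ℂ)⁻¹ • (fourierLp 2 (3 * k) - fourierLp 2 (3 * k + 2)) := by
  rw [cuntz_fourierLp,
    show filterBank 2 = (Real.sqrt 2 : ℂ)⁻¹ • (fourierLp ∞ 0 - fourierLp ∞ 2) from rfl]
  simp only [map_smul, map_sub, smul_apply, sub_apply, mulLTwo_fourierLp, add_zero]

/-- Filter 1 uses frequencies congruent to 1 mod 3, the other two those congruent to 0 and 2;
between filters 0 and 2 the signs cancel. -/
theorem inner_cuntz_fourierLp (i j : Fin 3) (k l : ℤ) :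
    (inner ℂ (cuntz i (fourierLp 2 k)) (cuntz j (fourierLp 2 l)) : ℂ)
      = if i = j then (if k = l then 1 else 0) else 0 := by
  have h := ofReal_sqrt_two_inv_mul_self
  have a1 : ((3 * k = 3 * l + 1) = False) := eq_false (by omega)
  have a2 : ((3 * k = 3 * l + 2) = False) := eq_false (by omega)
  have a3 : ((3 * k + 1 = 3 * l) = False) := eq_false (by omega)
  have a4 : ((3 * k + 2 = 3 * l) = False) := eq_false (by omega)
  have a5 : ((3 * k + 1 = 3 * l + 2) = False) := eq_false (by omega)
  have a6 : ((3 * k + 2 = 3 * l + 1) = False) := eq_false (by omega)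
  have a7 : (3 * k = 3 * l) = (k = l) := propext (by omega)
  have a8 : (3 * k + 1 = 3 * l + 1) = (k = l) := propext (by omega)
  have a9 : (3 * k + 2 = 3 * l + 2) = (k = l) := propext (by omega)
  fin_cases i <;> fin_cases j <;>
  simp only [Fin.zero_eta, Fin.mk_one, Fin.reduceFinMk, cuntz_zero_fourierLp, cuntz_one_fourierLp,
    cuntz_two_fourierLp, inner_smul_left, inner_smul_right, inner_add_left, inner_add_right,
    inner_sub_left, inner_sub_right, inner_fourierLp, conj_sqrt_two_inv, a1, a2, a3, a4, a5, a6,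
    a7, a8, a9, if_false, Fin.reduceEq, if_true, one_ne_zero, zero_ne_one] <;>
  (try split_ifs) <;> first | ring1 | linear_combination 2 * h

theorem adjoint_cuntz_cuntz (i j : Fin 3) (x : Lp ℂ 2 μT) :
    ContinuousLinearMap.adjoint (cuntz i) (cuntz j x) = if i = j then x else 0 := by
  have : ContinuousLinearMap.adjoint (cuntz i) ∘L cuntz j
      = if i = j then ContinuousLinearMap.id ℂ _ else 0 := by
    refine clm_ext_fourierLp fun k => lTwo_ext fun l => ?_
    rw [ContinuousLinearMap.comp_apply, ContinuousLinearMap.adjoint_inner_right,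
      inner_cuntz_fourierLp]
    by_cases h1 : i = j
    · rw [if_pos h1, if_pos h1, ContinuousLinearMap.id_apply, inner_fourierLp]
    · simp [h1]
  have h := congrArg (fun F => F x) this
  simp only [ContinuousLinearMap.comp_apply] at h
  rw [h]
  split_ifs <;> rfl

theorem inner_cuntz (i j : Fin 3) (x y : Lp ℂ 2 μT) :
    (inner ℂ (cuntz i x) (cuntz j y) : ℂ) = if i = j then inner ℂ x y else 0 := by
  rw [← ContinuousLinearMap.adjoint_inner_right, adjoint_cuntz_cuntz]
  split_ifs <;> simp

/-- The sum of the range projections fixes every range, and each `z^n` lies in the span of the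
ranges, by the residue of `n` mod 3. -/
theorem sum_cuntz_adjoint (x : Lp ℂ 2 μT) :
    ∑ i, cuntz i (ContinuousLinearMap.adjoint (cuntz i) x) = x := by
  set P : Lp ℂ 2 μT →L[ℂ] Lp ℂ 2 μT := ∑ i, cuntz i ∘L ContinuousLinearMap.adjoint (cuntz i)
    with hP
  have hPa : ∀ x, P x = ∑ i, cuntz i (ContinuousLinearMap.adjoint (cuntz i) x) := fun x => by
    simp [hP, sum_apply]
  have hfix : ∀ j x, P (cuntz j x) = cuntz j x := by
    intro j x
    rw [hPa]
    simp only [adjoint_cuntz_cuntz]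
    rw [Finset.sum_eq_single j]
    · simp
    · intro i _ hij; simp [hij]
    · simp
  have h2 : (Real.sqrt 2 : ℂ) * (Real.sqrt 2 : ℂ)⁻¹ = 1 := mul_inv_cancel₀ (by simp)
  have hI : P = ContinuousLinearMap.id ℂ _ := by
    refine clm_ext_fourierLp fun n => ?_
    rw [ContinuousLinearMap.id_apply]
    obtain ⟨k, rfl | rfl | rfl⟩ : ∃ k, n = 3 * k ∨ n = 3 * k + 1 ∨ n = 3 * k + 2 :=
      ⟨n / 3, by omega⟩
    · have e : fourierLp 2 (3 * k) = (Real.sqrt 2 : ℂ)⁻¹ •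
          (cuntz 0 (fourierLp 2 k) + cuntz 2 (fourierLp 2 k)) := by
        rw [cuntz_zero_fourierLp, cuntz_two_fourierLp, ← smul_add, smul_smul,
          ofReal_sqrt_two_inv_mul_self]
        module
      rw [e, map_smul, map_add, hfix, hfix]
    · rw [← cuntz_one_fourierLp, hfix]
    · have e : fourierLp 2 (3 * k + 2) = (Real.sqrt 2 : ℂ)⁻¹ •
          (cuntz 0 (fourierLp 2 k) - cuntz 2 (fourierLp 2 k)) := by
        rw [cuntz_zero_fourierLp, cuntz_two_fourierLp, ← smul_sub, smul_smul,
          ofReal_sqrt_two_inv_mul_self]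
        module
      rw [e, map_smul, map_sub, hfix, hfix]
  rw [← hPa, hI, ContinuousLinearMap.id_apply]

theorem norm_sum_cuntz_sq (x : Fin 3 → Lp ℂ 2 μT) :
    ‖∑ i, cuntz i (x i)‖ ^ 2 = ∑ i, ‖x i‖ ^ 2 := by
  have h : (inner ℂ (∑ i, cuntz i (x i)) (∑ i, cuntz i (x i)) : ℂ) = ∑ i, inner ℂ (x i) (x i) := by
    rw [sum_inner]
    refine Finset.sum_congr rfl fun i _ => ?_
    rw [inner_sum]
    simp [inner_cuntz]
  simp only [inner_self_eq_norm_sq_to_K] at h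
  exact_mod_cast h

/-- Composition of bounded functions with the iterates of the cube map. -/
def compCubeIter (n : ℕ) : Lp ℂ ∞ μT →ₗ[ℂ] Lp ℂ ∞ μT :=
  Lp.compMeasurePreservingₗ ℂ cubeMap^[n] (measurePreserving_cubeMap.iterate n)

theorem coeFn_compCubeIter (n : ℕ) (f : Lp ℂ ∞ μT) :
    compCubeIter n f =ᵐ[μT] fun t => f (cubeMap^[n] t) :=
  Lp.coeFn_compMeasurePreserving f (measurePreserving_cubeMap.iterate n)

theorem ae_iterate_cubeMap {P : 𝕋 → Prop} (n : ℕ) (h : ∀ᵐ t ∂μT, P t) :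
    ∀ᵐ t ∂μT, P (cubeMap^[n] t) :=
  (measurePreserving_cubeMap.iterate n).quasiMeasurePreserving.ae h

theorem compCubeIter_zero (f : Lp ℂ ∞ μT) : compCubeIter 0 f = f :=
  Lp.ext (coeFn_compCubeIter 0 f)

theorem compCubeIter_compCube (n : ℕ) (f : Lp ℂ ∞ μT) :
    compCubeIter n (compCube f) = compCubeIter (n + 1) f := by
  refine Lp.ext ?_
  filter_upwards [coeFn_compCubeIter n (compCube f), ae_iterate_cubeMap n (coeFn_compCube f),
    coeFn_compCubeIter (n + 1) f] with t h1 h2 h3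
  rw [h1, h2, h3, Function.iterate_succ_apply']

theorem norm_compCubeIter (n : ℕ) (f : Lp ℂ ∞ μT) : ‖compCubeIter n f‖ = ‖f‖ :=
  Lp.norm_compMeasurePreserving f (measurePreserving_cubeMap.iterate n)

theorem inner_mulLTwo_star (f : Lp ℂ ∞ μT) (n : ℕ) (x y : Lp ℂ 2 μT) :
    (inner ℂ (mulLTwo (compCubeIter n (star f)) x) y : ℂ)
      = inner ℂ x (mulLTwo (compCubeIter n f) y) := by
  rw [L2.inner_def, L2.inner_def]
  refine integral_congr_ae ?_
  filter_upwards [coeFn_mulLTwo (compCubeIter n (star f)) x, coeFn_mulLTwo (compCubeIter n f) y,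
    coeFn_compCubeIter n (star f), coeFn_compCubeIter n f,
    ae_iterate_cubeMap n (Lp.coeFn_star f)] with t h1 h2 h3 h4 h5
  simp only [RCLike.inner_apply, h1, h2, h3, h4, h5, Pi.star_apply, map_mul]
  rw [RCLike.star_def, RingHomCompTriple.comp_apply, RingHom.id_apply]
  ring

/-- The Hilbert space of the model. -/
abbrev ModelSpace : Type := lp (fun _ : ℕ => Lp ℂ 2 μT) 2

/-- The operators of the model representation: on the `j`-th summand, `f` acts as multiplication
by `f ∘ r^n` with `n = (j - 1) / 2`. -/
def modelOp (f : Lp ℂ ∞ μT) : ModelSpace →L[ℂ] ModelSpace :=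
  lp.mapCLM 2 (fun j => mulLTwo (compCubeIter ((j - 1) / 2) f)) (K := ‖mulLTwo‖ * ‖f‖)
    (by positivity) fun j => (mulLTwo.le_opNorm _).trans_eq (by rw [norm_compCubeIter])

theorem modelOp_apply (f : Lp ℂ ∞ μT) (x : ModelSpace) (j : ℕ) :
    modelOp f x j = mulLTwo (compCubeIter ((j - 1) / 2) f) (x j) := rfl

/-- The model representation of `L^∞`. -/
def modelRep : LInftyRep μT ModelSpace where
  toFun := modelOp
  map_add' f g := by
    ext x : 1
    refine lp.ext (funext fun j => ?_)
    simp only [modelOp_apply, add_apply, lp.coeFn_add, Pi.add_apply, map_add]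
  map_smul' c f := by
    ext x : 1
    refine lp.ext (funext fun j => ?_)
    simp only [modelOp_apply, smul_apply, lp.coeFn_smul, Pi.smul_apply, map_smul, RingHom.id_apply]
  map_one e he := by
    ext x : 1
    refine lp.ext (funext fun j => ?_)
    rw [modelOp_apply, one_apply_eq_self]
    refine Lp.ext ?_
    filter_upwards [coeFn_mulLTwo (compCubeIter ((j - 1) / 2) e) (x j),
      coeFn_compCubeIter ((j - 1) / 2) e, ae_iterate_cubeMap ((j - 1) / 2) he] with t h1 h2 h3
    rw [h1, h2, h3, one_mul]
  map_mul f g h hh := by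
    ext x : 1
    refine lp.ext (funext fun j => ?_)
    rw [modelOp_apply, mul_apply_eq_comp, modelOp_apply, modelOp_apply]
    refine Lp.ext ?_
    set n := (j - 1) / 2
    filter_upwards [coeFn_mulLTwo (compCubeIter n h) (x j),
      coeFn_mulLTwo (compCubeIter n f) (mulLTwo (compCubeIter n g) (x j)),
      coeFn_mulLTwo (compCubeIter n g) (x j), coeFn_compCubeIter n f, coeFn_compCubeIter n g,
      coeFn_compCubeIter n h, ae_iterate_cubeMap n hh] with t h1 h2 h3 h4 h5 h6 h7
    rw [h1, h2, h3, h4, h5, h6, h7, mul_assoc]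
  map_star f := by
    rw [ContinuousLinearMap.eq_adjoint_iff]
    intro x y
    rw [lp.inner_eq_tsum, lp.inner_eq_tsum]
    exact tsum_congr fun j => inner_mulLTwo_star f _ _ _

theorem modelRep_apply (f : Lp ℂ ∞ μT) (x : ModelSpace) (j : ℕ) :
    modelRep f x j = mulLTwo (compCubeIter ((j - 1) / 2) f) (x j) := rfl

/-- The components of the dilation operator of the model. -/
def modelDilationFun (x : ℕ → Lp ℂ 2 μT) : ℕ → Lp ℂ 2 μT
  | 0 => ∑ i : Fin 3, cuntz i (x i)
  | j + 1 => x (j + 3)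

theorem summable_sq_iff {x : ℕ → Lp ℂ 2 μT} : Memℓp x 2 ↔ Summable fun j => ‖x j‖ ^ 2 := by
  rw [memℓp_gen_iff (by norm_num)]
  simp

theorem norm_sq_modelSpace (y : ModelSpace) : ‖y‖ ^ 2 = ∑' j, ‖y j‖ ^ 2 := by
  have := lp.norm_rpow_eq_tsum (p := 2) (by norm_num) y
  simpa using this

theorem memℓp_modelDilationFun (x : ModelSpace) : Memℓp (modelDilationFun x) 2 := by
  rw [summable_sq_iff, ← summable_nat_add_iff 1]
  exact (summable_nat_add_iff 3).2 (summable_sq_iff.1 (lp.memℓp x))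

theorem tsum_norm_modelDilationFun_sq (x : ModelSpace) :
    ∑' j, ‖modelDilationFun x j‖ ^ 2 = ∑' j, ‖x j‖ ^ 2 := by
  have hx : Summable fun j => ‖x j‖ ^ 2 := summable_sq_iff.1 (lp.memℓp x)
  have hx' := summable_sq_iff.1 (memℓp_modelDilationFun x)
  rw [← hx.sum_add_tsum_nat_add 3, hx'.tsum_eq_zero_add]
  simp only [modelDilationFun]
  rw [norm_sum_cuntz_sq fun i => x i]
  simp [Fin.sum_univ_three, Finset.sum_range_succ]

/-- The dilation operator of the model, as a linear map. -/
def modelDilationₗ : ModelSpace →ₗ[ℂ] ModelSpace where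
  toFun x := ⟨modelDilationFun x, memℓp_modelDilationFun x⟩
  map_add' x y := by
    refine lp.ext (funext fun j => ?_)
    cases j with
    | zero =>
      change ∑ i : Fin 3, cuntz i ((x + y : ModelSpace) i)
        = ∑ i : Fin 3, cuntz i (x i) + ∑ i : Fin 3, cuntz i (y i)
      rw [← Finset.sum_add_distrib]
      refine Finset.sum_congr rfl fun i _ => ?_
      rw [lp.coeFn_add, Pi.add_apply, map_add]
    | succ j =>
      change (x + y : ModelSpace) (j + 3) = x (j + 3) + y (j + 3)
      rw [lp.coeFn_add, Pi.add_apply]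
  map_smul' c x := by
    refine lp.ext (funext fun j => ?_)
    cases j with
    | zero =>
      change ∑ i : Fin 3, cuntz i ((c • x : ModelSpace) i) = c • ∑ i : Fin 3, cuntz i (x i)
      rw [Finset.smul_sum]
      refine Finset.sum_congr rfl fun i _ => ?_
      rw [lp.coeFn_smul, Pi.smul_apply, map_smul]
    | succ j =>
      change (c • x : ModelSpace) (j + 3) = c • x (j + 3)
      rw [lp.coeFn_smul, Pi.smul_apply]

theorem norm_modelDilationₗ (x : ModelSpace) : ‖modelDilationₗ x‖ = ‖x‖ := by
  rw [← pow_left_inj₀ (norm_nonneg _) (norm_nonneg _) two_ne_zero, norm_sq_modelSpace,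
    norm_sq_modelSpace]
  exact tsum_norm_modelDilationFun_sq x

/-- The dilation operator of the model, as a linear isometry. -/
def modelDilationₗᵢ : ModelSpace →ₗᵢ[ℂ] ModelSpace := ⟨modelDilationₗ, norm_modelDilationₗ⟩

theorem modelDilation_surjective : Function.Surjective modelDilationₗᵢ := by
  intro y
  -- The adjoints decompose `y 0` into the components 0, 1, 2; the remaining components of `y` are
  -- shifted up by two places.
  let x : ℕ → Lp ℂ 2 μT := fun j => if h : j < 3 then
    ContinuousLinearMap.adjoint (cuntz ⟨j, h⟩) (y 0) else y (j - 2)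
  have hx : Memℓp x 2 := by
    rw [summable_sq_iff, ← summable_nat_add_iff 3]
    have : (fun j => ‖x (j + 3)‖ ^ 2) = fun j => ‖y (j + 1)‖ ^ 2 := by
      ext j; simp [x]
    rw [this]
    exact (summable_nat_add_iff 1).2 (summable_sq_iff.1 (lp.memℓp y))
  refine ⟨⟨x, hx⟩, lp.ext (funext fun j => ?_)⟩
  cases j with
  | zero =>
    change ∑ i : Fin 3, cuntz i (x i) = y 0
    conv_rhs => rw [← sum_cuntz_adjoint (y 0)]
    exact Finset.sum_congr rfl fun i _ => by simp [x]
  | succ j =>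
    change x (j + 3) = y (j + 1)
    simp [x]

/-- The dilation operator of the model, as a unitary. -/
def modelDilation : ModelSpace ≃ₗᵢ[ℂ] ModelSpace :=
  LinearIsometryEquiv.ofSurjective modelDilationₗᵢ modelDilation_surjective

theorem modelDilation_apply_zero (x : ModelSpace) :
    modelDilation x 0 = ∑ i : Fin 3, cuntz i (x i) := rfl

theorem modelDilation_apply_succ (x : ModelSpace) (j : ℕ) :
    modelDilation x (j + 1) = x (j + 3) := rfl

/-- The scaling vector of the model. -/
def modelVector : ModelSpace := lp.single 2 0 (fourierLp 2 0)

theorem modelVector_apply_zero : modelVector 0 = fourierLp 2 0 := by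
  simp [modelVector]

theorem modelVector_apply_of_ne {j : ℕ} (hj : j ≠ 0) : modelVector j = 0 := by
  simp [modelVector, lp.single_apply, hj]

/-! ### The model satisfies the axioms of a wavelet representation -/

theorem cuntz_mulLTwo (i : Fin 3) (f : Lp ℂ ∞ μT) (x : Lp ℂ 2 μT) :
    cuntz i (mulLTwo f x) = mulLTwo (compCube f) (cuntz i x) := by
  refine Lp.ext ?_
  filter_upwards [coeFn_cuntz i (mulLTwo f x), ae_cubeMap (coeFn_mulLTwo f x),
    coeFn_mulLTwo (compCube f) (cuntz i x), coeFn_cuntz i x, coeFn_compCube f]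
    with t h1 h2 h3 h4 h5
  rw [h1, h2, h3, h4, h5]
  ring

theorem modelDilation_modelRep (f : Lp ℂ ∞ μT) (x : ModelSpace) :
    modelDilation (modelRep f x) = modelRep (compCube f) (modelDilation x) := by
  refine lp.ext (funext fun j => ?_)
  cases j with
  | zero =>
    rw [modelDilation_apply_zero, modelRep_apply, modelDilation_apply_zero, map_sum]
    refine Finset.sum_congr rfl fun i _ => ?_
    -- Truncated subtraction makes the exponent vanish at index 0 as well, so all three summands fed
    -- into component 0 carry plain multiplication by `f`.
    have hi : ((i : ℕ) - 1) / 2 = 0 := by omega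
    rw [modelRep_apply, hi, Nat.zero_sub, Nat.zero_div, compCubeIter_zero, compCubeIter_zero,
      cuntz_mulLTwo]
  | succ j =>
    rw [modelDilation_apply_succ, modelRep_apply, modelRep_apply, modelDilation_apply_succ,
      compCubeIter_compCube, show (j + 3 - 1) / 2 = (j + 1 - 1) / 2 + 1 by omega]

theorem modelDilation_modelVector :
    modelDilation modelVector = modelRep cantorFilter modelVector := by
  refine lp.ext (funext fun j => ?_)
  cases j with
  | zero =>
    rw [modelDilation_apply_zero, modelRep_apply, Nat.zero_sub, Nat.zero_div, compCubeIter_zero,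
      modelVector_apply_zero, Fin.sum_univ_three]
    have h1 : modelVector ((1 : Fin 3) : ℕ) = 0 := modelVector_apply_of_ne (by decide)
    have h2 : modelVector ((2 : Fin 3) : ℕ) = 0 := modelVector_apply_of_ne (by decide)
    have h0 : modelVector ((0 : Fin 3) : ℕ) = fourierLp 2 0 := modelVector_apply_zero
    rw [h0, h1, h2, map_zero, map_zero, add_zero, add_zero, cuntz_fourierLp]
    rfl
  | succ j =>
    rw [modelDilation_apply_succ, modelRep_apply, modelVector_apply_of_ne (by omega),
      modelVector_apply_of_ne (by omega), map_zero]

/-- Components 0, 1, 2 are visible in component 0 of `U x`, as the isometries have orthogonal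
ranges; higher components move down by two under `U`, which drives the induction. This is totality
of the model. -/
theorem eq_zero_of_modelDilation_apply_zero (j : ℕ) (x : ModelSpace)
    (hx : ∀ n, (modelDilation^[n] x) 0 = 0) : x j = 0 := by
  induction j using Nat.strong_induction_on generalizing x with
  | _ j ih =>
    by_cases hj : j < 3
    · have h1 := hx 1
      rw [Function.iterate_one, modelDilation_apply_zero] at h1
      have h2 := norm_sum_cuntz_sq fun i => x i
      rw [h1, norm_zero, zero_pow two_ne_zero] at h2
      have h3 := (Finset.sum_eq_zero_iff_of_nonneg (fun i _ => by positivity)).1 h2.symm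
        ⟨j, hj⟩ (Finset.mem_univ _)
      simpa using h3
    · obtain ⟨i, rfl⟩ : ∃ i, j = i + 3 := ⟨j - 3, by omega⟩
      rw [← modelDilation_apply_succ]
      refine ih (i + 1) (by omega) _ fun n => ?_
      rw [← Function.iterate_succ_apply]
      exact hx (n + 1)

theorem isCantorWaveletRep_model : IsCantorWaveletRep modelDilation modelRep modelVector where
  covariance f v := by
    rw [modelDilation_modelRep, LinearIsometryEquiv.apply_symm_apply]
    rfl
  scaling := modelDilation_modelVector
  orthogonality f := by
    rw [modelVector, lp.inner_single_left, ← modelVector, modelRep_apply, modelVector_apply_zero,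
      Nat.zero_sub, Nat.zero_div, compCubeIter_zero, L2.inner_def]
    refine integral_congr_ae ?_
    filter_upwards [coeFn_fourierLp (T := 1) 2 0, coeFn_mulLTwo f (fourierLp 2 0)] with t h1 h2
    rw [h2, h1, fourier_zero]
    simp
  density := by
    refine dense_iterate_symm (fun f => ⟨linftyMul (compCube f) cantorFilter, ?_⟩) fun η hη => ?_
    · rw [modelDilation_modelRep, modelDilation_modelVector, LInftyRep.apply_mul]
    · refine lp.ext (funext fun j => eq_zero_of_modelDilation_apply_zero j η fun n => ?_)
      refine lTwo_ext fun k => ?_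
      have h := hη n (fourierLp ∞ k)
      have e : modelRep (fourierLp ∞ k) modelVector = lp.single 2 0 (fourierLp 2 k) := by
        refine lp.ext (funext fun j => ?_)
        rw [modelRep_apply]
        by_cases hj : j = 0
        · subst hj
          rw [modelVector_apply_zero, Nat.zero_sub, Nat.zero_div, compCubeIter_zero,
            mulLTwo_fourierLp]
          simp
        · rw [modelVector_apply_of_ne hj, map_zero]
          simp [lp.single_apply, hj]
      rw [inner_iterate_symm, e, lp.inner_single_left] at h
      rw [h, inner_zero_right]

/-! ### The Hausdorff measure of the Cantor set -/

theorem three_rpow_logb : (3 : ℝ) ^ Real.logb 3 2 = 2 :=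
  Real.rpow_logb (by norm_num) (by norm_num) (by norm_num)

theorem logb_three_two_pos : 0 < Real.logb 3 2 := Real.logb_pos (by norm_num) (by norm_num)

theorem inv_three_pow_rpow_logb (n : ℕ) :
    ((3 : ℝ) ^ n)⁻¹ ^ Real.logb 3 2 = ((2 : ℝ) ^ n)⁻¹ := by
  rw [Real.inv_rpow (by positivity), ← Real.rpow_natCast, ← Real.rpow_mul (by norm_num),
    mul_comm, Real.rpow_mul (by norm_num), three_rpow_logb, Real.rpow_natCast]

/-- Cover by the `2ⁿ` sets of prescribed first `n` digits, of diameter at most `3⁻ⁿ`; since `(3⁻ⁿ)ˢ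
= 2⁻ⁿ`, the sums never exceed 1. -/
theorem hausdorffMeasure_cantorSet_lt_top :
    Measure.hausdorffMeasure (Real.logb 3 2) cantorSet < ∞ := by
  let t : ∀ n : ℕ, (Fin n → Bool) → Set ℝ := fun n w =>
    {x | ∃ a : ℕ → Fin 3, (∀ i : Fin n, a i = if w i then 2 else 0) ∧ Real.ofDigits a = x}
  have hdiam : ∀ n w, Metric.ediam (t n w) ≤ ENNReal.ofReal ((3 : ℝ) ^ n)⁻¹ := by
    rintro n w
    refine Metric.ediam_le ?_
    rintro _ ⟨a, ha, rfl⟩ _ ⟨b, hb, rfl⟩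
    rw [edist_dist, Real.dist_eq]
    refine ENNReal.ofReal_le_ofReal ?_
    have := Real.abs_ofDigits_sub_ofDigits_le (n := n) (x := a) (y := b)
      fun i hi => (ha ⟨i, hi⟩).trans (hb ⟨i, hi⟩).symm
    simpa using this
  have hcover : ∀ n, cantorSet ⊆ ⋃ w, t n w := by
    intro n x hx
    rw [cantorSet_eq_zero_two_ofDigits] at hx
    obtain ⟨a, ha, rfl⟩ := hx
    refine Set.mem_iUnion.2 ⟨fun i => decide (a i = 2), a, fun i => ?_, rfl⟩
    have := ha i
    by_cases h : a i = 2 <;> simp [h]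
    grind
  have hlim : Tendsto (fun n : ℕ => ENNReal.ofReal ((3 : ℝ) ^ n)⁻¹) atTop (𝓝 0) := by
    rw [← ENNReal.ofReal_zero]
    refine (ENNReal.continuous_ofReal.tendsto 0).comp ?_
    simpa using tendsto_pow_atTop_nhds_zero_of_lt_one (r := (3 : ℝ)⁻¹) (by norm_num) (by norm_num)
  refine lt_of_le_of_lt (Measure.hausdorffMeasure_le_liminf_sum (Real.logb 3 2) cantorSet
    (fun n : ℕ => ENNReal.ofReal ((3 : ℝ) ^ n)⁻¹) hlim t (.of_forall hdiam)
    (.of_forall hcover)) (lt_of_le_of_lt (b := 1) ?_ ENNReal.one_lt_top)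
  have hsum : ∀ n, ∑ w, Metric.ediam (t n w) ^ Real.logb 3 2 ≤ 1 := by
    intro n
    calc ∑ w, Metric.ediam (t n w) ^ Real.logb 3 2
        ≤ ∑ _w : Fin n → Bool, ENNReal.ofReal ((2 : ℝ) ^ n)⁻¹ := by
          refine Finset.sum_le_sum fun w _ => ?_
          refine (ENNReal.rpow_le_rpow (hdiam n w) logb_three_two_pos.le).trans ?_
          rw [ENNReal.ofReal_rpow_of_nonneg (by positivity) logb_three_two_pos.le,
            inv_three_pow_rpow_logb]
      _ = ENNReal.ofReal ((2 : ℝ) ^ n * ((2 : ℝ) ^ n)⁻¹) := by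
          rw [ENNReal.ofReal_mul (by positivity), ENNReal.ofReal_pow (by norm_num)]
          simp
      _ = 1 := by rw [mul_inv_cancel₀ (by positivity)]; simp
  exact (liminf_le_liminf (.of_forall hsum)).trans (by simp)

/-- The distance between points of the Cantor set whose ternary digits first differ in place `n`
is at least `3 ^ -(n + 1)`. -/
theorem inv_pow_le_abs_ofDigits_sub {a b : ℕ → Fin 3} {n : ℕ} (h : ∀ i < n, a i = b i)
    (ha : a n ≠ 1) (hb : b n ≠ 1) (hn : a n ≠ b n) :
    ((3 : ℝ) ^ (n + 1))⁻¹ ≤ |Real.ofDigits a - Real.ofDigits b| := by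
  wlog h3 : a n = 0 ∧ b n = 2 generalizing a b
  · rw [abs_sub_comm]
    exact this (fun i hi => (h i hi).symm) hb ha hn.symm (by grind)
  obtain ⟨h0, h2⟩ := h3
  have hs : ∑ i ∈ Finset.range n, Real.ofDigitsTerm a i
      = ∑ i ∈ Finset.range n, Real.ofDigitsTerm b i := by
    refine Finset.sum_congr rfl fun i hi => ?_
    simp only [Real.ofDigitsTerm, h i (Finset.mem_range.1 hi)]
  have ea := Real.ofDigits_eq_sum_add_ofDigits a (n + 1)
  have eb := Real.ofDigits_eq_sum_add_ofDigits b (n + 1)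
  rw [Finset.sum_range_succ, hs] at ea
  rw [Finset.sum_range_succ] at eb
  simp only [Real.ofDigitsTerm, h0, h2] at ea eb
  have la := Real.ofDigits_le_one fun i => a (i + (n + 1))
  have lb := Real.ofDigits_nonneg fun i => b (i + (n + 1))
  have hp : 0 < ((3 : ℝ) ^ (n + 1))⁻¹ := by positivity
  have key : ((3 : ℝ) ^ (n + 1))⁻¹ ≤ Real.ofDigits b - Real.ofDigits a := by
    rw [ea, eb]
    norm_num
    nlinarith [mul_le_mul_of_nonneg_left la hp.le, mul_nonneg hp.le lb]
  rw [abs_sub_comm]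
  exact key.trans (le_abs_self _)

/-- The Cantor function: replace the ternary digits `0, 2` by the binary digits `0, 1`. -/
def cantorFunction (x : ℝ) : ℝ :=
  open Classical in
  if h : ∃ a : ℕ → Fin 3, (∀ i, a i ≠ 1) ∧ Real.ofDigits a = x then
    Real.ofDigits fun i => if h.choose i = 2 then (1 : Fin 2) else 0
  else 0

theorem cantorFunction_ofDigits {a : ℕ → Fin 3} (ha : ∀ i, a i ≠ 1) :
    cantorFunction (Real.ofDigits a)
      = Real.ofDigits fun i => if a i = 2 then (1 : Fin 2) else 0 := by
  have h : ∃ b : ℕ → Fin 3, (∀ i, b i ≠ 1) ∧ Real.ofDigits b = Real.ofDigits a := ⟨a, ha, rfl⟩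
  rw [cantorFunction, dif_pos h,
    ofDigits_zero_two_sequence_unique h.choose_spec.1 ha h.choose_spec.2]

/-- If the digits first differ in place `n`, the arguments are at least `3^{-(n+1)}` apart and the
values at most `2⁻ⁿ = 2 · (3^{-(n+1)})ˢ`, which is where the constant 2 arises. -/
theorem holderOnWith_cantorFunction : HolderOnWith 2 ⟨Real.logb 3 2, logb_three_two_pos.le⟩
    cantorFunction cantorSet := by
  intro x hx y hy
  rw [cantorSet_eq_zero_two_ofDigits] at hx hy
  obtain ⟨a, ha, rfl⟩ := hx
  obtain ⟨b, hb, rfl⟩ := hy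
  by_cases hab : a = b
  · subst hab; simp
  obtain ⟨n, hn, hmin⟩ : ∃ n, a n ≠ b n ∧ ∀ i < n, a i = b i := by
    have h := Function.ne_iff.1 hab
    exact ⟨Nat.find h, Nat.find_spec h, fun i hi => not_not.1 (Nat.find_min h hi)⟩
  have h1 := inv_pow_le_abs_ofDigits_sub hmin (ha n) (hb n) hn
  rw [cantorFunction_ofDigits ha, cantorFunction_ofDigits hb]
  have h2 := Real.abs_ofDigits_sub_ofDigits_le (n := n)
    (x := fun i => if a i = 2 then (1 : Fin 2) else 0)
    (y := fun i => if b i = 2 then (1 : Fin 2) else 0) (fun i hi => by rw [hmin i hi])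
  rw [edist_dist, edist_dist, Real.dist_eq, Real.dist_eq,
    ENNReal.ofReal_rpow_of_nonneg (abs_nonneg _) (by exact logb_three_two_pos.le)]
  have h3 := Real.rpow_le_rpow (by positivity) h1 logb_three_two_pos.le
  rw [inv_three_pow_rpow_logb] at h3
  rw [show ((2 : NNReal) : ℝ≥0∞) = ENNReal.ofReal 2 by simp, ← ENNReal.ofReal_mul (by norm_num)]
  refine ENNReal.ofReal_le_ofReal (h2.trans ?_)
  calc (((2 : ℕ) : ℝ) ^ n)⁻¹ = 2 * ((2 : ℝ) ^ (n + 1))⁻¹ := by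
        rw [pow_succ]; push_cast; field_simp
    _ ≤ _ := by gcongr; exact h3

theorem Icc_subset_image_cantorFunction : Set.Icc 0 1 ⊆ cantorFunction '' cantorSet := by
  intro y hy
  obtain ⟨d, -, rfl⟩ := Real.ofDigits_SurjOn (b := 2) (by norm_num) hy
  have ha : ∀ i, (if d i = 1 then (2 : Fin 3) else 0) ≠ 1 := fun i => by split_ifs <;> decide
  refine ⟨_, ofDigits_zero_two_sequence_mem_cantorSet ha, ?_⟩
  rw [cantorFunction_ofDigits ha]
  congr 1
  ext i
  have : d i = 0 ∨ d i = 1 := by omega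
  rcases this with h | h <;> simp [h]

/-- The Cantor function covers `[0, 1]`, of 1-dimensional measure 1, and a map that is Hölder of
exponent `s` sends an `𝓗ˢ`-null set to an `𝓗¹`-null set. -/
theorem hausdorffMeasure_cantorSet_pos :
    0 < Measure.hausdorffMeasure (Real.logb 3 2) cantorSet := by
  rw [pos_iff_ne_zero]
  intro h0
  have h := holderOnWith_cantorFunction.hausdorffMeasure_image_le
    (show (0 : NNReal) < ⟨Real.logb 3 2, logb_three_two_pos.le⟩ from logb_three_two_pos)
    (d := 1) zero_le_one
  have h1 : (1 : ℝ≥0∞) ≤ Measure.hausdorffMeasure 1 (cantorFunction '' cantorSet) := by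
    refine le_trans ?_ (measure_mono Icc_subset_image_cantorFunction)
    rw [hausdorffMeasure_real]
    simp
  have h2 : Measure.hausdorffMeasure (Real.logb 3 2 * 1) cantorSet = 0 := by rw [mul_one, h0]
  have h3 := h1.trans h
  erw [h2] at h3
  simp at h3

/-! ### Composition operators on `L²` -/

section WeightedComp

variable {α : Type*} [MeasurableSpace α] {ν : Measure α}

theorem quasiMeasurePreserving_of_map_eq_smul {e : α ≃ᵐ α} {κ : NNReal}
    (h : ν.map e = κ • ν) : Measure.QuasiMeasurePreserving e ν ν :=
  ⟨e.measurable, by rw [h]; exact Measure.smul_absolutelyContinuous⟩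

theorem map_symm_eq_inv_smul {e : α ≃ᵐ α} {κ : NNReal} (hκ : κ ≠ 0)
    (h : ν.map e = κ • ν) : ν.map e.symm = κ⁻¹ • ν := by
  have h1 : ν = κ⁻¹ • ν.map e := by rw [h, smul_smul, inv_mul_cancel₀ hκ, one_smul]
  conv_lhs => rw [h1]
  rw [Measure.map_smul, MeasurableEquiv.map_symm_map]

theorem eLpNorm_comp_of_map_eq_smul {e : α ≃ᵐ α} {κ : NNReal} (h : ν.map e = κ • ν)
    (ξ : Lp ℂ 2 ν) :
    eLpNorm (ξ ∘ e) 2 ν = ENNReal.ofReal (Real.sqrt κ) * eLpNorm ξ 2 ν := by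
  have hm : AEStronglyMeasurable ξ (ν.map e) :=
    (Lp.aestronglyMeasurable ξ).mono_ac
      (quasiMeasurePreserving_of_map_eq_smul h).absolutelyContinuous
  rw [← eLpNorm_map_measure hm e.measurable.aemeasurable, h]
  have : (κ • ν) = (κ : ℝ≥0∞) • ν := rfl
  rw [this, eLpNorm_smul_measure_of_ne_top (by norm_num), smul_eq_mul]
  congr 1
  rw [Real.sqrt_eq_rpow, ← ENNReal.ofReal_rpow_of_nonneg κ.coe_nonneg (by norm_num)]
  simp

theorem memLp_comp_of_map_eq_smul {e : α ≃ᵐ α} {κ : NNReal} (h : ν.map e = κ • ν)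
    (ξ : Lp ℂ 2 ν) : MemLp (ξ ∘ e) 2 ν := by
  refine ⟨(Lp.aestronglyMeasurable ξ).comp_quasiMeasurePreserving
    (quasiMeasurePreserving_of_map_eq_smul h), ?_⟩
  rw [eLpNorm_comp_of_map_eq_smul h]
  exact ENNReal.mul_lt_top ENNReal.ofReal_lt_top (Lp.eLpNorm_lt_top ξ)

/-- The function `κ ^ (-1/2) • ξ ∘ e`. -/
def weightedCompFun {e : α ≃ᵐ α} {κ : NNReal} (h : ν.map e = κ • ν) (ξ : Lp ℂ 2 ν) : Lp ℂ 2 ν :=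
  ((Real.sqrt κ : ℝ) : ℂ)⁻¹ • (memLp_comp_of_map_eq_smul h ξ).toLp (ξ ∘ e)

theorem coeFn_weightedCompFun {e : α ≃ᵐ α} {κ : NNReal} (h : ν.map e = κ • ν) (ξ : Lp ℂ 2 ν) :
    ∀ᵐ x ∂ν, weightedCompFun h ξ x = ((Real.sqrt κ : ℝ) : ℂ)⁻¹ * ξ (e x) := by
  filter_upwards [Lp.coeFn_smul ((Real.sqrt κ : ℝ) : ℂ)⁻¹
    ((memLp_comp_of_map_eq_smul h ξ).toLp (ξ ∘ e)),
    (memLp_comp_of_map_eq_smul h ξ).coeFn_toLp] with x h1 h2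
  rw [weightedCompFun, h1, Pi.smul_apply, h2, smul_eq_mul, Function.comp_apply]

theorem weightedCompFun_weightedCompFun {e f : α ≃ᵐ α} {κ κ' : NNReal} (h : ν.map e = κ • ν)
    (h' : ν.map f = κ' • ν) (hef : ∀ x, e (f x) = x) (hκ : κ * κ' = 1) (ξ : Lp ℂ 2 ν) :
    weightedCompFun h' (weightedCompFun h ξ) = ξ := by
  refine Lp.ext ?_
  filter_upwards [coeFn_weightedCompFun h' (weightedCompFun h ξ),
    (quasiMeasurePreserving_of_map_eq_smul h').ae (coeFn_weightedCompFun h ξ)] with x h1 h2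
  rw [h1, h2, hef, ← mul_assoc, ← mul_inv, ← Complex.ofReal_mul, ← Real.sqrt_mul κ'.coe_nonneg,
    mul_comm (κ' : ℝ)]
  have : (κ : ℝ) * κ' = 1 := by exact_mod_cast hκ
  rw [this]
  simp

theorem norm_weightedCompFun {e : α ≃ᵐ α} {κ : NNReal} (hκ : κ ≠ 0) (h : ν.map e = κ • ν)
    (ξ : Lp ℂ 2 ν) : ‖weightedCompFun h ξ‖ = ‖ξ‖ := by
  have hs : 0 < Real.sqrt κ := Real.sqrt_pos.2 (by exact_mod_cast pos_iff_ne_zero.2 hκ)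
  rw [weightedCompFun, norm_smul, Lp.norm_toLp, eLpNorm_comp_of_map_eq_smul h, ENNReal.toReal_mul,
    ENNReal.toReal_ofReal hs.le, norm_inv, Complex.norm_real, Real.norm_of_nonneg hs.le,
    ← mul_assoc, inv_mul_cancel₀ hs.ne', one_mul, Lp.norm_def]

/-- The unitary operator `ξ ↦ κ ^ (-1/2) • ξ ∘ e` on `L²(ν)`, where `e` multiplies `ν` by `κ`. -/
def weightedComp (e : α ≃ᵐ α) (κ : NNReal) (hκ : κ ≠ 0) (h : ν.map e = κ • ν) :
    Lp ℂ 2 ν ≃ₗᵢ[ℂ] Lp ℂ 2 ν where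
  toFun := weightedCompFun h
  map_add' ξ η := by
    refine Lp.ext ?_
    filter_upwards [coeFn_weightedCompFun h (ξ + η), coeFn_weightedCompFun h ξ,
      coeFn_weightedCompFun h η, Lp.coeFn_add (weightedCompFun h ξ) (weightedCompFun h η),
      (quasiMeasurePreserving_of_map_eq_smul h).ae (Lp.coeFn_add ξ η)] with x h1 h2 h3 h4 h5
    rw [h1, h4, h5, Pi.add_apply, Pi.add_apply, h2, h3, mul_add]
  map_smul' c ξ := by
    refine Lp.ext ?_
    filter_upwards [coeFn_weightedCompFun h (c • ξ), coeFn_weightedCompFun h ξ,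
      Lp.coeFn_smul c (weightedCompFun h ξ),
      (quasiMeasurePreserving_of_map_eq_smul h).ae (Lp.coeFn_smul c ξ)] with x h1 h2 h4 h5
    rw [RingHom.id_apply, h1, h4, h5, Pi.smul_apply, Pi.smul_apply, h2, smul_eq_mul, smul_eq_mul,
      mul_left_comm]
  invFun := weightedCompFun (map_symm_eq_inv_smul hκ h)
  left_inv := weightedCompFun_weightedCompFun _ _ e.apply_symm_apply (mul_inv_cancel₀ hκ)
  right_inv := weightedCompFun_weightedCompFun _ _ e.symm_apply_apply (inv_mul_cancel₀ hκ)
  norm_map' := norm_weightedCompFun hκ h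

theorem coeFn_weightedComp (e : α ≃ᵐ α) (κ : NNReal) (hκ : κ ≠ 0) (h : ν.map e = κ • ν)
    (ξ : Lp ℂ 2 ν) :
    ∀ᵐ x ∂ν, weightedComp e κ hκ h ξ x = ((Real.sqrt κ : ℝ) : ℂ)⁻¹ * ξ (e x) :=
  coeFn_weightedCompFun h ξ

theorem coeFn_weightedComp_symm (e : α ≃ᵐ α) (κ : NNReal) (hκ : κ ≠ 0) (h : ν.map e = κ • ν)
    (ξ : Lp ℂ 2 ν) :
    ∀ᵐ x ∂ν, (weightedComp e κ hκ h).symm ξ x = ((Real.sqrt κ : ℝ) : ℂ) * ξ (e.symm x) := by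
  filter_upwards [coeFn_weightedCompFun (map_symm_eq_inv_smul hκ h) ξ] with x hx
  refine hx.trans ?_
  simp

end WeightedComp

/-! ### Triadic pieces of the enlarged Cantor set -/

theorem mem_cantorSet_iff (x : ℝ) : x ∈ cantorSet ↔ 3 * x ∈ cantorSet ∨ 3 * x - 2 ∈ cantorSet := by
  conv_lhs => rw [cantorSet_eq_union_halves]
  constructor
  · rintro (⟨y, hy, rfl⟩ | ⟨y, hy, rfl⟩)
    · left; convert hy using 1; ring
    · right; convert hy using 1; ring
  · rintro (h | h)
    · exact Or.inl ⟨_, h, by ring⟩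
    · exact Or.inr ⟨_, h, by ring⟩

/-- The copy of the Cantor set in the interval `[k / 3 ^ n, (k + 1) / 3 ^ n]`. -/
def cantorPiece (n : ℕ) (k : ℤ) : Set ℝ := {x | 3 ^ n * x - k ∈ cantorSet}

theorem mem_cantorPiece {n : ℕ} {k : ℤ} {x : ℝ} :
    x ∈ cantorPiece n k ↔ 3 ^ n * x - k ∈ cantorSet := Iff.rfl

theorem isClosed_cantorPiece (n : ℕ) (k : ℤ) : IsClosed (cantorPiece n k) :=
  isClosed_cantorSet.preimage (by fun_prop : Continuous fun x : ℝ => 3 ^ n * x - k)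

theorem measurableSet_cantorPiece (n : ℕ) (k : ℤ) : MeasurableSet (cantorPiece n k) :=
  (isClosed_cantorPiece n k).measurableSet

theorem cantorPiece_zero_zero : cantorPiece 0 0 = cantorSet := by
  ext x; simp [mem_cantorPiece]

theorem cantorPiece_eq_union (n : ℕ) (k : ℤ) :
    cantorPiece n k = cantorPiece (n + 1) (3 * k) ∪ cantorPiece (n + 1) (3 * k + 2) := by
  ext x
  rw [Set.mem_union, mem_cantorPiece, mem_cantorSet_iff, mem_cantorPiece, mem_cantorPiece]
  push_cast
  ring_nf

theorem mem_Icc_of_mem_cantorPiece {n : ℕ} {k : ℤ} {x : ℝ} (hx : x ∈ cantorPiece n k) :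
    3 ^ n * x ∈ Set.Icc (k : ℝ) (k + 1) := by
  have := cantorSet_subset_unitInterval hx
  constructor <;> linarith [this.1, this.2]

/-- A piece is a union of pieces of any finer level. -/
theorem exists_cantorPiece_eq_iUnion (n : ℕ) (k : ℤ) (p : ℕ) :
    ∃ S : Set ℤ, cantorPiece n k = ⋃ j ∈ S, cantorPiece (n + p) j := by
  induction p with
  | zero => exact ⟨{k}, by simp⟩
  | succ p ih =>
    obtain ⟨S, hS⟩ := ih
    refine ⟨{i | ∃ j ∈ S, i = 3 * j ∨ i = 3 * j + 2}, ?_⟩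
    rw [hS]
    ext x
    simp only [Set.mem_iUnion, cantorPiece_eq_union (n + p), exists_prop, Set.mem_union,
      Set.mem_ofPred_eq, ← add_assoc]
    constructor
    · rintro ⟨j, hj, h | h⟩
      exacts [⟨_, ⟨j, hj, Or.inl rfl⟩, h⟩, ⟨_, ⟨j, hj, Or.inr rfl⟩, h⟩]
    · rintro ⟨_, ⟨j, hj, rfl | rfl⟩, h⟩
      exacts [⟨j, hj, Or.inl h⟩, ⟨j, hj, Or.inr h⟩]

theorem cantorPiece_zero_subset (n : ℕ) : cantorPiece n 0 ⊆ cantorSet := by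
  induction n with
  | zero => rw [cantorPiece_zero_zero]
  | succ n ih =>
    refine subset_trans ?_ ih
    rw [cantorPiece_eq_union n 0]
    exact Set.subset_union_left

/-- A shift of `C` by `k / 3ⁿ` with `n ≥ 0` splits into pieces of level `n`; for negative exponents
the shift is an integer. Conversely the piece `(n, k)` lies in `C + k / 3ⁿ` because `3⁻ⁿ C ⊆ C`. -/
theorem mem_enlargedCantorSet_iff {x : ℝ} :
    x ∈ enlargedCantorSet ↔ ∃ (n : ℕ) (k : ℤ), x ∈ cantorPiece n k := by
  simp only [enlargedCantorSet, Set.mem_iUnion]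
  constructor
  · rintro ⟨k, n, y, hy, rfl⟩
    obtain ⟨n, rfl | rfl⟩ := n.eq_nat_or_neg
    · rw [← cantorPiece_zero_zero] at hy
      obtain ⟨S, hS⟩ := exists_cantorPiece_eq_iUnion 0 0 n
      rw [hS] at hy
      simp only [Set.mem_iUnion, exists_prop, zero_add] at hy
      obtain ⟨j, -, hj⟩ := hy
      refine ⟨n, j + k, ?_⟩
      rw [mem_cantorPiece] at hj ⊢
      convert hj using 1
      push_cast
      rw [zpow_natCast]
      field_simp
      ring
    · refine ⟨0, k * 3 ^ n, ?_⟩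
      rw [mem_cantorPiece]
      convert hy using 1
      push_cast
      rw [zpow_neg, zpow_natCast]
      field_simp
      ring
  · rintro ⟨n, k, h⟩
    refine ⟨k, n, x - k / 3 ^ n, cantorPiece_zero_subset n ?_, by simp⟩
    rw [mem_cantorPiece] at h ⊢
    convert h using 1
    field_simp
    simp

theorem measurableSet_enlargedCantorSet : MeasurableSet enlargedCantorSet := by
  have : enlargedCantorSet = ⋃ (n : ℕ) (k : ℤ), cantorPiece n k := by
    ext x; simp [mem_enlargedCantorSet_iff]
  rw [this]
  exact .iUnion fun n => .iUnion fun k => measurableSet_cantorPiece n k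

theorem cantorSet_subset_enlargedCantorSet : cantorSet ⊆ enlargedCantorSet := fun x hx =>
  mem_enlargedCantorSet_iff.2 ⟨0, 0, by rwa [cantorPiece_zero_zero]⟩

theorem three_mul_mem_enlargedCantorSet_iff {x : ℝ} :
    3 * x ∈ enlargedCantorSet ↔ x ∈ enlargedCantorSet := by
  rw [mem_enlargedCantorSet_iff, mem_enlargedCantorSet_iff]
  constructor
  · rintro ⟨n, k, h⟩
    refine ⟨n + 1, k, ?_⟩
    rw [mem_cantorPiece] at h ⊢
    convert h using 1
    ring
  · rintro ⟨n, k, h⟩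
    rw [cantorPiece_eq_union] at h
    rcases h with h | h
    · refine ⟨n, 3 * k, ?_⟩
      rw [mem_cantorPiece] at h ⊢
      convert h using 1
      ring
    · refine ⟨n, 3 * k + 2, ?_⟩
      rw [mem_cantorPiece] at h ⊢
      convert h using 1
      ring

theorem add_intCast_mem_of_mem_enlargedCantorSet {x : ℝ} (j : ℤ) (hx : x ∈ enlargedCantorSet) :
    x + j ∈ enlargedCantorSet := by
  rw [mem_enlargedCantorSet_iff] at hx ⊢
  obtain ⟨n, k, h⟩ := hx
  refine ⟨n, k + 3 ^ n * j, ?_⟩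
  rw [mem_cantorPiece] at h ⊢
  convert h using 1
  push_cast
  ring

theorem add_intCast_mem_enlargedCantorSet_iff {x : ℝ} (j : ℤ) :
    x + j ∈ enlargedCantorSet ↔ x ∈ enlargedCantorSet := by
  refine ⟨fun h => ?_, add_intCast_mem_of_mem_enlargedCantorSet j⟩
  simpa using add_intCast_mem_of_mem_enlargedCantorSet (-j) h

/-! ### Dilation and translation of the Hausdorff measure -/

theorem map_restrict_of_preimage {m : Measure ℝ} (e : ℝ ≃ᵐ ℝ) (κ : NNReal) {R : Set ℝ}
    (hm : ∀ A, m (e ⁻¹' A) = κ * m A) (hR : e ⁻¹' R = R) :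
    (m.restrict R).map e = κ • m.restrict R := by
  ext A hA
  rw [e.map_apply, Measure.restrict_apply (e.measurable hA)]
  nth_rewrite 1 [← hR]
  rw [← Set.preimage_inter, hm, Measure.smul_apply, Measure.restrict_apply hA]
  rfl

/-- The map `x ↦ x / 3`. -/
def divThree : ℝ ≃ᵐ ℝ := (MeasurableEquiv.mulLeft₀ (3 : ℝ) (by norm_num)).symm

theorem divThree_apply (x : ℝ) : divThree x = x / 3 := by
  rw [div_eq_inv_mul]; rfl

theorem divThree_symm_apply (x : ℝ) : divThree.symm x = 3 * x := rfl

-- The preimage of `A` under `x ↦ x / 3` is `3 A`, and `3ˢ = 2`.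
open scoped Pointwise in
theorem map_divThree : cantorHausdorff.map divThree = (2 : NNReal) • cantorHausdorff := by
  refine map_restrict_of_preimage _ _ (fun A => ?_) ?_
  · have : divThree ⁻¹' A = (3 : ℝ) • A := by
      ext x
      rw [Set.mem_smul_set_iff_inv_smul_mem₀ (by norm_num)]
      rfl
    rw [this, Measure.hausdorffMeasure_smul₀ logb_three_two_pos.le (by norm_num)]
    have h3 : ‖(3 : ℝ)‖₊ ^ Real.logb 3 2 = 2 := by
      apply NNReal.coe_injective
      rw [NNReal.coe_rpow]
      simp
    rw [h3]
    rfl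
  · ext x
    rw [Set.mem_preimage, divThree_apply, ← three_mul_mem_enlargedCantorSet_iff]
    congr! 1
    ring

/-- The map `x ↦ x - k`. -/
def subInt (k : ℤ) : ℝ ≃ᵐ ℝ := MeasurableEquiv.addRight (-(k : ℝ))

theorem subInt_apply (k : ℤ) (x : ℝ) : subInt k x = x - k := (sub_eq_add_neg x (k : ℝ)).symm

theorem map_subInt (k : ℤ) : cantorHausdorff.map (subInt k) = (1 : NNReal) • cantorHausdorff := by
  refine map_restrict_of_preimage _ _ (fun A => ?_) ?_
  · rw [ENNReal.coe_one, one_mul]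
    exact (IsometryEquiv.addRight (-(k : ℝ))).hausdorffMeasure_preimage _ A
  · ext x
    rw [Set.mem_preimage, subInt_apply, sub_eq_add_neg, ← Int.cast_neg,
      add_intCast_mem_enlargedCantorSet_iff]

theorem cantorHausdorff_singleton (x : ℝ) : cantorHausdorff {x} = 0 := by
  refine le_antisymm ((Measure.restrict_apply_le _ _).trans ?_) zero_le
  have := Measure.nullSingletonClass_hausdorff ℝ logb_three_two_pos
  simp

theorem cantorHausdorff_cantorSet :
    cantorHausdorff cantorSet = Measure.hausdorffMeasure (Real.logb 3 2) cantorSet := by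
  rw [cantorHausdorff, Measure.restrict_apply isClosed_cantorSet.measurableSet,
    Set.inter_eq_left.2 cantorSet_subset_enlargedCantorSet]

theorem cantorHausdorff_cantorSet_ne_top : cantorHausdorff cantorSet ≠ ∞ := by
  rw [cantorHausdorff_cantorSet]; exact hausdorffMeasure_cantorSet_lt_top.ne

theorem cantorHausdorff_cantorSet_pos : 0 < cantorHausdorff cantorSet := by
  rw [cantorHausdorff_cantorSet]; exact hausdorffMeasure_cantorSet_pos

/-! ### The Cantor system on `L²` of the Hausdorff measure -/

/-- The unitary operator `ξ ↦ 2 ^ (-1/2) ξ(x / 3)`. -/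
def cantorDilation : Lp ℂ 2 cantorHausdorff ≃ₗᵢ[ℂ] Lp ℂ 2 cantorHausdorff :=
  weightedComp divThree 2 two_ne_zero map_divThree

theorem coeFn_cantorDilation (ξ : Lp ℂ 2 cantorHausdorff) :
    ∀ᵐ x ∂cantorHausdorff, cantorDilation ξ x = (Real.sqrt 2 : ℂ)⁻¹ * ξ (x / 3) := by
  filter_upwards [coeFn_weightedComp divThree 2 two_ne_zero map_divThree ξ] with x hx
  rw [cantorDilation, hx, divThree_apply]
  rfl

theorem coeFn_cantorDilation_symm (ξ : Lp ℂ 2 cantorHausdorff) :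
    ∀ᵐ x ∂cantorHausdorff, cantorDilation.symm ξ x = (Real.sqrt 2 : ℂ) * ξ (3 * x) := by
  filter_upwards [coeFn_weightedComp_symm divThree 2 two_ne_zero map_divThree ξ] with x hx
  rw [cantorDilation, hx, divThree_symm_apply]
  rfl

/-- The unitary operator `ξ ↦ ξ(x - k)`. -/
def cantorTranslation (k : ℤ) : Lp ℂ 2 cantorHausdorff →L[ℂ] Lp ℂ 2 cantorHausdorff :=
  (weightedComp (subInt k) 1 one_ne_zero (map_subInt k)).toLinearIsometry.toContinuousLinearMap

theorem coeFn_cantorTranslation (k : ℤ) (ξ : Lp ℂ 2 cantorHausdorff) :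
    ∀ᵐ x ∂cantorHausdorff, cantorTranslation k ξ x = ξ (x - k) := by
  filter_upwards [coeFn_weightedComp (subInt k) 1 one_ne_zero (map_subInt k) ξ] with x hx
  refine hx.trans ?_
  simp [subInt_apply]

theorem inner_cantorTranslation (k : ℤ) (ξ η : Lp ℂ 2 cantorHausdorff) :
    inner ℂ (cantorTranslation k ξ) (cantorTranslation k η) = inner ℂ ξ η :=
  (weightedComp (subInt k) 1 one_ne_zero (map_subInt k)).inner_map_map ξ η

theorem ae_div_three {p : ℝ → Prop} (h : ∀ᵐ x ∂cantorHausdorff, p x) :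
    ∀ᵐ x ∂cantorHausdorff, p (x / 3) := by
  filter_upwards [(quasiMeasurePreserving_of_map_eq_smul map_divThree).ae h] with x hx
  rwa [divThree_apply] at hx

theorem ae_three_mul {p : ℝ → Prop} (h : ∀ᵐ x ∂cantorHausdorff, p x) :
    ∀ᵐ x ∂cantorHausdorff, p (3 * x) :=
  (quasiMeasurePreserving_of_map_eq_smul (map_symm_eq_inv_smul two_ne_zero map_divThree)).ae h

theorem ae_sub_intCast {p : ℝ → Prop} (h : ∀ᵐ x ∂cantorHausdorff, p x) (k : ℤ) :
    ∀ᵐ x ∂cantorHausdorff, p (x - k) := by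
  filter_upwards [(quasiMeasurePreserving_of_map_eq_smul (map_subInt k)).ae h] with x hx
  rwa [subInt_apply] at hx

/-- The characteristic function of the Cantor set in `L²`. -/
def cantorIndicator : Lp ℂ 2 cantorHausdorff :=
  indicatorConstLp 2 isClosed_cantorSet.measurableSet cantorHausdorff_cantorSet_ne_top 1

theorem coeFn_cantorIndicator : ∀ᵐ x ∂cantorHausdorff,
    cantorIndicator x = cantorSet.indicator (fun _ => (1 : ℂ)) x :=
  indicatorConstLp_coeFn

theorem real_cantorSet_pos : 0 < cantorHausdorff.real cantorSet :=
  ENNReal.toReal_pos cantorHausdorff_cantorSet_pos.ne' cantorHausdorff_cantorSet_ne_top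

/-- The normalised characteristic function of the Cantor set. -/
def cantorVector : Lp ℂ 2 cantorHausdorff :=
  ((Real.sqrt (cantorHausdorff.real cantorSet) : ℝ) : ℂ)⁻¹ • cantorIndicator

theorem sqrt_real_cantorSet_ne_zero :
    ((Real.sqrt (cantorHausdorff.real cantorSet) : ℝ) : ℂ) ≠ 0 :=
  Complex.ofReal_ne_zero.2 (Real.sqrt_pos.2 real_cantorSet_pos).ne'

theorem coeFn_cantorVector : ∀ᵐ x ∂cantorHausdorff, cantorVector x =
    ((Real.sqrt (cantorHausdorff.real cantorSet) : ℝ) : ℂ)⁻¹ *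
      cantorSet.indicator (fun _ => (1 : ℂ)) x := by
  filter_upwards [Lp.coeFn_smul ((Real.sqrt (cantorHausdorff.real cantorSet) : ℝ) : ℂ)⁻¹
    cantorIndicator, coeFn_cantorIndicator] with x h1 h2
  rw [cantorVector, h1, Pi.smul_apply, h2, smul_eq_mul]

theorem coeFn_cantorTranslation_cantorIndicator (k : ℤ) : ∀ᵐ x ∂cantorHausdorff,
    cantorTranslation k cantorIndicator x = (cantorPiece 0 k).indicator (fun _ => (1 : ℂ)) x := by
  filter_upwards [coeFn_cantorTranslation k cantorIndicator,
    ae_sub_intCast coeFn_cantorIndicator k] with x h1 h2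
  rw [h1, h2]
  classical simp [Set.indicator_apply, mem_cantorPiece]

/-- The two copies lie in distinct unit intervals with integer endpoints, so they meet at most at 0
or 1, and points are null since `s > 0`. -/
theorem ae_notMem_intersection (k : ℤ) (hk : k ≠ 0) :
    ∀ᵐ x ∂cantorHausdorff, ¬ (x ∈ cantorSet ∧ x ∈ cantorPiece 0 k) := by
  have h : ∀ y, ∀ᵐ x ∂cantorHausdorff, x ≠ y := fun y => by
    rw [ae_iff]; simpa using cantorHausdorff_singleton y
  filter_upwards [h 0, h 1] with x h0 h1 hx
  have a := cantorSet_subset_unitInterval hx.1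
  have b := mem_Icc_of_mem_cantorPiece hx.2
  rw [pow_zero, one_mul] at b
  have c : (0 : ℝ) < x := lt_of_le_of_ne a.1 h0.symm
  have d : x < 1 := lt_of_le_of_ne a.2 h1
  have e1 : ((0 : ℤ) : ℝ) < ((k + 1 : ℤ) : ℝ) := by push_cast; exact c.trans_le b.2
  have e2 : (k : ℝ) < ((1 : ℤ) : ℝ) := by push_cast; exact b.1.trans_lt d
  rw [Int.cast_lt] at e1 e2
  omega

theorem inner_cantorIndicator_cantorTranslation (k : ℤ) :
    inner ℂ cantorIndicator (cantorTranslation k cantorIndicator)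
      = if k = 0 then (cantorHausdorff.real cantorSet : ℂ) else 0 := by
  rw [cantorIndicator, L2.inner_indicatorConstLp_one, ← cantorIndicator]
  split_ifs with hk
  · subst hk
    rw [setIntegral_congr_ae (g := fun _ => (1 : ℂ)) isClosed_cantorSet.measurableSet]
    · simp
    · filter_upwards [coeFn_cantorTranslation_cantorIndicator 0] with x hx hxC
      rw [hx, cantorPiece_zero_zero, Set.indicator_of_mem hxC]
  · rw [setIntegral_congr_ae (g := fun _ => (0 : ℂ)) isClosed_cantorSet.measurableSet]
    · simp
    · filter_upwards [coeFn_cantorTranslation_cantorIndicator k, ae_notMem_intersection k hk]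
        with x hx hn hxC
      rw [hx, Set.indicator_of_notMem fun h => hn ⟨hxC, h⟩]

theorem coeFn_iterate_cantorDilation_symm (n : ℕ) (k : ℤ) : ∀ᵐ x ∂cantorHausdorff,
    cantorDilation.symm^[n] (cantorTranslation k cantorIndicator) x
      = (Real.sqrt 2 : ℂ) ^ n * (cantorPiece n k).indicator (fun _ => (1 : ℂ)) x := by
  induction n with
  | zero =>
    filter_upwards [coeFn_cantorTranslation_cantorIndicator k] with x hx
    simpa using hx
  | succ n ih =>
    rw [Function.iterate_succ_apply']
    filter_upwards [coeFn_cantorDilation_symm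
      (cantorDilation.symm^[n] (cantorTranslation k cantorIndicator)), ae_three_mul ih]
      with x h1 h2
    rw [h1, h2, pow_succ', mul_assoc]
    congr 2
    classical simp only [Set.indicator_apply, mem_cantorPiece, pow_succ, mul_assoc]

/-- Up to a nonzero factor its indicator is a dilated translate of the indicator of `C`, hence
square integrable. -/
theorem cantorHausdorff_cantorPiece_ne_top (n : ℕ) (k : ℤ) :
    cantorHausdorff (cantorPiece n k) ≠ ∞ := by
  have hs : (Real.sqrt 2 : ℂ) ^ n ≠ 0 := pow_ne_zero _ (by simp)
  have h := (Lp.memLp (cantorDilation.symm^[n] (cantorTranslation k cantorIndicator))).ae_eq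
    (coeFn_iterate_cantorDilation_symm n k)
  have h2 : MemLp ((cantorPiece n k).indicator (fun _ => (1 : ℂ))) 2 cantorHausdorff := by
    convert h.const_mul ((Real.sqrt 2 : ℂ) ^ n)⁻¹ using 1
    ext x
    rw [← mul_assoc, inv_mul_cancel₀ hs, one_mul]
  rw [memLp_indicator_iff_restrict (measurableSet_cantorPiece n k), memLp_const_iff
    (by norm_num) (by norm_num)] at h2
  simpa [lt_top_iff_ne_top] using h2

theorem setIntegral_cantorPiece_eq_zero {η : Lp ℂ 2 cantorHausdorff} {n : ℕ} {k : ℤ}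
    (h : inner ℂ (cantorDilation.symm^[n] (cantorTranslation k cantorIndicator)) η = 0) :
    ∫ x in cantorPiece n k, η x ∂cantorHausdorff = 0 := by
  have hs : (Real.sqrt 2 : ℂ) ^ n ≠ 0 := pow_ne_zero _ (by simp)
  have e : cantorDilation.symm^[n] (cantorTranslation k cantorIndicator) = (Real.sqrt 2 : ℂ) ^ n •
      indicatorConstLp 2 (measurableSet_cantorPiece n k)
        (cantorHausdorff_cantorPiece_ne_top n k) (1 : ℂ) := by
    refine Lp.ext ?_
    filter_upwards [coeFn_iterate_cantorDilation_symm n k, Lp.coeFn_smul ((Real.sqrt 2 : ℂ) ^ n)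
      (indicatorConstLp 2 (measurableSet_cantorPiece n k)
        (cantorHausdorff_cantorPiece_ne_top n k) (1 : ℂ)),
      indicatorConstLp_coeFn (p := 2) (hs := measurableSet_cantorPiece n k)
        (hμs := cantorHausdorff_cantorPiece_ne_top n k) (c := (1 : ℂ))] with x h1 h2 h3
    rw [h1, h2, Pi.smul_apply, h3, smul_eq_mul]
  rw [e, inner_smul_left, L2.inner_indicatorConstLp_one, mul_eq_zero] at h
  exact h.resolve_left (by simp)

/-- Up to a null set, a piece meets a triadic interval of finer level in a finer piece, or not at
all. -/
theorem cantorPiece_inter_Ico_ae_eq (m : ℕ) (l : ℤ) (p : ℕ) (j : ℤ) :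
    (cantorPiece m l ∩ Set.Ico ((j : ℝ) / 3 ^ (m + p)) ((j + 1 : ℝ) / 3 ^ (m + p)) : Set ℝ)
      =ᵐ[cantorHausdorff] cantorPiece (m + p) j ∨
    (cantorPiece m l ∩ Set.Ico ((j : ℝ) / 3 ^ (m + p)) ((j + 1 : ℝ) / 3 ^ (m + p)) : Set ℝ)
      =ᵐ[cantorHausdorff] (∅ : Set ℝ) := by
  obtain ⟨S, hS⟩ := exists_cantorPiece_eq_iUnion m l p
  have hne : ∀ y, ∀ᵐ x ∂cantorHausdorff, x ≠ y := fun y => by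
    rw [ae_iff]; simpa using cantorHausdorff_singleton y
  have hp : (0 : ℝ) < 3 ^ (m + p) := by positivity
  have key : ∀ᵐ x ∂cantorHausdorff, x ∈ cantorPiece m l →
      x ∈ Set.Ico ((j : ℝ) / 3 ^ (m + p)) ((j + 1 : ℝ) / 3 ^ (m + p)) →
      j ∈ S ∧ x ∈ cantorPiece (m + p) j := by
    filter_upwards [hne (j / 3 ^ (m + p))] with x hx hxQ hxI
    rw [hS] at hxQ
    simp only [Set.mem_iUnion, exists_prop] at hxQ
    obtain ⟨i, hi, hxi⟩ := hxQ
    have b := mem_Icc_of_mem_cantorPiece hxi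
    have c1 : (j : ℝ) < 3 ^ (m + p) * x := by
      have := lt_of_le_of_ne hxI.1 hx.symm
      rwa [div_lt_iff₀' hp] at this
    have c2 : 3 ^ (m + p) * x < (j + 1 : ℝ) := by
      have := hxI.2
      rwa [lt_div_iff₀' hp] at this
    have e1 : (j : ℝ) < ((i + 1 : ℤ) : ℝ) := by push_cast; exact c1.trans_le b.2
    have e2 : (i : ℝ) < ((j + 1 : ℤ) : ℝ) := by push_cast; exact b.1.trans_lt c2
    rw [Int.cast_lt] at e1 e2
    obtain rfl : i = j := by omega
    exact ⟨hi, hxi⟩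
  by_cases hj : j ∈ S
  · left
    rw [eventuallyEq_set]
    filter_upwards [key, hne ((j + 1) / 3 ^ (m + p))] with x h1 h2
    refine ⟨fun h => (h1 h.1 h.2).2, fun h => ⟨?_, ?_⟩⟩
    · rw [hS]
      exact Set.mem_biUnion hj h
    · have b := mem_Icc_of_mem_cantorPiece h
      refine ⟨?_, lt_of_le_of_ne ?_ h2⟩
      · rw [div_le_iff₀' hp]; exact b.1
      · rw [le_div_iff₀' hp]; exact b.2
  · right
    rw [eventuallyEq_set]
    filter_upwards [key] with x h1
    simp only [Set.mem_empty_iff_false, iff_false]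
    exact fun h => hj (h1 h.1 h.2).1

/-- The triadic rationals. -/
def triadic : Set ℝ := {x | ∃ (n : ℕ) (k : ℤ), x = k / 3 ^ n}

theorem dense_triadic : Dense triadic := by
  refine dense_of_exists_between fun a b hab => ?_
  obtain ⟨n, hn⟩ := exists_pow_lt_of_lt_one (sub_pos.2 hab) (by norm_num : (3 : ℝ)⁻¹ < 1)
  have hp : (0 : ℝ) < 3 ^ n := by positivity
  refine ⟨((⌊3 ^ n * a⌋ + 1 : ℤ) : ℝ) / 3 ^ n, ⟨n, _, rfl⟩, ?_, ?_⟩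
  · rw [lt_div_iff₀' hp]
    push_cast
    exact Int.lt_floor_add_one _
  · rw [div_lt_iff₀' hp]
    push_cast
    have := Int.floor_le (3 ^ n * a)
    rw [inv_pow, inv_lt_iff_one_lt_mul₀' hp] at hn
    nlinarith

/-- The interval is built from `q` cells of length `3^{-(m+p)}`; over each cell the integral is one
over a whole finer piece or over a null set. -/
theorem setIntegral_cantorPiece_inter_Ico {η : ℝ → ℂ} {m : ℕ} {l : ℤ}
    (hη : IntegrableOn η (cantorPiece m l) cantorHausdorff)
    (h : ∀ n k, ∫ x in cantorPiece n k, η x ∂cantorHausdorff = 0) (p : ℕ) (j : ℤ) (q : ℕ) :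
    ∫ x in cantorPiece m l ∩ Set.Ico ((j : ℝ) / 3 ^ (m + p)) ((j + q : ℝ) / 3 ^ (m + p)),
      η x ∂cantorHausdorff = 0 := by
  have hp : (0 : ℝ) < 3 ^ (m + p) := by positivity
  induction q with
  | zero => simp
  | succ q ih =>
    have hu : Set.Ico ((j : ℝ) / 3 ^ (m + p)) ((j + (q + 1 : ℕ) : ℝ) / 3 ^ (m + p))
        = Set.Ico ((j : ℝ) / 3 ^ (m + p)) ((j + q : ℝ) / 3 ^ (m + p)) ∪
          Set.Ico ((j + q : ℝ) / 3 ^ (m + p)) ((j + (q + 1 : ℕ) : ℝ) / 3 ^ (m + p)) := by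
      rw [Set.Ico_union_Ico_eq_Ico]
      · gcongr; simp
      · gcongr; simp
    rw [hu, Set.inter_union_distrib_left, setIntegral_union _ ((measurableSet_cantorPiece m l).inter
      measurableSet_Ico) (hη.mono_set Set.inter_subset_left) (hη.mono_set Set.inter_subset_left),
      ih, zero_add]
    · have := cantorPiece_inter_Ico_ae_eq m l p (j + q)
      push_cast at this ⊢
      rw [← add_assoc]
      rcases this with h1 | h1
      · rw [setIntegral_congr_set h1, h]
      · rw [setIntegral_congr_set h1]; simp
    · exact (Set.Ico_disjoint_Ico_same).mono Set.inter_subset_right Set.inter_subset_right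

/-- Dynkin's lemma: half-open intervals with triadic endpoints form a π-system generating the Borel
sets. The complement step uses that the integral over the whole piece vanishes. -/
theorem setIntegral_cantorPiece_inter {η : ℝ → ℂ} {m : ℕ} {l : ℤ}
    (hη : IntegrableOn η (cantorPiece m l) cantorHausdorff)
    (h : ∀ n k, ∫ x in cantorPiece n k, η x ∂cantorHausdorff = 0) {A : Set ℝ}
    (hA : MeasurableSet A) : ∫ x in cantorPiece m l ∩ A, η x ∂cantorHausdorff = 0 := by
  have hgen : (inferInstance : MeasurableSpace ℝ) = .generateFrom
      {S : Set ℝ | ∃ l ∈ triadic, ∃ u ∈ triadic, l < u ∧ Set.Ico l u = S} := by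
    rw [← dense_triadic.borel_eq_generateFrom_Ico_mem]
    exact BorelSpace.measurable_eq
  induction A, hA using MeasurableSpace.induction_on_inter hgen
    (isPiSystem_Ico_mem triadic triadic) with
  | empty => simp
  | basic A hA =>
    obtain ⟨_, ⟨n, k, rfl⟩, _, ⟨n', k', rfl⟩, hlt, rfl⟩ := hA
    -- Both endpoints are put over the common denominator `3^{m+n+n'}`, at least as fine as the
    -- piece.
    have e1 : (k : ℝ) / 3 ^ n = ((k * 3 ^ (m + n') : ℤ) : ℝ) / 3 ^ (m + (n + n')) := by
      push_cast
      field_simp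
      ring
    have e2 : (k' : ℝ) / 3 ^ n' = ((k' * 3 ^ (m + n) : ℤ) : ℝ) / 3 ^ (m + (n + n')) := by
      push_cast
      field_simp
      ring
    rw [e1, e2] at hlt ⊢
    have hlt' : k * 3 ^ (m + n') < k' * 3 ^ (m + n) := by
      rw [div_lt_div_iff_of_pos_right (by positivity)] at hlt
      exact_mod_cast hlt
    obtain ⟨q, hq⟩ := Int.eq_ofNat_of_zero_le (sub_nonneg.2 hlt'.le)
    have e3 : k' * 3 ^ (m + n) = k * 3 ^ (m + n') + q := by omega
    rw [e3, Int.cast_add, Int.cast_natCast]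
    exact setIntegral_cantorPiece_inter_Ico hη h _ _ q
  | compl A hA ih =>
    have := integral_inter_add_sdiff hA hη
    rw [ih, h, zero_add] at this
    rwa [← Set.sdiff_eq]
  | iUnion f hd hm ih =>
    rw [Set.inter_iUnion, integral_iUnion (fun i => (measurableSet_cantorPiece m l).inter (hm i))
      (fun i j hij => (hd hij).mono Set.inter_subset_right Set.inter_subset_right)
      (hη.mono_set (Set.iUnion_subset fun i => Set.inter_subset_left))]
    simp [ih]

/-- Working one piece at a time keeps `η` integrable; countably many pieces exhaust `𝓡`. This
supplies totality, as the vectors `U⁻ⁿ τ k φ` are multiples of indicators of pieces. -/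
theorem eq_zero_of_setIntegral_cantorPiece {η : Lp ℂ 2 cantorHausdorff}
    (h : ∀ n k, ∫ x in cantorPiece n k, η x ∂cantorHausdorff = 0) : η = 0 := by
  have hae : ∀ n k, ∀ᵐ x ∂cantorHausdorff, x ∈ cantorPiece n k → η x = 0 := by
    intro n k
    have hfi : IntegrableOn η (cantorPiece n k) cantorHausdorff :=
      integrableOn_Lp_of_measure_ne_top η (by norm_num) (cantorHausdorff_cantorPiece_ne_top n k)
    rw [← ae_restrict_iff' (measurableSet_cantorPiece n k)]
    refine Integrable.ae_eq_zero_of_forall_setIntegral_eq_zero hfi fun A hA _ => ?_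
    rw [Measure.restrict_restrict hA, Set.inter_comm]
    exact setIntegral_cantorPiece_inter hfi h hA
  refine Lp.ext ?_
  have hR : ∀ᵐ x ∂cantorHausdorff, x ∈ enlargedCantorSet :=
    ae_restrict_mem measurableSet_enlargedCantorSet
  filter_upwards [Lp.coeFn_zero ℂ 2 cantorHausdorff, ae_all_iff.2 fun n => ae_all_iff.2 (hae n), hR]
    with x h0 h1 h2
  obtain ⟨n, k, hx⟩ := mem_enlargedCantorSet_iff.1 h2
  rw [h0, h1 n k hx]
  rfl

theorem indicator_cantorSet_div_three {x : ℝ} (hx : ¬ (x ∈ cantorSet ∧ x ∈ cantorPiece 0 2)) :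
    cantorSet.indicator (fun _ => (1 : ℂ)) (x / 3)
      = cantorSet.indicator (fun _ => (1 : ℂ)) x
        + cantorSet.indicator (fun _ => (1 : ℂ)) (x - 2) := by
  have h := mem_cantorSet_iff (x / 3)
  rw [mul_div_cancel₀ x (by norm_num : (3 : ℝ) ≠ 0)] at h
  rw [mem_cantorPiece, pow_zero, one_mul] at hx
  classical simp only [Set.indicator_apply]
  push_cast at hx
  by_cases h1 : x ∈ cantorSet <;> by_cases h2 : x - 2 ∈ cantorSet <;> simp_all

theorem cantorTranslation_add (j k : ℤ) (ξ : Lp ℂ 2 cantorHausdorff) :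
    cantorTranslation (j + k) ξ = cantorTranslation j (cantorTranslation k ξ) := by
  refine Lp.ext ?_
  filter_upwards [coeFn_cantorTranslation (j + k) ξ, ae_sub_intCast (coeFn_cantorTranslation k ξ) j,
    coeFn_cantorTranslation j (cantorTranslation k ξ)] with x h1 h2 h3
  rw [h1, h3, h2, Int.cast_add, sub_sub]

theorem cantorTranslation_zero (ξ : Lp ℂ 2 cantorHausdorff) : cantorTranslation 0 ξ = ξ := by
  refine Lp.ext ?_
  filter_upwards [coeFn_cantorTranslation 0 ξ] with x h1
  rw [h1, Int.cast_zero, sub_zero]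

theorem cantorDilation_eq_iff (ξ : Lp ℂ 2 cantorHausdorff) :
    cantorDilation ξ = (Real.sqrt 2 : ℂ)⁻¹ • (ξ + cantorTranslation 2 ξ) ↔
      ∀ᵐ x ∂cantorHausdorff, ξ (x / 3) = ξ x + ξ (x - 2) := by
  have hs : (Real.sqrt 2 : ℂ)⁻¹ ≠ 0 := by simp
  rw [Lp.ext_iff]
  refine eventually_congr ?_
  filter_upwards [coeFn_cantorDilation ξ,
    Lp.coeFn_smul (Real.sqrt 2 : ℂ)⁻¹ (ξ + cantorTranslation 2 ξ),
    Lp.coeFn_add ξ (cantorTranslation 2 ξ), coeFn_cantorTranslation 2 ξ] with x h1 h2 h3 h4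
  rw [h1, h2, Pi.smul_apply, h3, Pi.add_apply, h4, smul_eq_mul, Int.cast_ofNat]
  exact mul_right_inj' hs

theorem isCantorSystem_cantorHausdorff :
    IsCantorSystem cantorDilation cantorTranslation cantorVector where
  add := cantorTranslation_add
  zero := cantorTranslation_zero
  inner_left k u v := by
    conv_lhs => rw [← cantorTranslation_zero v, ← add_neg_cancel k, cantorTranslation_add,
      inner_cantorTranslation]
  dilate k v := by
    refine Lp.ext ?_
    filter_upwards [coeFn_cantorDilation (cantorTranslation k v),
      ae_div_three (coeFn_cantorTranslation k v),
      coeFn_cantorTranslation (3 * k) (cantorDilation v),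
      ae_sub_intCast (coeFn_cantorDilation v) (3 * k)] with x h1 h2 h3 h4
    rw [h1, h2, h3, h4]
    congr 2
    push_cast
    ring
  scaling := by
    rw [cantorDilation_eq_iff]
    filter_upwards [coeFn_cantorVector, ae_div_three coeFn_cantorVector,
      ae_sub_intCast coeFn_cantorVector 2, ae_notMem_intersection 2 (by norm_num)]
      with x h1 h2 h3 h4
    rw [Int.cast_ofNat] at h3
    rw [h1, h2, h3, ← mul_add, indicator_cantorSet_div_three h4]
  orth k := by
    rw [cantorVector, map_smul, inner_smul_left, inner_smul_right,
      inner_cantorIndicator_cantorTranslation]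
    split_ifs with hk
    · rw [← Complex.ofReal_inv, Complex.conj_ofReal, ← Complex.ofReal_mul, ← Complex.ofReal_mul,
        ← mul_assoc, ← mul_inv, Real.mul_self_sqrt real_cantorSet_pos.le,
        inv_mul_cancel₀ real_cantorSet_pos.ne', Complex.ofReal_one]
    · simp
  total η hη := by
    refine eq_zero_of_setIntegral_cantorPiece fun n k => setIntegral_cantorPiece_eq_zero ?_
    have := hη n k
    rw [cantorVector, map_smul, iterate_map_smul, inner_smul_left, mul_eq_zero] at this
    exact this.resolve_left (by simpa using sqrt_real_cantorSet_ne_zero)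

/-- The substitution `x ↦ 3x` and its inverse preserve null sets, which turns the equation at `x /
3` into the one at `x`; normalising the indicator only changes the constant. -/
theorem refinementUnique_cantorHausdorff_iff :
    RefinementUnique cantorDilation cantorTranslation cantorVector ↔
      ∀ ξ : Lp ℂ 2 cantorHausdorff,
        (∀ᵐ x ∂cantorHausdorff, ξ x = ξ (3 * x) + ξ (3 * x - 2)) →
        ∃ c : ℂ, ∀ᵐ x ∂cantorHausdorff,
          ξ x = c * cantorSet.indicator (fun _ => (1 : ℂ)) x := by
  refine forall_congr' fun ξ => imp_congr ?_ ?_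
  · rw [cantorDilation_eq_iff]
    refine ⟨fun h => ?_, fun h => ?_⟩
    · filter_upwards [ae_three_mul h] with x hx
      rwa [mul_div_cancel_left₀ x (by norm_num : (3 : ℝ) ≠ 0)] at hx
    · filter_upwards [ae_div_three h] with x hx
      rwa [mul_div_cancel₀ x (by norm_num : (3 : ℝ) ≠ 0)] at hx
  · constructor
    · rintro ⟨c, rfl⟩
      refine ⟨c * ((Real.sqrt (cantorHausdorff.real cantorSet) : ℝ) : ℂ)⁻¹, ?_⟩
      filter_upwards [coeFn_cantorVector, Lp.coeFn_smul c cantorVector] with x h1 h2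
      rw [h2, Pi.smul_apply, h1, smul_eq_mul, mul_assoc]
    · rintro ⟨c, hc⟩
      refine ⟨c * ((Real.sqrt (cantorHausdorff.real cantorSet) : ℝ) : ℂ), Lp.ext ?_⟩
      filter_upwards [hc, coeFn_cantorVector, Lp.coeFn_smul
        (c * ((Real.sqrt (cantorHausdorff.real cantorSet) : ℝ) : ℂ)) cantorVector] with x h1 h2 h3
      rw [h1, h3, Pi.smul_apply, h2, smul_eq_mul, mul_assoc,
        mul_inv_cancel_left₀ sqrt_real_cantorSet_ne_zero]

end CantorWavelet

end

theorem theorem3p2 :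
    -- the wavelet representation exists
    (∃ (H : Type) (_ : NormedAddCommGroup H) (_ : InnerProductSpace ℂ H) (_ : CompleteSpace H)
      (U : H ≃ₗᵢ[ℂ] H)
      (π : CantorWavelet.LInftyRep (AddCircle.haarAddCircle (T := (1 : ℝ))) H) (φ : H),
      CantorWavelet.IsCantorWaveletRep U π φ) ∧
    -- and for each realization of it the three assertions are equivalent
    ∀ (H : Type*) [NormedAddCommGroup H] [InnerProductSpace ℂ H] [CompleteSpace H]
      (U : H ≃ₗᵢ[ℂ] H)
      (π : CantorWavelet.LInftyRep (AddCircle.haarAddCircle (T := (1 : ℝ))) H) (φ : H),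
      CantorWavelet.IsCantorWaveletRep U π φ →
      List.TFAE [
        CantorWavelet.IsIrreducible U π,
        ∀ a : lp (fun _ : ℤ => ℂ) 2,
          MeasureTheory.MemLp (CantorWavelet.fourierSeries a) ⊤
            (AddCircle.haarAddCircle (T := (1 : ℝ))) →
          (∀ k : ℤ, a k = 1 / 2 * a (3 * k - 2) + a (3 * k) + 1 / 2 * a (3 * k + 2)) →
          ∀ k : ℤ, k ≠ 0 → a k = 0,
        ∀ ξ : MeasureTheory.Lp ℂ 2 CantorWavelet.cantorHausdorff,
          (∀ᵐ x ∂CantorWavelet.cantorHausdorff, ξ x = ξ (3 * x) + ξ (3 * x - 2)) →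
          ∃ c : ℂ, ∀ᵐ x ∂CantorWavelet.cantorHausdorff,
            ξ x = c * cantorSet.indicator (fun _ => (1 : ℂ)) x] := by
  refine ⟨⟨CantorWavelet.ModelSpace, inferInstance, inferInstance, inferInstance,
    CantorWavelet.modelDilation, CantorWavelet.modelRep,
    CantorWavelet.modelVector, CantorWavelet.isCantorWaveletRep_model⟩, ?_⟩
  intro H _ _ _ U π φ W
  have h12 := W.isIrreducible_iff.trans CantorWavelet.boundedHarmonicConst_iff
  have h23 := CantorWavelet.boundedHarmonicConst_iff.symm.trans
    (CantorWavelet.isCantorSystem_cantorHausdorff.refinementUnique_iff.symm.trans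
      CantorWavelet.refinementUnique_cantorHausdorff_iff)
  tfae_have 1 ↔ 2 := h12
  tfae_have 2 ↔ 3 := h23
  tfae_finish
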